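/- Let $\Omega\subset\mathbb R^3$ be a bounded open set with smooth boundary, let $g$ be a Riemannian metric on $\Omega$, smooth up to $\partial\Omega$, and let $\Omega=D_0\supset D_1\supset\dots\supset D_k$ ($k\ge0$) be open sets with smooth boundaries and $\overline{D_{j+1}}\subset D_j$. The interfaces $\Gamma_j=\partial D_j$, $1\le j\le k$, split $\Omega$ into the layers $D_j\setminus\overline{D_{j+1}}$ ($0\le j\le k$, $D_{k+1}=\emptyset$). Let $\lambda,\mu,\rho>0$ be smooth and positive up to the boundary in each layer, with possible jumps across the interfaces. For a complex covector field $u$ put $$(d^su)_{ij}=\tfrac12(\nabla_iu_j+\nabla_ju_i),\quad \delta u=\nabla^iu_i,\quad \sigma(u)=\lambda(\delta u)g+2\mu\,d^su,\quad (Eu)_i=\rho^{-1}\nabla^j\sigma_{ij}(u),\quad (Nu)_i=\sigma_{ij}(u)\nu^j,$$ where $\nu$ is the unit normal. Let $E$ be defined on the space $\mathcal C$ of all $u$ which are smooth up to the boundary in each layer and satisfy $[u]=0$, $[Nu]=0$ on every $\Gamma_j$, and $u=0$ on $\partial\Omega$. Here $L^2(\Omega,\rho\,d\mathrm{Vol})$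 is the Hilbert space of covector fields with inner product $\int_\Omega g^{ij}u_i\bar v_j\,\rho\,d\mathrm{Vol}$. Then: 1. $E$ is a well-defined, densely defined and symmetric operator in $L^2(\Omega,\rho\,d\mathrm{Vol})$, and it extends to a self-adjoint operator $A$. 2. Let $V\subset L^2(\Omega,\rho\,d\mathrm{Vol})$ be the space of finite energy fields with zero Dirichlet data, i.e. the $u$ with a strain $d^su\in L^2$ such that $(u,d^su)$ is in the $L^2$-closure of $\{(w,d^sw):w\in\mathcal C\}$; the strain of $u\in V$ is unique. The extension $A$ can be chosen with $D(A)\subset V$ and $(-Au,v)=\int_\Omega\big(\lambda\,\delta u\,\overline{\delta v}+2\mu\langle d^su,d^sv\rangle\big)d\mathrm{Vol}$ for all $u\in D(A)$, $v\in V$, where $\delta u$ is the trace of $d^su$ and $\langle\cdot,\cdot\rangle$ is the Hermitian inner product of tensors. Moreover, for this $A$, 3 and 4 hold. 3. The energy space $\mathcal H=V\times L^2(\Omega,\rho\,d\mathrm{Vol})$ is a Hilbert space with the norm $$\|(f_1,f_2)\|_{\mathcal H}^2=\int_\Omega\big(\lambda|\delta f_1|^2+2\mu|d^sf_1|^2+\rho|f_2|^2\big)\,d\mathrm{Vol},$$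 and the operator $\mathbf E(u_1,u_2)=(u_2,Au_1)$ with domain $D(A)\times V$ is densely defined and skew-adjoint on $\mathcal H$ (i.e. $\mathbf E^*=-\mathbf E$). 4. $\mathbf E$ is the generator of a strongly continuous one-parameter group $U(t)$, $t\in\mathbb R$, of unitary operators on $\mathcal H$. This group solves the Cauchy problem with Dirichlet boundary conditions: for $(f_1,f_2)\in D(A)\times V$, with $(u(t),v(t))=U(t)(f_1,f_2)$, one has $u'(t)=v(t)$, $u(t)\in D(A)$ and $v'(t)=Au(t)$ for all $t\in\mathbb R$, with derivatives in $L^2(\Omega,\rho\,d\mathrm{Vol})$, and $u(0)=f_1$, $v(0)=f_2$; the solution $(u,v)$ with these properties is unique. -/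

import Mathlib

open MeasureTheory Set Filter Topology ComplexConjugate
open scoped ContDiff

noncomputable section

/-- A measurable field of real symmetric matrices on `(α, m)` which is bounded and uniformly
positive definite `m`-almost everywhere. -/
structure FiberWeight {α : Type*} [MeasurableSpace α] (m : Measure α)
    (ι : Type*) [Fintype ι] where
  mat : α → Matrix ι ι ℝ
  symm : ∀ x i j, mat x i j = mat x j i
  meas : ∀ i j, Measurable fun x => mat x i j
  bdd : ∃ C : ℝ, ∀ᵐ x ∂m, ∀ i j, |mat x i j| ≤ C
  coercive : ∃ c : ℝ, 0 < c ∧ ∀ᵐ x ∂m, ∀ v : ι → ℝ,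
    c * ∑ i, v i ^ 2 ≤ ∑ i, ∑ j, mat x i j * (v i * v j)

/-- The sesquilinear form `∑ Wᵢⱼ conj(vᵢ) wⱼ`. -/
def hermForm {ι : Type*} [Fintype ι] (W : Matrix ι ι ℝ) (v w : EuclideanSpace ℂ ι) : ℂ :=
  ∑ i, ∑ j, (W i j : ℂ) * (conj (v i) * w j)

/-- The space of square integrable `ℂ^ι`-valued fields on `(α, m)`, with the fibrewise inner
product given by the weight `w`, that is `⟪u, v⟫ = ∫ ∑ wᵢⱼ(x) conj(uᵢ(x)) vⱼ(x) dm(x)`. -/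
def WL2 {α : Type*} [MeasurableSpace α] {m : Measure α} {ι : Type*} [Fintype ι]
    (_w : FiberWeight m ι) : Type _ :=
  Lp (EuclideanSpace ℂ ι) 2 m

namespace WL2

variable {α : Type*} [MeasurableSpace α] {m : Measure α} {ι : Type*} [Fintype ι]
  {w : FiberWeight m ι}

instance : AddCommGroup (WL2 w) := inferInstanceAs (AddCommGroup (Lp (EuclideanSpace ℂ ι) 2 m))

instance : Module ℂ (WL2 w) := inferInstanceAs (Module ℂ (Lp (EuclideanSpace ℂ ι) 2 m))

/-- The underlying element of the unweighted space `L²(m; ℂ^ι)`. -/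
def toLp (u : WL2 w) : Lp (EuclideanSpace ℂ ι) 2 m := u

instance : CoeFun (WL2 w) (fun _ => α → EuclideanSpace ℂ ι) := ⟨fun u => (toLp u : α → _)⟩

theorem coe_add (u v : WL2 w) : (⇑(u + v).toLp : α → _) =ᵐ[m] fun x => u x + v x :=
  Lp.coeFn_add u.toLp v.toLp

theorem coe_smul (c : ℂ) (u : WL2 w) : (⇑(c • u).toLp : α → _) =ᵐ[m] fun x => c • u x :=
  Lp.coeFn_smul c u.toLp

theorem coe_zero : (⇑(0 : WL2 w).toLp : α → _) =ᵐ[m] fun _ => 0 :=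
  Lp.coeFn_zero _ _ _

/-- The weighted inner product. -/
def ip (u v : WL2 w) : ℂ := ∫ x, hermForm (w.mat x) (u x) (v x) ∂m

theorem memLp_coord (u : WL2 w) (i : ι) : MemLp (fun x => u x i) 2 m := by
  refine (Lp.memLp u.toLp).mono ?_ (Eventually.of_forall fun x => PiLp.norm_apply_le _ i)
  exact (PiLp.continuous_apply 2 _ i).comp_aestronglyMeasurable (Lp.aestronglyMeasurable u.toLp)

theorem integrable_hermForm (u v : WL2 w) :
    Integrable (fun x => hermForm (w.mat x) (u x) (v x)) m := by
  unfold hermForm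
  refine integrable_finsetSum _ fun i _ => integrable_finsetSum _ fun j _ => ?_
  obtain ⟨C, hC⟩ := w.bdd
  refine Integrable.bdd_mul (c := C) ?_ ?_ ?_
  · exact (memLp_coord u i).star.integrable_mul (memLp_coord v j)
  · exact (Complex.measurable_ofReal.comp (w.meas i j)).aestronglyMeasurable
  · filter_upwards [hC] with x hx
    simpa using hx i j

theorem hermForm_self_re (W : Matrix ι ι ℝ) (v : EuclideanSpace ℂ ι) :
    (hermForm W v v).re = ∑ i, ∑ j, W i j * ((v i).re * (v j).re) +
      ∑ i, ∑ j, W i j * ((v i).im * (v j).im) := by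
  simp only [hermForm, Complex.re_sum, ← Finset.sum_add_distrib]
  refine Finset.sum_congr rfl fun i _ => Finset.sum_congr rfl fun j _ => ?_
  simp only [Complex.mul_re, Complex.ofReal_re, Complex.ofReal_im, Complex.conj_re,
    Complex.conj_im]
  ring

theorem norm_sq_eq_integral (u : WL2 w) : ‖u.toLp‖ ^ 2 = ∫ x, ‖u x‖ ^ 2 ∂m := by
  have h := L2.inner_def (𝕜 := ℂ) u.toLp u.toLp
  have h2 : (∫ x, inner ℂ (u x) (u x) ∂m) = ((∫ x, ‖u x‖ ^ 2 ∂m : ℝ) : ℂ) := by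
    rw [← integral_complex_ofReal]
    refine integral_congr_ae (Eventually.of_forall fun x => ?_)
    simp [inner_self_eq_norm_sq_to_K]
  rw [h2, inner_self_eq_norm_sq_to_K] at h
  exact Complex.ofReal_injective (by simpa using h)

theorem re_ip_self (u : WL2 w) :
    (ip u u).re = ∫ x, (hermForm (w.mat x) (u x) (u x)).re ∂m := by
  rw [ip]
  exact (integral_re (integrable_hermForm u u)).symm

theorem exists_lower (w : FiberWeight m ι) :
    ∃ c : ℝ, 0 < c ∧ ∀ u : WL2 w, c * ‖u.toLp‖ ^ 2 ≤ (ip u u).re := by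
  obtain ⟨c, hc, h⟩ := w.coercive
  refine ⟨c, hc, fun u => ?_⟩
  rw [re_ip_self, norm_sq_eq_integral, ← integral_const_mul]
  refine integral_mono_ae ?_ (integrable_hermForm u u).re ?_
  · exact ((memLp_two_iff_integrable_sq_norm (Lp.aestronglyMeasurable u.toLp)).1
      (Lp.memLp u.toLp)).const_mul c
  · filter_upwards [h] with x hx
    have h1 := hx fun i => (u x i).re
    have h2 := hx fun i => (u x i).im
    have e : ‖u x‖ ^ 2 = ∑ i, (u x i).re ^ 2 + ∑ i, (u x i).im ^ 2 := by
      rw [EuclideanSpace.norm_sq_eq, ← Finset.sum_add_distrib]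
      refine Finset.sum_congr rfl fun i _ => ?_
      rw [Complex.sq_norm, Complex.normSq_apply]
      ring
    change c * ‖u x‖ ^ 2 ≤ (hermForm (w.mat x) (u x) (u x)).re
    rw [e, hermForm_self_re]
    linarith

theorem exists_upper (w : FiberWeight m ι) :
    ∃ C : ℝ, 0 ≤ C ∧ ∀ u : WL2 w, (ip u u).re ≤ C * ‖u.toLp‖ ^ 2 := by
  obtain ⟨C, h⟩ := w.bdd
  refine ⟨∑ _i : ι, ∑ _j : ι, |C|, by positivity, fun u => ?_⟩
  rw [re_ip_self, norm_sq_eq_integral, ← integral_const_mul]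
  refine integral_mono_ae (integrable_hermForm u u).re ?_ ?_
  · exact ((memLp_two_iff_integrable_sq_norm (Lp.aestronglyMeasurable u.toLp)).1
      (Lp.memLp u.toLp)).const_mul _
  · filter_upwards [h] with x hx
    change (hermForm (w.mat x) (u x) (u x)).re ≤ (∑ _i : ι, ∑ _j : ι, |C|) * ‖u x‖ ^ 2
    refine (Complex.re_le_norm _).trans ?_
    unfold hermForm
    simp only [Finset.sum_mul]
    refine (norm_sum_le _ _).trans (Finset.sum_le_sum fun i _ => ?_)
    refine (norm_sum_le _ _).trans (Finset.sum_le_sum fun j _ => ?_)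
    rw [norm_mul, norm_mul, RCLike.norm_conj, Complex.norm_real, Real.norm_eq_abs, pow_two]
    have h1 : ‖u x i‖ ≤ ‖u x‖ := PiLp.norm_apply_le _ i
    have h2 : ‖u x j‖ ≤ ‖u x‖ := PiLp.norm_apply_le _ j
    have h3 : |w.mat x i j| ≤ |C| := (hx i j).trans (le_abs_self C)
    gcongr

/-- The inner product axioms for the weighted space. -/
@[reducible] def core (w : FiberWeight m ι) : InnerProductSpace.Core ℂ (WL2 w) where
  inner := ip
  conj_inner_symm u v := by
    rw [ip, ip, ← integral_conj]
    refine integral_congr_ae (Eventually.of_forall fun x => ?_)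
    simp only [hermForm, map_sum, map_mul, Complex.conj_conj, Complex.conj_ofReal]
    rw [Finset.sum_comm]
    refine Finset.sum_congr rfl fun i _ => Finset.sum_congr rfl fun j _ => ?_
    rw [w.symm x j i]
    ring
  re_inner_nonneg u := by
    obtain ⟨c, hc, h⟩ := exists_lower w
    exact le_trans (by positivity) (h u)
  add_left u v z := by
    rw [ip, ip, ip, ← integral_add (integrable_hermForm u z) (integrable_hermForm v z)]
    refine integral_congr_ae ?_
    filter_upwards [coe_add u v] with x hx
    simp only [hx, hermForm, ← Finset.sum_add_distrib, PiLp.add_apply, map_add]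
    refine Finset.sum_congr rfl fun i _ => Finset.sum_congr rfl fun j _ => ?_
    ring
  smul_left u v r := by
    rw [ip, ip, ← integral_const_mul]
    refine integral_congr_ae ?_
    filter_upwards [coe_smul r u] with x hx
    simp only [hx, hermForm, Finset.mul_sum, PiLp.smul_apply, smul_eq_mul, map_mul]
    refine Finset.sum_congr rfl fun i _ => Finset.sum_congr rfl fun j _ => ?_
    ring
  definite u hu := by
    obtain ⟨c, hc, h⟩ := exists_lower w
    have h1 := h u
    have h2 : (ip u u).re = 0 := congrArg Complex.re hu
    rw [h2] at h1
    have h3 : ‖u.toLp‖ ^ 2 ≤ 0 := by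
      by_contra hlt
      push Not at hlt
      have := mul_pos hc hlt
      linarith
    have h4 : ‖u.toLp‖ = 0 := by nlinarith [norm_nonneg u.toLp, sq_nonneg ‖u.toLp‖]
    exact norm_eq_zero.1 h4

instance : NormedAddCommGroup (WL2 w) := (core w).toNormedAddCommGroup

instance : InnerProductSpace ℂ (WL2 w) := InnerProductSpace.ofCore (core w).toCore

theorem inner_def (u v : WL2 w) :
    inner ℂ u v = ∫ x, hermForm (w.mat x) (u x) (v x) ∂m := rfl

theorem norm_sq (u : WL2 w) : ‖u‖ ^ 2 = (ip u u).re :=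
  (inner_self_eq_norm_sq (𝕜 := ℂ) u).symm

/-- The identity, as a linear map onto the unweighted space. -/
def toLpₗ (w : FiberWeight m ι) : WL2 w →ₗ[ℂ] Lp (EuclideanSpace ℂ ι) 2 m where
  toFun u := u.toLp
  map_add' _ _ := rfl
  map_smul' _ _ := rfl

instance : CompleteSpace (WL2 w) := by
  obtain ⟨c, hc, hl⟩ := exists_lower w
  obtain ⟨C, hC, hu⟩ := exists_upper w
  have hA : AntilipschitzWith (Real.toNNReal (√C)) (toLpₗ w) := by
    refine AddMonoidHomClass.antilipschitz_of_bound (toLpₗ w) fun u => ?_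
    rw [Real.coe_toNNReal _ (Real.sqrt_nonneg _)]
    refine abs_le_of_sq_le_sq' ?_ (by positivity) |>.2
    rw [mul_pow, Real.sq_sqrt hC, norm_sq]
    exact hu u
  have hL : LipschitzWith (Real.toNNReal (√c⁻¹)) (toLpₗ w) := by
    refine AddMonoidHomClass.lipschitz_of_bound (toLpₗ w) _ fun u => ?_
    refine abs_le_of_sq_le_sq' ?_ (by positivity) |>.2
    rw [mul_pow, Real.sq_sqrt (by positivity), norm_sq, ← div_eq_inv_mul, le_div_iff₀ hc,
      mul_comm]
    exact hl u
  have hU := hA.isUniformInducing hL.uniformContinuous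
  exact (hU.completeSpace_congr fun y => ⟨y, rfl⟩).2 inferInstance

end WL2

/-! ## Layered domains -/

/-- Euclidean three-space. -/
abbrev E3 := EuclideanSpace ℝ (Fin 3)

/-- Values of complex covector fields: the components `uᵢ`. -/
abbrev C3 := EuclideanSpace ℂ (Fin 3)

/-- Values of complex covariant `2`-tensor fields: the components `eᵢⱼ`. -/
abbrev T2 := EuclideanSpace ℂ (Fin 3 × Fin 3)

/-- The partial derivative `∂ᵢ f`. -/
def pd {F : Type*} [NormedAddCommGroup F] [NormedSpace ℝ F] (i : Fin 3) (f : E3 → F) (x : E3) : F :=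
  fderiv ℝ f x (EuclideanSpace.single i 1)

/-- `φ` is a smooth defining function of the set `D` near `x`: its differential at `x` does not
vanish, and `D = {φ < 0}` near `x`. -/
structure IsLocalDefining (D : Set E3) (x : E3) (φ : E3 → ℝ) : Prop where
  smooth : ContDiff ℝ ∞ φ
  fderiv_ne : fderiv ℝ φ x ≠ 0
  mem_iff : ∀ᶠ y in 𝓝 x, (y ∈ D ↔ φ y < 0)

/-- The boundary of the set `D` is a smooth surface, with `D` locally on one side of it. -/
def HasSmoothBoundary (D : Set E3) : Prop :=
  ∀ x ∈ frontier D, ∃ φ, IsLocalDefining D x φ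

/-- For nested sets `D 0 ⊇ D 1 ⊇ ⋯`, the `j`-th layer together with both its exterior boundary
`∂(D j)` and its interior boundary `∂(D (j+1))`. -/
def closedLayer {k : ℕ} (D : Fin (k + 1) → Set E3) (j : Fin (k + 1)) : Set E3 :=
  closure (D j) \ ⋃ i, ⋃ _ : j < i, D i

/-- The `j`-th layer, without its exterior boundary. These sets partition `D 0`. -/
def layer {k : ℕ} (D : Fin (k + 1) → Set E3) (j : Fin (k + 1)) : Set E3 :=
  D j \ ⋃ i, ⋃ _ : j < i, D i

/-- The field which equals `f j` on the `j`-th layer, and `0` outside `D 0`. (The choice made on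
the interfaces, which are null sets, plays no role.) -/
def glue {k : ℕ} (D : Fin (k + 1) → Set E3) {F : Type*} [AddCommMonoid F]
    (f : Fin (k + 1) → E3 → F) (x : E3) : F :=
  ∑ j, (layer D j).indicator (f j) x

/-- An isotropic elastic body: a smooth bounded open set `Ω = D 0` in `ℝ³`, split into `k + 1`
layers by the disjoint closed smooth interfaces `∂(D 1), …, ∂(D k)`, each inside the previous one;
a Riemannian metric `g` on `Ω`, smooth up to the boundary; Lamé parameters `λ, μ > 0` and a density
`ρ > 0`, smooth up to the boundary in each layer and possibly jumping across the interfaces.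

A function is smooth up to the boundary of a layer when it is the restriction of a smooth function
on `ℝ³`. Accordingly the piecewise smooth functions are given here by one smooth function for each
layer; its values off the closed layer are irrelevant. -/
structure ElasticBody where
  /-- the number of interfaces -/
  k : ℕ
  D : Fin (k + 1) → Set E3
  isOpen : ∀ j, IsOpen (D j)
  bounded : Bornology.IsBounded (D 0)
  nested : ∀ i j, i < j → closure (D j) ⊆ D i
  smoothBoundary : ∀ j, HasSmoothBoundary (D j)
  g : E3 → Matrix (Fin 3) (Fin 3) ℝ
  g_smooth : ∀ i j, ContDiff ℝ ∞ fun x => g x i j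
  g_posDef : ∀ x ∈ closure (D 0), (g x).PosDef
  lam : Fin (k + 1) → E3 → ℝ
  mu : Fin (k + 1) → E3 → ℝ
  rho : Fin (k + 1) → E3 → ℝ
  lam_smooth : ∀ j, ContDiff ℝ ∞ (lam j)
  mu_smooth : ∀ j, ContDiff ℝ ∞ (mu j)
  rho_smooth : ∀ j, ContDiff ℝ ∞ (rho j)
  lam_pos : ∀ j, ∀ x ∈ closedLayer D j, 0 < lam j x
  mu_pos : ∀ j, ∀ x ∈ closedLayer D j, 0 < mu j x
  rho_pos : ∀ j, ∀ x ∈ closedLayer D j, 0 < rho j x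

theorem posDef_coercive {X : Type*} [TopologicalSpace X] {ι : Type*} [Fintype ι] {K : Set X}
    (hK : IsCompact K) (W : X → Matrix ι ι ℝ) (hW : ∀ i j, ContinuousOn (fun x => W x i j) K)
    (hpos : ∀ x ∈ K, (W x).PosDef) :
    ∃ c : ℝ, 0 < c ∧ ∀ x ∈ K, ∀ v : ι → ℝ,
      c * ∑ i, v i ^ 2 ≤ ∑ i, ∑ j, W x i j * (v i * v j) := by
  have key : ∀ x ∈ K, ∀ v : EuclideanSpace ℝ ι, v ≠ 0 →
      0 < ∑ i, ∑ j, W x i j * (v i * v j) := by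
    intro x hx v hv
    have h := (hpos x hx).dotProduct_mulVec_pos (x := fun i => v i)
      (fun h => hv (by ext i; exact congrFun h i))
    refine h.trans_le (le_of_eq ?_)
    simp only [dotProduct, Matrix.mulVec, Finset.mul_sum, Pi.star_apply, star_trivial]
    refine Finset.sum_congr rfl fun i _ => Finset.sum_congr rfl fun j _ => ?_
    ring
  let S : Set (X × EuclideanSpace ℝ ι) := K ×ˢ Metric.sphere 0 1
  have hS : IsCompact S := hK.prod (isCompact_sphere _ _)
  have hcont : ContinuousOn (fun p : X × EuclideanSpace ℝ ι =>
      ∑ i, ∑ j, W p.1 i j * (p.2 i * p.2 j)) S := by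
    refine continuousOn_finsetSum _ fun i _ => continuousOn_finsetSum _ fun j _ => ?_
    refine ((hW i j).comp continuousOn_fst fun p hp => hp.1).mul ?_
    fun_prop
  obtain ⟨c, hc, hcS⟩ : ∃ c : ℝ, 0 < c ∧ ∀ p ∈ S, c ≤ ∑ i, ∑ j, W p.1 i j * (p.2 i * p.2 j) := by
    rcases S.eq_empty_or_nonempty with h | h
    · exact ⟨1, one_pos, by simp [h]⟩
    · obtain ⟨p, hp, hmin⟩ := hS.exists_isMinOn h hcont
      refine ⟨_, key p.1 hp.1 p.2 ?_, fun q hq => hmin hq⟩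
      intro h0
      have := hp.2
      simp [h0] at this
  refine ⟨c, hc, fun x hx v => ?_⟩
  set v' : EuclideanSpace ℝ ι := WithLp.toLp 2 v with hv'
  by_cases h0 : v' = 0
  · have : ∀ i, v i = 0 := fun i => congrFun (congrArg WithLp.ofLp h0) i
    simp [this]
  · have hn : ‖v'‖ ≠ 0 := norm_ne_zero_iff.2 h0
    have h1 := hcS (x, ‖v'‖⁻¹ • v') ⟨hx, by simp [norm_smul, hn]⟩
    have h2 : ∑ i, ∑ j, W x i j * ((‖v'‖⁻¹ • v') i * (‖v'‖⁻¹ • v') j) =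
        (‖v'‖ ^ 2)⁻¹ * ∑ i, ∑ j, W x i j * (v i * v j) := by
      simp only [Finset.mul_sum, PiLp.smul_apply, smul_eq_mul]
      refine Finset.sum_congr rfl fun i _ => Finset.sum_congr rfl fun j _ => ?_
      change W x i j * (‖v'‖⁻¹ * v i * (‖v'‖⁻¹ * v j)) = _
      field_simp
    have h3 : ‖v'‖ ^ 2 = ∑ i, v i ^ 2 := by
      rw [EuclideanSpace.norm_sq_eq]
      simp [hv']
    change c ≤ ∑ i, ∑ j, W x i j * ((‖v'‖⁻¹ • v') i * (‖v'‖⁻¹ • v') j) at h1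
    rw [h2, ← div_eq_inv_mul, le_div_iff₀ (by positivity), h3] at h1
    exact h1

namespace ElasticBody

variable (B : ElasticBody)

/-- The domain `Ω`. -/
@[reducible] def Ω : Set E3 := B.D 0

theorem D_subset (j : Fin (B.k + 1)) : B.D j ⊆ B.Ω := by
  rcases eq_or_lt_of_le (Fin.zero_le j) with h | h
  · exact h ▸ subset_rfl
  · exact subset_closure.trans (B.nested 0 j h)

theorem isCompact_closedLayer (j : Fin (B.k + 1)) : IsCompact (closedLayer B.D j) := by
  have h : IsCompact (closure (B.D j)) := (B.bounded.subset (B.D_subset j)).isCompact_closure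
  refine h.diff ?_
  exact isOpen_iUnion fun i => isOpen_iUnion fun _ => B.isOpen i

theorem layer_subset (j : Fin (B.k + 1)) : layer B.D j ⊆ closedLayer B.D j :=
  sdiff_subset_sdiff_left subset_closure

theorem closedLayer_subset (j : Fin (B.k + 1)) : closedLayer B.D j ⊆ closure (B.D 0) :=
  sdiff_subset.trans (closure_mono (B.D_subset j))

theorem measurableSet_layer (j : Fin (B.k + 1)) : MeasurableSet (layer B.D j) :=
  (B.isOpen j).measurableSet.diff
    (isOpen_iUnion fun i => isOpen_iUnion fun _ => B.isOpen i).measurableSet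

theorem exists_mem_layer {x : E3} (hx : x ∈ B.Ω) : ∃ j, x ∈ layer B.D j := by
  classical
  have hne : (Finset.univ.filter fun j => x ∈ B.D j).Nonempty := ⟨0, by simpa using hx⟩
  refine ⟨Finset.max' _ hne, ?_, ?_⟩
  · simpa using Finset.max'_mem _ hne
  · simp only [mem_iUnion, not_exists]
    intro i hi hxi
    exact absurd (Finset.le_max' _ i (by simpa using hxi)) (not_le.2 hi)

theorem layer_disjoint {i j : Fin (B.k + 1)} (hij : i ≠ j) {x : E3} (hi : x ∈ layer B.D i) :
    x ∉ layer B.D j := by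
  intro hj
  rcases lt_or_gt_of_ne hij with h | h
  · exact hi.2 (mem_iUnion.2 ⟨j, mem_iUnion.2 ⟨h, hj.1⟩⟩)
  · exact hj.2 (mem_iUnion.2 ⟨i, mem_iUnion.2 ⟨h, hi.1⟩⟩)

theorem glue_eq {F : Type*} [AddCommMonoid F] (f : Fin (B.k + 1) → E3 → F) {j : Fin (B.k + 1)}
    {x : E3} (hx : x ∈ layer B.D j) : glue B.D f x = f j x := by
  unfold glue
  rw [Finset.sum_eq_single j]
  · simp [hx]
  · intro i _ hij
    exact indicator_of_notMem (B.layer_disjoint hij.symm hx) _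
  · simp

/-- The weight given on each layer by a matrix field, continuous and positive definite on the closed
layer. -/
def layeredWeight {ι : Type} [Fintype ι] (W : Fin (B.k + 1) → E3 → Matrix ι ι ℝ)
    (hm : ∀ j i i', Measurable fun x => W j x i i')
    (hc : ∀ j i i', ContinuousOn (fun x => W j x i i') (closedLayer B.D j))
    (hp : ∀ j, ∀ x ∈ closedLayer B.D j, (W j x).PosDef) :
    FiberWeight (volume.restrict B.Ω) ι where
  mat x := Matrix.of fun i j => glue B.D (fun l y => W l y i j) x
  symm x i j := by
    simp only [Matrix.of_apply, glue]
    refine Finset.sum_congr rfl fun l _ => ?_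
    by_cases hl : x ∈ layer B.D l
    · have := (hp l x (B.layer_subset l hl)).isHermitian.apply i j
      simpa [hl] using this.symm
    · simp [hl]
  meas i j := by
    simp only [Matrix.of_apply, glue]
    exact Finset.measurable_fun_sum _ fun l _ => (hm l i j).indicator (B.measurableSet_layer l)
  bdd := by
    have h : ∀ l i j, ∃ C, ∀ x ∈ closedLayer B.D l, |W l x i j| ≤ C := fun l i j =>
      (B.isCompact_closedLayer l).exists_bound_of_continuousOn (hc l i j)
    choose C hC using h
    refine ⟨∑ l, ∑ i, ∑ j, |C l i j|, ?_⟩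
    rw [ae_restrict_iff' (B.isOpen 0).measurableSet]
    refine Eventually.of_forall fun x hx i j => ?_
    obtain ⟨l, hl⟩ := B.exists_mem_layer hx
    simp only [Matrix.of_apply, B.glue_eq _ hl]
    have h0 := (hC l i j x (B.layer_subset l hl)).trans (le_abs_self _)
    have h1 : |C l i j| ≤ ∑ j, |C l i j| :=
      Finset.single_le_sum (f := fun j => |C l i j|) (fun _ _ => abs_nonneg _) (Finset.mem_univ j)
    have h2 : ∑ j, |C l i j| ≤ ∑ i, ∑ j, |C l i j| :=
      Finset.single_le_sum (f := fun i => ∑ j, |C l i j|) (fun _ _ => by positivity)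
        (Finset.mem_univ i)
    have h3 : ∑ i, ∑ j, |C l i j| ≤ ∑ l, ∑ i, ∑ j, |C l i j| :=
      Finset.single_le_sum (f := fun l => ∑ i, ∑ j, |C l i j|) (fun _ _ => by positivity)
        (Finset.mem_univ l)
    linarith
  coercive := by
    have h := fun l => posDef_coercive (B.isCompact_closedLayer l) (W l) (hc l) (hp l)
    choose c hc0 hc using h
    refine ⟨Finset.univ.inf' Finset.univ_nonempty c, ?_, ?_⟩
    · simpa [Finset.lt_inf'_iff] using hc0
    rw [ae_restrict_iff' (B.isOpen 0).measurableSet]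
    refine Eventually.of_forall fun x hx v => ?_
    obtain ⟨l, hl⟩ := B.exists_mem_layer hx
    simp only [Matrix.of_apply, B.glue_eq _ hl]
    refine le_trans ?_ (hc l x (B.layer_subset l hl) v)
    gcongr
    exact Finset.inf'_le _ (Finset.mem_univ l)

/-! ### The Hilbert spaces -/

/-- The components `gⁱʲ` of the inverse metric. -/
def ginv (x : E3) (i j : Fin 3) : ℝ := (B.g x)⁻¹ i j

/-- The Riemannian volume density `√det g`. -/
def volDensity (x : E3) : ℝ := √(B.g x).det

/-- The matrix `ρ √det g gⁱʲ` of the inner product of covectors with respect to `ρ dVol`. -/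
def massMatrix (j : Fin (B.k + 1)) (x : E3) : Matrix (Fin 3) (Fin 3) ℝ :=
  Matrix.of fun a b => B.rho j x * B.volDensity x * B.ginv x a b

/-- The matrix of the elastic energy density: for covariant `2`-tensors `e`, `f`, it gives
`(λ tr e tr f + 2 μ ⟨e, f⟩) √det g`, with trace `gᵃᵇ eₐᵦ` and product
`⟨e, f⟩ = gᵃᶜ gᵇᵈ eₐᵦ f_cd`. -/
def stiffnessMatrix (j : Fin (B.k + 1)) (x : E3) :
    Matrix (Fin 3 × Fin 3) (Fin 3 × Fin 3) ℝ :=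
  Matrix.of fun p q => B.volDensity x *
    (B.lam j x * (B.ginv x p.1 p.2 * B.ginv x q.1 q.2) +
      2 * B.mu j x * (B.ginv x p.1 q.1 * B.ginv x p.2 q.2))

theorem continuous_g : Continuous B.g :=
  continuous_matrix fun i j => (B.g_smooth i j).continuous

theorem ginv_eq (x : E3) (i j : Fin 3) :
    B.ginv x i j = (B.g x).det⁻¹ * (B.g x).adjugate i j := by
  rw [ginv, Matrix.inv_def, Ring.inverse_eq_inv']
  rfl

theorem measurable_ginv (i j : Fin 3) : Measurable fun x => B.ginv x i j := by
  simp only [ginv_eq]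
  exact B.continuous_g.matrix_det.measurable.inv.mul
    (B.continuous_g.matrix_adjugate.matrix_elem i j).measurable

theorem continuousOn_ginv (i j : Fin 3) :
    ContinuousOn (fun x => B.ginv x i j) (closure (B.D 0)) := by
  simp only [ginv_eq]
  exact (B.continuous_g.matrix_det.continuousOn.inv₀ fun x hx => (B.g_posDef x hx).det_pos.ne').mul
    (B.continuous_g.matrix_adjugate.matrix_elem i j).continuousOn

theorem continuous_volDensity : Continuous B.volDensity :=
  B.continuous_g.matrix_det.sqrt

theorem volDensity_pos {x : E3} (hx : x ∈ closure (B.D 0)) : 0 < B.volDensity x :=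
  Real.sqrt_pos.2 (B.g_posDef x hx).det_pos

theorem massMatrix_posDef (j : Fin (B.k + 1)) {x : E3} (hx : x ∈ closedLayer B.D j) :
    (B.massMatrix j x).PosDef := by
  have hx' := B.closedLayer_subset j hx
  have h : B.massMatrix j x = (B.rho j x * B.volDensity x) • (B.g x)⁻¹ := rfl
  rw [h]
  exact (B.g_posDef x hx').inv.smul (mul_pos (B.rho_pos j x hx) (B.volDensity_pos hx'))

theorem stiffnessMatrix_posDef (j : Fin (B.k + 1)) {x : E3} (hx : x ∈ closedLayer B.D j) :
    (B.stiffnessMatrix j x).PosDef := by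
  have hx' := B.closedLayer_subset j hx
  let τ : Fin 3 × Fin 3 → ℝ := fun p => B.ginv x p.1 p.2
  have h : B.stiffnessMatrix j x = B.volDensity x •
      (B.lam j x • Matrix.vecMulVec τ (star τ) +
        (2 * B.mu j x) • Matrix.kronecker (B.g x)⁻¹ (B.g x)⁻¹) := rfl
  rw [h]
  have hi := (B.g_posDef x hx').inv
  refine Matrix.PosDef.smul ?_ (B.volDensity_pos hx')
  refine Matrix.PosDef.posSemidef_add ?_ ?_
  · exact (Matrix.posSemidef_vecMulVec_self_star τ).smul (B.lam_pos j x hx).le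
  · exact (hi.kronecker hi).smul (mul_pos two_pos (B.mu_pos j x hx))

/-- The fibre inner product of `L²(Ω, ρ dVol)`. -/
def massWeight : FiberWeight (volume.restrict B.Ω) (Fin 3) :=
  B.layeredWeight B.massMatrix
    (fun j a b => ((B.rho_smooth j).continuous.measurable.mul
      B.continuous_volDensity.measurable).mul (B.measurable_ginv a b))
    (fun j a b => ((B.rho_smooth j).continuous.continuousOn.mul
      B.continuous_volDensity.continuousOn).mul
        ((B.continuousOn_ginv a b).mono (B.closedLayer_subset j)))
    (fun j _ hx => B.massMatrix_posDef j hx)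

/-- The fibre inner product of strains. -/
def stiffnessWeight : FiberWeight (volume.restrict B.Ω) (Fin 3 × Fin 3) :=
  B.layeredWeight B.stiffnessMatrix
    (fun j p q => B.continuous_volDensity.measurable.mul
      (((B.lam_smooth j).continuous.measurable.mul
        ((B.measurable_ginv _ _).mul (B.measurable_ginv _ _))).add
      (((B.mu_smooth j).continuous.measurable.const_mul 2).mul
        ((B.measurable_ginv _ _).mul (B.measurable_ginv _ _)))))
    (fun j p q => by
      have h := fun a b => (B.continuousOn_ginv a b).mono (B.closedLayer_subset j)
      exact B.continuous_volDensity.continuousOn.mul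
        (((B.lam_smooth j).continuous.continuousOn.mul ((h _ _).mul (h _ _))).add
        (((B.mu_smooth j).continuous.continuousOn.const_mul 2).mul ((h _ _).mul (h _ _)))))
    (fun j _ hx => B.stiffnessMatrix_posDef j hx)

/-- The Hilbert space `L²(Ω, ρ dVol)` of complex covector fields, with inner product
`∫ gⁱʲ conj(uᵢ) vⱼ ρ dVol`. -/
abbrev L2 : Type := WL2 B.massWeight

/-- The Hilbert space of square integrable covariant `2`-tensor fields, with inner product
`∫ (λ conj(tr e) tr f + 2 μ ⟨e, f⟩) dVol`. -/
abbrev StrainL2 : Type := WL2 B.stiffnessWeight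

/-! ### The elastic operator -/

/-- The Christoffel symbols `Γᵏᵢⱼ` of the metric. -/
def christoffel (x : E3) (k i j : Fin 3) : ℝ :=
  (1 / 2) * ∑ l, B.ginv x k l *
    (pd i (fun y => B.g y j l) x + pd j (fun y => B.g y i l) x - pd l (fun y => B.g y i j) x)

/-- The covariant derivative `∇ᵢ uⱼ` of a covector field. -/
def covDeriv (u : E3 → C3) (x : E3) (i j : Fin 3) : ℂ :=
  pd i (fun y => u y j) x - ∑ k, (B.christoffel x k i j : ℂ) * u x k

/-- The symmetric differential (strain) `dˢu`. -/
def symDiff (u : E3 → C3) (x : E3) : T2 :=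
  WithLp.toLp 2 fun p => (B.covDeriv u x p.1 p.2 + B.covDeriv u x p.2 p.1) / 2

/-- The divergence `δu = ∇ⁱuᵢ` of a covector field. -/
def div1 (u : E3 → C3) (x : E3) : ℂ :=
  ∑ i, ∑ j, (B.ginv x i j : ℂ) * B.covDeriv u x i j

/-- The stress tensor `σ(u) = λ (δu) g + 2 μ dˢu`, with the Lamé parameters of the layer `j`. -/
def stress (j : Fin (B.k + 1)) (u : E3 → C3) (x : E3) (a b : Fin 3) : ℂ :=
  (B.lam j x : ℂ) * B.div1 u x * (B.g x a b : ℂ) + 2 * (B.mu j x : ℂ) * B.symDiff u x (a, b)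

/-- The divergence `(δs)ₐ = ∇ᵇsₐᵦ` of a covariant `2`-tensor field, where
`∇_c sₐᵦ = ∂_c sₐᵦ - Γˡ_ca s_lb - Γˡ_cb s_al`. -/
def div2 (s : E3 → Fin 3 → Fin 3 → ℂ) (x : E3) (a : Fin 3) : ℂ :=
  ∑ b, ∑ c, (B.ginv x b c : ℂ) * (pd c (fun y => s y a b) x -
    ∑ l, (B.christoffel x l c a : ℂ) * s x l b - ∑ l, (B.christoffel x l c b : ℂ) * s x a l)

/-- The elastic operator `Eu = ρ⁻¹ δσ(u)`, with the coefficients of the layer `j`. -/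
def elastic (j : Fin (B.k + 1)) (u : E3 → C3) (x : E3) : C3 :=
  WithLp.toLp 2 fun a => (B.rho j x : ℂ)⁻¹ * B.div2 (B.stress j u) x a

/-- `ν` is the outer unit normal vector at the boundary point `x` of `D`, with respect to `g`. -/
def IsOuterUnitNormal (D : Set E3) (x : E3) (ν : Fin 3 → ℝ) : Prop :=
  ∃ φ, IsLocalDefining D x φ ∧ ∀ a, ν a = (∑ b, B.ginv x a b * pd b φ x) /
    √(∑ b, ∑ c, B.ginv x b c * (pd b φ x * pd c φ x))

/-- The traction `(Nu)ₐ = σₐᵦ(u) νᵇ`, with the coefficients of the layer `j`. -/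
def traction (j : Fin (B.k + 1)) (u : E3 → C3) (x : E3) (ν : Fin 3 → ℝ) (a : Fin 3) : ℂ :=
  ∑ b, B.stress j u x a b * (ν b : ℂ)

theorem differentiableAt_coord {u : E3 → C3} (hu : ContDiff ℝ ∞ u) (x : E3) (i : Fin 3) :
    DifferentiableAt ℝ (fun y => u y i) x :=
  ((EuclideanSpace.proj (𝕜 := ℂ) i).restrictScalars ℝ).differentiableAt.comp x
    (hu.differentiable (by simp) x)

theorem covDeriv_add {u v : E3 → C3} (hu : ContDiff ℝ ∞ u) (hv : ContDiff ℝ ∞ v) (x : E3)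
    (i j : Fin 3) :
    B.covDeriv (u + v) x i j = B.covDeriv u x i j + B.covDeriv v x i j := by
  have h : pd i (fun y => (u + v) y j) x = pd i (fun y => u y j) x + pd i (fun y => v y j) x := by
    have := fderiv_fun_add (differentiableAt_coord hu x j) (differentiableAt_coord hv x j)
    exact congrArg (fun L => L (EuclideanSpace.single i 1)) this
  rw [covDeriv, h]
  simp only [covDeriv, Pi.add_apply, PiLp.add_apply, mul_add, Finset.sum_add_distrib]
  ring

theorem covDeriv_smul (c : ℂ) {u : E3 → C3} (hu : ContDiff ℝ ∞ u) (x : E3) (i j : Fin 3) :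
    B.covDeriv (c • u) x i j = c * B.covDeriv u x i j := by
  have h : pd i (fun y => (c • u) y j) x = c * pd i (fun y => u y j) x := by
    have := fderiv_fun_const_smul (differentiableAt_coord hu x j) c
    exact congrArg (fun L => L (EuclideanSpace.single i 1)) this
  rw [covDeriv, h]
  simp only [covDeriv, Pi.smul_apply, PiLp.smul_apply, smul_eq_mul, mul_sub, Finset.mul_sum]
  congr 1
  refine Finset.sum_congr rfl fun k _ => ?_
  ring

theorem covDeriv_zero (x : E3) (i j : Fin 3) : B.covDeriv 0 x i j = 0 := by
  simp [covDeriv, pd]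

theorem symDiff_add {u v : E3 → C3} (hu : ContDiff ℝ ∞ u) (hv : ContDiff ℝ ∞ v) (x : E3) :
    B.symDiff (u + v) x = B.symDiff u x + B.symDiff v x := by
  ext p
  simp only [symDiff, B.covDeriv_add hu hv, PiLp.add_apply]
  ring

theorem symDiff_smul (c : ℂ) {u : E3 → C3} (hu : ContDiff ℝ ∞ u) (x : E3) :
    B.symDiff (c • u) x = c • B.symDiff u x := by
  ext p
  simp only [symDiff, B.covDeriv_smul c hu, PiLp.smul_apply, smul_eq_mul]
  ring

theorem symDiff_zero (x : E3) : B.symDiff 0 x = 0 := by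
  ext p
  simp [symDiff, B.covDeriv_zero]

theorem traction_add (l : Fin (B.k + 1)) {u v : E3 → C3} (hu : ContDiff ℝ ∞ u)
    (hv : ContDiff ℝ ∞ v) (x : E3) (ν : Fin 3 → ℝ) (a : Fin 3) :
    B.traction l (u + v) x ν a = B.traction l u x ν a + B.traction l v x ν a := by
  simp only [traction, stress, div1, B.symDiff_add hu hv, B.covDeriv_add hu hv, PiLp.add_apply,
    mul_add, Finset.sum_add_distrib, add_mul]
  ring

theorem traction_smul (l : Fin (B.k + 1)) (c : ℂ) {u : E3 → C3} (hu : ContDiff ℝ ∞ u) (x : E3)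
    (ν : Fin 3 → ℝ) (a : Fin 3) :
    B.traction l (c • u) x ν a = c * B.traction l u x ν a := by
  have h : B.div1 (c • u) x = c * B.div1 u x := by
    simp only [div1, B.covDeriv_smul c hu, Finset.mul_sum]
    refine Finset.sum_congr rfl fun i _ => Finset.sum_congr rfl fun j _ => ?_
    ring
  simp only [traction, stress, h, B.symDiff_smul c hu, PiLp.smul_apply, smul_eq_mul,
    Finset.mul_sum]
  refine Finset.sum_congr rfl fun i _ => ?_
  ring

theorem traction_zero (l : Fin (B.k + 1)) (x : E3) (ν : Fin 3 → ℝ) (a : Fin 3) :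
    B.traction l 0 x ν a = 0 := by
  simp [traction, stress, div1, B.symDiff_zero, B.covDeriv_zero]

/-- The original domain of the elastic operator: displacements which are smooth up to the
interfaces and up to `∂Ω` in every layer, satisfy the transmission conditions `[u] = 0` and
`[Nu] = 0` on every interface, and vanish on `∂Ω`. Such a displacement is given by one smooth
function `u j` for each layer `j`; its values off the closed layer are irrelevant. -/
def admissible : Submodule ℂ (Fin (B.k + 1) → E3 → C3) where
  carrier := {u | (∀ j, ContDiff ℝ ∞ (u j)) ∧
    (∀ j : Fin B.k, ∀ x ∈ frontier (B.D j.succ), u j.castSucc x = u j.succ x) ∧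
    (∀ j : Fin B.k, ∀ x ∈ frontier (B.D j.succ), ∀ ν, B.IsOuterUnitNormal (B.D j.succ) x ν →
      ∀ a, B.traction j.castSucc (u j.castSucc) x ν a = B.traction j.succ (u j.succ) x ν a) ∧
    ∀ x ∈ frontier B.Ω, u 0 x = 0}
  zero_mem' := by
    refine ⟨fun j => contDiff_const, fun j x _ => rfl, fun j x _ ν _ a => ?_, fun x _ => rfl⟩
    simp only [Pi.zero_apply, traction_zero]
  add_mem' := by
    rintro u v ⟨hu, hu1, hu2, hu3⟩ ⟨hv, hv1, hv2, hv3⟩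
    refine ⟨fun j => (hu j).add (hv j), fun j x hx => ?_, fun j x hx ν hν a => ?_,
      fun x hx => ?_⟩
    · simp only [Pi.add_apply, hu1 j x hx, hv1 j x hx]
    · simp only [Pi.add_apply, B.traction_add _ (hu _) (hv _), hu2 j x hx ν hν, hv2 j x hx ν hν]
    · simp only [Pi.add_apply, hu3 x hx, hv3 x hx, add_zero]
  smul_mem' := by
    rintro c u ⟨hu, hu1, hu2, hu3⟩
    refine ⟨fun j => (hu j).const_smul c, fun j x hx => ?_, fun j x hx ν hν a => ?_,
      fun x hx => ?_⟩
    · simp only [Pi.smul_apply, hu1 j x hx]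
    · simp only [Pi.smul_apply, B.traction_smul _ c (hu _), hu2 j x hx ν hν]
    · simp only [Pi.smul_apply, hu3 x hx, smul_zero]

/-- The element `a` of `L²(Ω, ρ dVol)` is the (class of the) piecewise field `u`. -/
def Represents (a : B.L2) (u : Fin (B.k + 1) → E3 → C3) : Prop :=
  (fun x => a x) =ᵐ[volume.restrict B.Ω] glue B.D u

/-! ### The energy space and the dynamics -/

/-- The pairs `(u, dˢu)` for admissible displacements `u`. -/
def strainGraph : Submodule ℂ (B.L2 × B.StrainL2) where
  carrier := {p | ∃ u ∈ B.admissible, B.Represents p.1 u ∧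
    (fun x => p.2 x) =ᵐ[volume.restrict B.Ω] glue B.D fun j => B.symDiff (u j)}
  zero_mem' := by
    refine ⟨0, zero_mem _, ?_, ?_⟩
    · filter_upwards [WL2.coe_zero (w := B.massWeight)] with x hx
      simpa [glue] using hx
    · filter_upwards [WL2.coe_zero (w := B.stiffnessWeight)] with x hx
      have h : B.symDiff (0 : E3 → C3) = 0 := funext fun y => B.symDiff_zero y
      simpa [glue, h] using hx
  add_mem' := by
    rintro p q ⟨u, hu, hp, hp'⟩ ⟨v, hv, hq, hq'⟩
    refine ⟨u + v, add_mem hu hv, ?_, ?_⟩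
    · filter_upwards [hp, hq, WL2.coe_add p.1 q.1] with x h1 h2 h3
      simp only [Prod.fst_add, h3, h1, h2, glue, ← Finset.sum_add_distrib, Pi.add_apply,
        indicator_add']
    · filter_upwards [hp', hq', WL2.coe_add p.2 q.2] with x h1 h2 h3
      have h : ∀ j, B.symDiff ((u + v) j) = B.symDiff (u j) + B.symDiff (v j) := fun j =>
        funext fun y => B.symDiff_add (hu.1 j) (hv.1 j) y
      simp only [Prod.snd_add, h3, h1, h2, glue, h, indicator_add']
      simp only [← Finset.sum_add_distrib, Pi.add_apply]
  smul_mem' := by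
    rintro c p ⟨u, hu, hp, hp'⟩
    refine ⟨c • u, B.admissible.smul_mem c hu, ?_, ?_⟩
    · filter_upwards [hp, WL2.coe_smul c p.1] with x h1 h2
      simp only [Prod.smul_fst, h2, h1, glue, Finset.smul_sum, Pi.smul_apply]
      refine Finset.sum_congr rfl fun j _ => ?_
      rw [← indicator_const_smul_apply]
      rfl
    · filter_upwards [hp', WL2.coe_smul c p.2] with x h1 h2
      have h : ∀ j, B.symDiff ((c • u) j) = c • B.symDiff (u j) := fun j =>
        funext fun y => B.symDiff_smul c (hu.1 j) y
      simp only [Prod.smul_snd, h2, h1, glue, h, Finset.smul_sum]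
      refine Finset.sum_congr rfl fun j _ => ?_
      rw [← indicator_const_smul_apply]
      rfl

/-- The closure of `{(u, dˢu)}` in `L²`: pairs of a displacement `u` of finite energy with zero
Dirichlet data, and its strain `dˢu`. -/
def formSpace : Submodule ℂ (B.L2 × B.StrainL2) := B.strainGraph.topologicalClosure

/-- The energy space of pairs `(f₁, f₂)`, where `f₁` has finite energy and zero Dirichlet data (and
is accompanied by its strain `dˢf₁`), and `f₂` is in `L²(Ω, ρ dVol)`. -/
def EnergySpace : Type := B.formSpace × B.L2

namespace EnergySpace

variable {B}

instance : AddCommGroup B.EnergySpace := inferInstanceAs (AddCommGroup (B.formSpace × B.L2))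

instance : Module ℂ B.EnergySpace := inferInstanceAs (Module ℂ (B.formSpace × B.L2))

/-- The displacement `f₁`. -/
def disp (x : B.EnergySpace) : B.L2 := x.1.1.1

/-- The strain `dˢf₁`. -/
def strain (x : B.EnergySpace) : B.StrainL2 := x.1.1.2

/-- The velocity `f₂`. -/
def vel (x : B.EnergySpace) : B.L2 := x.2

variable (B) in
/-- The energy form, with
`‖(f₁, f₂)‖² = ∫ (λ |δf₁|² + 2 μ |dˢf₁|² + ρ |f₂|²) dVol`. -/
@[reducible] def core : PreInnerProductSpace.Core ℂ B.EnergySpace where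
  inner x y := inner ℂ (strain x) (strain y) + inner ℂ (vel x) (vel y)
  conj_inner_symm x y := by
    rw [map_add, inner_conj_symm, inner_conj_symm]
  re_inner_nonneg x := by
    rw [map_add]
    exact add_nonneg inner_self_nonneg inner_self_nonneg
  add_left x y z := by
    change inner ℂ (strain x + strain y) (strain z) + inner ℂ (vel x + vel y) (vel z) = _
    rw [inner_add_left, inner_add_left]
    ring
  smul_left x y r := by
    change inner ℂ (r • strain x) (strain y) + inner ℂ (r • vel x) (vel y) = _
    rw [inner_smul_left, inner_smul_left]
    ring

instance : SeminormedAddCommGroup B.EnergySpace :=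
  @InnerProductSpace.Core.toSeminormedAddCommGroup ℂ B.EnergySpace _ _ _ (core B)

instance : InnerProductSpace ℂ B.EnergySpace := InnerProductSpace.ofCore (core B)

theorem inner_def (x y : B.EnergySpace) :
    inner ℂ x y = inner ℂ (strain x) (strain y) + inner ℂ (vel x) (vel y) := rfl

end EnergySpace

open EnergySpace in
/-- The graph of the evolution operator `𝐄 (u₁, u₂) = (u₂, A u₁)`, with domain the pairs where
`u₁ ∈ D(A)` and `u₂` has finite energy and zero Dirichlet data: `𝐄 x = y`. -/
def EvolEq (A : B.L2 →ₗ.[ℂ] B.L2) (x y : B.EnergySpace) : Prop :=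
  disp y = vel x ∧ (disp x, vel y) ∈ A.graph

/-- `u`, with velocity `v`, solves `u'' = A u` in `L²(Ω, ρ dVol)` for all times, with Cauchy data
`u(0) = f₁` and `u'(0) = f₂`. -/
structure SolvesCauchy (A : B.L2 →ₗ.[ℂ] B.L2) (f₁ f₂ : B.L2) (u v : ℝ → B.L2) : Prop where
  init_u : u 0 = f₁
  init_v : v 0 = f₂
  deriv_u : ∀ t, HasDerivAt u (v t) t
  deriv_v : ∀ t, ∃ w, (u t, w) ∈ A.graph ∧ HasDerivAt v w t

end ElasticBody

end

/-! The proof separates abstract Hilbert space theory from three facts about the admissible fields: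
Green's formula (`green`), density in L² (`dense_elasticGraph`), and a Poincaré inequality bounding
‖u‖ by the strain norm (`exists_poincare`). `evolution_of_form` derives the whole theorem from
these.

Abstract part. On the closed form space V of pairs (u, dˢu), the Poincaré inequality makes the
strain norm a complete norm, so each f has a variational solution Rf with strain Lf satisfying ⟨f,
v⟩ = ⟨Lf, dˢv⟩ on V. The operator R is bounded, self-adjoint and, by density, injective; A = -R⁻¹ is
the required self-adjoint operator, and Green's formula shows that it extends E. Symmetry together
with density also shows that E is single-valued, and testing Green's formula against a limit pair
(0, e) forces e = 0, which is the uniqueness of strain.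

The evolution operator is treated through its bounded inverse J(y₁, y₂) = (-R y₂, y₁), which is
skew-adjoint and injective on the energy space. Skew-adjointness of 𝐄 = J⁻¹ is then algebra, and its
unitary group is e^{-it/K} with K = -iJ. That function of K oscillates wildly at the spectral value
0, but s e^{-it/s} is continuous, so K e^{-it/K} comes from the continuous functional calculus; it
has the same norm as K on every vector, so e^{-it/K} extends isometrically from the dense range of K
(`exists_unitaryGroup`). No spectral theorem for unbounded operators is needed. Uniqueness for the
Cauchy problem uses the conserved quantity ‖u‖² + ⟨v, Rv⟩.

Concrete part. No surface integrals or traces occur. The only divergence theorem is for fields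
tangent to the boundary, where smooth cutoffs in the defining function produce an error that
vanishes in the limit (`setIntegral_coordDiv_eq_zero`). For piecewise fields one subtracts
neighbouring extensions: their difference is tangent to the interface, so the integrals telescope
(`integral_glue_coordDiv`). With the identity div(v̄·σ(u)) = v̄·δσ(u) + ⟨σ(u), dˢv⟩ this is Green's
formula.

The Poincaré inequality avoids Korn's inequality. The divergence of the field with components
w|u_b|² contains only the diagonal derivatives ∂_b u_b, which are strain components plus Christoffel
terms of order zero; an exponential weight w with a large exponent absorbs the latter. -/

noncomputable section

/-! ### Unitary groups with a boundedly invertible generator -/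

section UnitaryGroup

/-- The unimodular function `e^{-it/s}`, equal to `1` at `s = 0`. -/
def phase (t s : ℝ) : ℂ := Complex.exp ((-(t / s) : ℝ) * Complex.I)

theorem norm_phase (t s : ℝ) : ‖phase t s‖ = 1 := Complex.norm_exp_ofReal_mul_I _

theorem phase_zero (s : ℝ) : phase 0 s = 1 := by simp [phase]

theorem phase_add (t r s : ℝ) : phase (t + r) s = phase t s * phase r s := by
  rw [phase, phase, phase, ← Complex.exp_add]
  congr 1
  push_cast
  ring

/-- The factor s damps the oscillation of e^{-it/s} at 0. Continuity there is what makes the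
function available to the continuous functional calculus of an operator with 0 in its spectrum. -/
theorem continuous_damped_phase (t : ℝ) : Continuous fun s : ℝ => (s : ℂ) * phase t s := by
  rw [continuous_iff_continuousAt]
  intro s
  by_cases hs : s = 0
  · subst hs
    rw [ContinuousAt, Complex.ofReal_zero, zero_mul]
    refine squeeze_zero_norm (a := fun s : ℝ => |s|) (fun s => ?_) ?_
    · rw [norm_mul, norm_phase, mul_one, Complex.norm_real, Real.norm_eq_abs]
    · simpa using (continuous_abs (G := ℝ)).tendsto 0
  · unfold phase
    have h : ContinuousAt (fun s : ℝ => -(t / s)) s :=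
      (continuousAt_const.div continuousAt_id hs).neg
    refine Complex.continuous_ofReal.continuousAt.mul ?_
    exact Complex.continuous_exp.continuousAt.comp
      ((Complex.continuous_ofReal.continuousAt.comp h).mul continuousAt_const)

/-- For |θ| ≤ 1 this is the Taylor estimate; for |θ| > 1 the triangle inequality gives 2 + |θ|,
which is at most 3θ². -/
theorem norm_exp_mul_I_sub_le (θ : ℝ) :
    ‖Complex.exp (θ * Complex.I) - 1 - θ * Complex.I‖ ≤ 3 * θ ^ 2 := by
  have hn : ‖(θ : ℂ) * Complex.I‖ = |θ| := by simp
  by_cases h : |θ| ≤ 1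
  · have := Complex.norm_exp_sub_one_sub_id_le (x := θ * Complex.I) (by rw [hn]; exact h)
    rw [hn, sq_abs] at this
    nlinarith [sq_nonneg θ]
  · push Not at h
    calc ‖Complex.exp (θ * Complex.I) - 1 - θ * Complex.I‖
        ≤ ‖Complex.exp (θ * Complex.I)‖ + ‖(1 : ℂ)‖ + ‖(θ : ℂ) * Complex.I‖ :=
          (norm_sub_le _ _).trans (add_le_add_left (norm_sub_le _ _) _)
      _ = 2 + |θ| := by rw [Complex.norm_exp_ofReal_mul_I, norm_one, hn]; ring
      _ ≤ 3 * θ ^ 2 := by rw [← sq_abs θ]; nlinarith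

/-- The Taylor remainder of e^{-it/s} in t is of size (t - r)²/s², and the two factors s cancel the
denominator. The bound is thus uniform in s, which turns into an operator norm bound. -/
theorem norm_damped_phase_sub_le (t r s : ℝ) :
    ‖(s : ℂ) * (s * phase t s) - s * (s * phase r s) -
      ((t - r : ℝ) : ℂ) * (-Complex.I * (s * phase r s))‖ ≤ 3 * (t - r) ^ 2 := by
  by_cases hs : s = 0
  · subst hs
    simp only [Complex.ofReal_zero, zero_mul, mul_zero, sub_zero, norm_zero]
    positivity
  have hs' : (s : ℂ) ≠ 0 := Complex.ofReal_ne_zero.2 hs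
  have e : phase t s = phase r s * phase (t - r) s := by rw [← phase_add]; congr 1; ring
  have h : (s : ℂ) * (s * phase t s) - s * (s * phase r s) -
      ((t - r : ℝ) : ℂ) * (-Complex.I * (s * phase r s)) = s ^ 2 * phase r s *
      (Complex.exp ((-((t - r) / s) : ℝ) * Complex.I) - 1 - (-((t - r) / s) : ℝ) * Complex.I) := by
    rw [e, phase, phase]
    push_cast
    field_simp
  rw [h, norm_mul, norm_mul, norm_phase, norm_pow, Complex.norm_real, mul_one, Real.norm_eq_abs,
    sq_abs]
  calc s ^ 2 * _ ≤ s ^ 2 * (3 * (-((t - r) / s)) ^ 2) := by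
        gcongr
        exact norm_exp_mul_I_sub_le _
    _ = 3 * (t - r) ^ 2 := by field_simp

variable {𝓗 : Type*} [NormedAddCommGroup 𝓗] [InnerProductSpace ℂ 𝓗] [CompleteSpace 𝓗]

/-- The operator `K e^{-it/K}`. -/
def dampedGroup (K : 𝓗 →L[ℂ] 𝓗) (t : ℝ) : 𝓗 →L[ℂ] 𝓗 :=
  cfc (fun z : ℂ => (z.re : ℂ) * phase t z.re) K

variable {K : 𝓗 →L[ℂ] 𝓗}

theorem continuous_damped_phase_re (t : ℝ) :
    Continuous fun z : ℂ => (z.re : ℂ) * phase t z.re :=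
  (continuous_damped_phase t).comp Complex.continuous_re

theorem cfc_re_eq (hK : IsSelfAdjoint K) : cfc (fun z : ℂ => (z.re : ℂ)) K = K := by
  have hn : IsStarNormal K := hK.isStarNormal
  conv_rhs => rw [← cfc_id ℂ K]
  exact cfc_congr fun z hz => (hK.mem_spectrum_eq_re hz).symm

theorem dampedGroup_zero (hK : IsSelfAdjoint K) : dampedGroup K 0 = K := by
  conv_rhs => rw [← cfc_re_eq hK]
  unfold dampedGroup
  congr 1
  funext z
  rw [phase_zero, mul_one]

/-- Each factor carries one K, so the group law holds only up to a surplus K. It is removed later by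
density of the range of K². -/
theorem dampedGroup_mul (hK : IsSelfAdjoint K) (t r : ℝ) :
    dampedGroup K t * dampedGroup K r = K * dampedGroup K (t + r) := by
  have hn : IsStarNormal K := hK.isStarNormal
  have e : K * dampedGroup K (t + r) = dampedGroup K 0 * dampedGroup K (t + r) := by
    rw [dampedGroup_zero hK]
  rw [e]
  unfold dampedGroup
  rw [← cfc_mul _ _ K (continuous_damped_phase_re _).continuousOn
    (continuous_damped_phase_re _).continuousOn, ← cfc_mul _ _ K
    (continuous_damped_phase_re _).continuousOn (continuous_damped_phase_re _).continuousOn]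
  congr 1
  funext z
  rw [phase_zero, phase_add]
  ring

/-- Since |e^{-it/s}| = 1, the phases cancel and s² remains. This is what makes the extension off
the range of K isometric. -/
theorem star_dampedGroup_mul (hK : IsSelfAdjoint K) (t : ℝ) :
    star (dampedGroup K t) * dampedGroup K t = star K * K := by
  have hn : IsStarNormal K := hK.isStarNormal
  conv_rhs => rw [hK.star_eq]; congr <;> rw [← cfc_re_eq hK]
  unfold dampedGroup
  rw [← cfc_star, ← cfc_mul _ _ K (continuous_damped_phase_re _).star.continuousOn
    (continuous_damped_phase_re _).continuousOn, ← cfc_mul _ _ K (by fun_prop) (by fun_prop)]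
  congr 1
  funext z
  have h : conj (phase t z.re) * phase t z.re = 1 := by
    rw [← Complex.normSq_eq_conj_mul_self, Complex.normSq_eq_norm_sq, norm_phase]
    norm_num
  simp only [star_mul', Complex.star_def, Complex.conj_ofReal]
  linear_combination (z.re : ℂ) ^ 2 * h

theorem norm_dampedGroup_apply (hK : IsSelfAdjoint K) (t : ℝ) (y : 𝓗) :
    ‖dampedGroup K t y‖ = ‖K y‖ := by
  have h (S : 𝓗 →L[ℂ] 𝓗) : ‖S y‖ ^ 2 = RCLike.re (inner ℂ ((star S * S) y) y) := by
    rw [ContinuousLinearMap.star_eq_adjoint, mul_apply_eq_comp,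
      ContinuousLinearMap.adjoint_inner_left, inner_self_eq_norm_sq]
  refine (sq_eq_sq₀ (norm_nonneg _) (norm_nonneg _)).1 ?_
  rw [h, h, star_dampedGroup_mul hK]

theorem dampedGroup_comm (hK : IsSelfAdjoint K) (t : ℝ) :
    dampedGroup K t * K = K * dampedGroup K t := by
  simpa [dampedGroup_zero hK] using dampedGroup_mul hK t 0

theorem cfc_sub_mul_sub [IsStarNormal K] (p f g : ℂ → ℂ) (hp : Continuous p) (hf : Continuous f)
    (hg : Continuous g) (c d : ℂ) :
    cfc (fun z => p z * f z - p z * g z - c * (d * g z)) K =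
      cfc p K * cfc f K - cfc p K * cfc g K - c • d • cfc g K := by
  rw [cfc_sub (fun z => p z * f z - p z * g z) (fun z => c * (d * g z)) K,
    cfc_sub (fun z => p z * f z) (fun z => p z * g z) K, cfc_mul p f K, cfc_mul p g K,
    cfc_const_mul c (fun z => d * g z) K, cfc_const_mul d g K]

/-- The second factor K compensates the 1/K produced by differentiation, so the derivative exists in
operator norm, with quadratic error. -/
theorem hasDerivAt_dampedGroup (hK : IsSelfAdjoint K) (t : ℝ) :
    HasDerivAt (fun t => K * dampedGroup K t) (-Complex.I • dampedGroup K t) t := by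
  have hn : IsStarNormal K := hK.isStarNormal
  have hb : ∀ r, ‖K * dampedGroup K r - K * dampedGroup K t -
      (r - t) • (-Complex.I • dampedGroup K t)‖ ≤ 3 * (r - t) ^ 2 := by
    intro r
    have c0 : Continuous fun z : ℂ => (z.re : ℂ) := by fun_prop
    have c1 := continuous_damped_phase_re r
    have c2 := continuous_damped_phase_re t
    have e : K * dampedGroup K r - K * dampedGroup K t -
        (r - t) • (-Complex.I • dampedGroup K t) =
        cfc (fun z : ℂ => (z.re : ℂ) * (z.re * phase r z.re) - z.re * (z.re * phase t z.re) -
          ((r - t : ℝ) : ℂ) * (-Complex.I * (z.re * phase t z.re))) K := by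
      rw [cfc_sub_mul_sub _ _ _ c0 c1 c2, cfc_re_eq hK]
      rfl
    rw [e]
    exact norm_cfc_le (by positivity) fun z _ => norm_damped_phase_sub_le r t z.re
  rw [hasDerivAt_iff_isLittleO]
  refine Asymptotics.IsBigO.trans_isLittleO (g := fun r => (r - t) ^ 2) ?_ ?_
  · refine Asymptotics.IsBigO.of_bound 3 (Eventually.of_forall fun r => ?_)
    rw [Real.norm_of_nonneg (sq_nonneg _)]
    exact hb r
  · have h : Tendsto (fun r : ℝ => r - t) (𝓝 t) (𝓝 0) := by
      simpa using (continuous_sub_right t).tendsto t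
    have h2 := (Asymptotics.isLittleO_pow_id (𝕜 := ℝ) one_lt_two).comp_tendsto h
    exact h2

/-- The isometry `e^{-it/K}`, for an injective self-adjoint operator `K`. -/
def isometryGroup (K : 𝓗 →L[ℂ] 𝓗) (t : ℝ) : 𝓗 →L[ℂ] 𝓗 :=
  (dampedGroup K t).toLinearMap.extendOfNorm K.toLinearMap

/-- The orthogonal complement of the range is the kernel of the adjoint, here the kernel of K. -/
theorem denseRange_of_selfAdjoint (hK : IsSelfAdjoint K) (hinj : ∀ x, K x = 0 → x = 0) :
    DenseRange K := by
  have h : K.range.topologicalClosure = ⊤ := by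
    rw [Submodule.topologicalClosure_eq_top_iff, eq_bot_iff]
    intro x hx
    refine hinj x (ext_inner_left ℂ fun y => ?_)
    rw [inner_zero_right, ← ContinuousLinearMap.adjoint_inner_left,
      ← ContinuousLinearMap.star_eq_adjoint, hK.star_eq]
    exact hx (K y) ⟨y, rfl⟩
  have := Submodule.dense_iff_topologicalClosure_eq_top.2 h
  exact this

theorem isometryGroup_apply (hK : IsSelfAdjoint K) (hinj : ∀ x, K x = 0 → x = 0) (t : ℝ)
    (y : 𝓗) : isometryGroup K t (K y) = dampedGroup K t y :=
  LinearMap.extendOfNorm_eq (denseRange_of_selfAdjoint hK hinj)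
    ⟨1, fun x => by simpa using (norm_dampedGroup_apply hK t x).le⟩ y

theorem norm_isometryGroup (hK : IsSelfAdjoint K) (hinj : ∀ x, K x = 0 → x = 0) (t : ℝ)
    (x : 𝓗) : ‖isometryGroup K t x‖ = ‖x‖ := by
  have hd := denseRange_of_selfAdjoint hK hinj
  refine congrFun (hd.equalizer (isometryGroup K t).continuous.norm continuous_norm ?_) x
  funext y
  simp [isometryGroup_apply hK hinj, norm_dampedGroup_apply hK]

theorem isometryGroup_commute (hK : IsSelfAdjoint K) (hinj : ∀ x, K x = 0 → x = 0) (t : ℝ)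
    (x : 𝓗) : isometryGroup K t (K x) = K (isometryGroup K t x) := by
  have hd := denseRange_of_selfAdjoint hK hinj
  refine congrFun (hd.equalizer ((isometryGroup K t).continuous.comp K.continuous)
    (K.continuous.comp (isometryGroup K t).continuous) ?_) x
  funext y
  simp only [Function.comp_apply, isometryGroup_apply hK hinj]
  exact congrArg (fun S => S y) (dampedGroup_comm hK t)

/-- Both sides are continuous, so it suffices to compare them on vectors K(K y): one K is consumed
by each of the two factors of the group. -/
theorem isometryGroup_add (hK : IsSelfAdjoint K) (hinj : ∀ x, K x = 0 → x = 0) (t r : ℝ)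
    (x : 𝓗) : isometryGroup K (t + r) x = isometryGroup K t (isometryGroup K r x) := by
  have hd := denseRange_of_selfAdjoint hK hinj
  have hd2 : DenseRange (K ∘ K) := hd.comp hd K.continuous
  refine congrFun (hd2.equalizer (isometryGroup K (t + r)).continuous
    ((isometryGroup K t).continuous.comp (isometryGroup K r).continuous) ?_) x
  funext y
  simp only [Function.comp_apply]
  rw [isometryGroup_commute hK hinj r, isometryGroup_apply hK hinj t,
    isometryGroup_apply hK hinj r, isometryGroup_commute hK hinj, isometryGroup_apply hK hinj]
  exact (congrArg (fun S => S y) (dampedGroup_mul hK t r)).symm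

theorem isometryGroup_zero (hK : IsSelfAdjoint K) (hinj : ∀ x, K x = 0 → x = 0) (x : 𝓗) :
    isometryGroup K 0 x = x := by
  have hd := denseRange_of_selfAdjoint hK hinj
  refine congrFun (hd.equalizer (isometryGroup K 0).continuous continuous_id ?_) x
  funext y
  simp [isometryGroup_apply hK hinj, dampedGroup_zero hK]

/-- For x in the range of K this is the operator norm statement. In general x is approximated by
K(yₙ); the derivatives converge uniformly in t because the group acts by isometries, so the limit
may be differentiated. -/
theorem hasDerivAt_isometryGroup (hK : IsSelfAdjoint K) (hinj : ∀ x, K x = 0 → x = 0) (t : ℝ)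
    (x : 𝓗) :
    HasDerivAt (fun t => isometryGroup K t (K x)) (-Complex.I • isometryGroup K t x) t := by
  have hd := denseRange_of_selfAdjoint hK hinj
  have hrange : ∀ (y : 𝓗) (t : ℝ), HasDerivAt (fun t => isometryGroup K t (K (K y)))
      (-Complex.I • isometryGroup K t (K y)) t := by
    intro y t
    have h := ((ContinuousLinearMap.apply ℂ 𝓗 y).restrictScalars ℝ).hasFDerivAt.comp_hasDerivAt t
      (hasDerivAt_dampedGroup hK t)
    rw [isometryGroup_apply hK hinj]
    refine h.congr_of_eventuallyEq (Eventually.of_forall fun r => ?_)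
    change isometryGroup K r (K (K y)) = K (dampedGroup K r y)
    rw [isometryGroup_commute hK hinj, isometryGroup_apply hK hinj]
  obtain ⟨s, hs, hlim⟩ := mem_closure_iff_seq_limit.1 (hd x)
  choose y hy using hs
  obtain rfl : (fun n => K (y n)) = s := funext hy
  refine hasDerivAt_of_tendstoUniformly (l := atTop)
    (f := fun n t => isometryGroup K t (K (K (y n))))
    (f' := fun n t => -Complex.I • isometryGroup K t (K (y n)))
    (g' := fun t => -Complex.I • isometryGroup K t x) ?_
    (Eventually.of_forall fun n t => hrange (y n) t) ?_ t
  · rw [Metric.tendstoUniformly_iff]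
    intro ε hε
    filter_upwards [Metric.tendsto_nhds.1 hlim ε hε] with n hn t
    rw [dist_eq_norm, ← smul_sub, ← map_sub, norm_smul, norm_isometryGroup hK hinj]
    simpa [dist_eq_norm, norm_sub_rev] using hn
  · intro t
    exact ((isometryGroup K t).continuous.comp K.continuous).continuousAt.tendsto.comp hlim

/-- An injective bounded skew-adjoint operator `J` is the inverse of the generator of a strongly
continuous unitary group. -/
theorem exists_unitaryGroup (J : 𝓗 →L[ℂ] 𝓗) (hJ : ∀ x y, inner ℂ (J x) y = -inner ℂ x (J y))
    (hinj : ∀ x, J x = 0 → x = 0) :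
    ∃ U : ℝ → (𝓗 ≃ₗᵢ[ℂ] 𝓗), (∀ s t, U (s + t) = U s * U t) ∧
      (∀ x, Continuous fun t => U t x) ∧ (∀ t x, U t (J x) = J (U t x)) ∧
      (∀ t x, HasDerivAt (fun t => U t (J x)) (U t x) t) ∧
      (∀ x y, x = J y ↔ HasDerivAt (fun t => U t x) y 0) ∧ DenseRange J := by
  -- Then J = iK, so J⁻¹ = -iK⁻¹ and e^{tJ⁻¹} = e^{-it/K}.
  set K : 𝓗 →L[ℂ] 𝓗 := -Complex.I • J with hKdef
  have hJK : ∀ x, J x = Complex.I • K x := fun x => by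
    simp [hKdef, smul_smul]
  have hK : IsSelfAdjoint K := by
    rw [ContinuousLinearMap.isSelfAdjoint_iff_isSymmetric]
    intro x y
    simp [hKdef, inner_smul_left, inner_smul_right, hJ]
  have hKi : ∀ x, K x = 0 → x = 0 := fun x hx => hinj x (by rw [hJK, hx, smul_zero])
  let U : ℝ → (𝓗 ≃ₗᵢ[ℂ] 𝓗) := fun t =>
    { toLinearEquiv := LinearEquiv.ofLinearMap (isometryGroup K t).toLinearMap
        (isometryGroup K (-t)).toLinearMap
        (by
          ext x
          simp [← isometryGroup_add hK hKi, isometryGroup_zero hK hKi])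
        (by
          ext x
          simp [← isometryGroup_add hK hKi, isometryGroup_zero hK hKi])
      norm_map' := norm_isometryGroup hK hKi t }
  have hU : ∀ t x, U t x = isometryGroup K t x := fun t x => rfl
  have hcomm : ∀ t x, U t (J x) = J (U t x) := fun t x => by
    simp only [hU, hJK, map_smul, isometryGroup_commute hK hKi]
  have hderiv : ∀ t x, HasDerivAt (fun t => U t (J x)) (U t x) t := fun t x => by
    have h := (hasDerivAt_isometryGroup hK hKi t x).const_smul Complex.I
    have e : Complex.I • (-Complex.I • isometryGroup K t x) = U t x := by
      rw [smul_smul]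
      simp [hU]
    rw [e] at h
    refine h.congr_of_eventuallyEq (Eventually.of_forall fun r => ?_)
    simp [hU, hJK]
  have hU0 : ∀ x, U 0 x = x := isometryGroup_zero hK hKi
  have hdense : DenseRange J := by
    have h := denseRange_of_selfAdjoint hK hKi
    refine h.mono ?_
    rintro _ ⟨y, rfl⟩
    exact ⟨-Complex.I • y, by simp [hKdef]⟩
  refine ⟨U, fun s t => ?_, fun x => ?_, hcomm, hderiv, fun x y => ⟨?_, fun h => ?_⟩,
    hdense⟩
  · ext x
    exact isometryGroup_add hK hKi s t x
  -- Orbits of vectors in the range of J are differentiable, and a general orbit is a uniform limit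
  -- of such orbits.
  · obtain ⟨s, hs, hlim⟩ := mem_closure_iff_seq_limit.1 (hdense x)
    choose y hy using hs
    have hu : TendstoUniformly (fun n t => U t (s n)) (fun t => U t x) atTop := by
      rw [Metric.tendstoUniformly_iff]
      intro ε hε
      filter_upwards [Metric.tendsto_nhds.1 hlim ε hε] with n hn t
      rwa [(U t).dist_map, dist_comm]
    refine hu.continuous (Frequently.of_forall fun n => ?_)
    rw [← hy n]
    exact continuous_iff_continuousAt.2 fun t => (hderiv t (y n)).continuousAt
  · rintro rfl
    simpa [hU0] using hderiv 0 y
  -- The orbit of J x is differentiated at 0 in two ways: as J applied to the orbit of x, giving J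
  -- y, and by `hderiv`, giving x.
  · have h1 := (J.restrictScalars ℝ).hasFDerivAt.comp_hasDerivAt 0 h
    have h2 : HasDerivAt (fun t => U t (J x)) (J y) 0 := by
      refine h1.congr_of_eventuallyEq (Eventually.of_forall fun r => ?_)
      exact hcomm r x
    simpa [hU0] using (hderiv 0 x).unique h2

end UnitaryGroup

/-- The energy space carries only a seminorm as an instance; that it is a norm depends on the
Poincaré inequality. This version transfers the result under a separation hypothesis. -/
theorem exists_unitaryGroup_of_separated {𝓗 : Type*} [SeminormedAddCommGroup 𝓗]
    [InnerProductSpace ℂ 𝓗] [CompleteSpace 𝓗] (hsep : ∀ x : 𝓗, ‖x‖ = 0 → x = 0)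
    (J : 𝓗 →L[ℂ] 𝓗) (hJ : ∀ x y, inner ℂ (J x) y = -inner ℂ x (J y))
    (hinj : ∀ x, J x = 0 → x = 0) :
    ∃ U : ℝ → (𝓗 ≃ₗᵢ[ℂ] 𝓗), (∀ s t, U (s + t) = U s * U t) ∧
      (∀ x, Continuous fun t => U t x) ∧ (∀ t x, U t (J x) = J (U t x)) ∧
      (∀ t x, HasDerivAt (fun t => U t (J x)) (U t x) t) ∧
      (∀ x y, x = J y ↔ HasDerivAt (fun t => U t x) y 0) ∧ DenseRange J := by
  let _ := NormedAddCommGroup.ofSeparation hsep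
  exact exists_unitaryGroup J hJ hinj

theorem hasDerivAt_comp_of_separated {𝓗 F : Type*} [SeminormedAddCommGroup 𝓗]
    [InnerProductSpace ℂ 𝓗] [NormedAddCommGroup F] [InnerProductSpace ℂ F]
    (hsep : ∀ x : 𝓗, ‖x‖ = 0 → x = 0) (T : 𝓗 →L[ℂ] F) {u : ℝ → 𝓗} {u' : 𝓗} {t : ℝ}
    (hu : HasDerivAt u u' t) : HasDerivAt (fun t => T (u t)) (T u') t := by
  let _ := NormedAddCommGroup.ofSeparation hsep
  exact (T.restrictScalars ℝ).hasFDerivAt.comp_hasDerivAt t hu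

/-! ### The self-adjoint operator of a closed form -/

section Form

variable {H K : Type*} [NormedAddCommGroup H] [InnerProductSpace ℂ H]
  [NormedAddCommGroup K] [InnerProductSpace ℂ K]

theorem bound_closure {S : Submodule ℂ (H × K)} {C : ℝ} (hP : ∀ p ∈ S, ‖p.1‖ ≤ C * ‖p.2‖)
    {p : H × K} (hp : p ∈ S.topologicalClosure) : ‖p.1‖ ≤ C * ‖p.2‖ :=
  closure_minimal (s := (S : Set (H × K))) (t := {p | ‖p.1‖ ≤ C * ‖p.2‖}) hP
    (isClosed_le (by fun_prop) (by fun_prop)) hp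

theorem inner_eq_closure {S : Submodule ℂ (H × K)} {f : H} {e : K}
    (h : ∀ p ∈ S, inner ℂ f p.1 = inner ℂ e p.2)
    {p : H × K} (hp : p ∈ S.topologicalClosure) : inner ℂ f p.1 = inner ℂ e p.2 :=
  closure_minimal (s := (S : Set (H × K))) (t := {p | inner ℂ f p.1 = inner ℂ e p.2}) h
    (isClosed_eq (by fun_prop) (by fun_prop)) hp

/-- The bound makes the second projection antilipschitz on the complete space V, so its range is
complete. -/
theorem isClosed_map_snd [CompleteSpace H] [CompleteSpace K] {V : Submodule ℂ (H × K)}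
    (hV : IsClosed (V : Set (H × K))) {C : ℝ} (hP : ∀ p ∈ V, ‖p.1‖ ≤ C * ‖p.2‖) :
    IsClosed ((V.map (LinearMap.snd ℂ H K) : Submodule ℂ K) : Set K) := by
  have : CompleteSpace V := hV.completeSpace_coe
  let f : V →ₗ[ℂ] K := (LinearMap.snd ℂ H K).comp V.subtype
  have hf : AntilipschitzWith (max C 1).toNNReal f := by
    refine AddMonoidHomClass.antilipschitz_of_bound f fun p => ?_
    rw [Real.coe_toNNReal _ (le_max_of_le_right zero_le_one)]
    refine max_le ?_ ?_
    · exact (hP p p.2).trans (mul_le_mul_of_nonneg_right (le_max_left _ _) (norm_nonneg _))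
    · exact le_mul_of_one_le_left (norm_nonneg _) (le_max_right _ _)
  have hu : UniformContinuous f := uniformContinuous_snd.comp uniformContinuous_subtype_val
  have := (hf.isComplete_range hu).isClosed
  convert this
  ext x
  simp [f]

/-- For a closed form which bounds the norm: the solution operator `f ↦ (R f, L f)` of the
variational problem. -/
theorem exists_solution [CompleteSpace H] [CompleteSpace K] {V : Submodule ℂ (H × K)}
    (hV : IsClosed (V : Set (H × K))) {C : ℝ} (hP : ∀ p ∈ V, ‖p.1‖ ≤ C * ‖p.2‖) :
    ∃ (R : H →L[ℂ] H) (L : H →L[ℂ] K), (∀ f, (R f, L f) ∈ V) ∧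
      ∀ f, ∀ p ∈ V, inner ℂ f p.1 = inner ℂ (L f) p.2 := by
  let W : Submodule ℂ K := V.map (LinearMap.snd ℂ H K)
  have : CompleteSpace W := (isClosed_map_snd hV hP).completeSpace_coe
  have hex : ∀ e : W, ∃ a, (a, (e : K)) ∈ V := by
    rintro ⟨_, ⟨p, hp, rfl⟩⟩
    exact ⟨p.1, hp⟩
  choose T hT using hex
  have huniq : ∀ (a b : H) (e : K), (a, e) ∈ V → (b, e) ∈ V → a = b := by
    intro a b e ha hb
    have h := hP _ (V.sub_mem ha hb)
    simp only [Prod.snd_sub, sub_self, norm_zero, mul_zero, Prod.fst_sub] at h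
    exact sub_eq_zero.1 (norm_le_zero_iff.1 h)
  -- The bound ‖u‖ ≤ C‖e‖ makes u a bounded linear function of e on the closed space W of second
  -- components.
  let T' : W →L[ℂ] H := LinearMap.mkContinuous
    { toFun := T
      map_add' := fun e f => huniq _ _ _ (hT (e + f)) (V.add_mem (hT e) (hT f))
      map_smul' := fun c e => huniq _ _ _ (hT (c • e)) (V.smul_mem c (hT e)) } C
    fun e => hP _ (hT e)
  -- With L = T'* and R = T'T'*, the variational identity is the definition of the adjoint: ⟨f, T'e⟩
  -- = ⟨T'*f, e⟩.
  refine ⟨T'.comp (ContinuousLinearMap.adjoint T'),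
    W.subtypeL.comp (ContinuousLinearMap.adjoint T'), fun f => hT _, fun f p hp => ?_⟩
  have hpW : p.2 ∈ W := ⟨p, hp, rfl⟩
  have h1 : p.1 = T' ⟨p.2, hpW⟩ := huniq _ _ _ hp (hT ⟨p.2, hpW⟩)
  rw [h1, ← ContinuousLinearMap.adjoint_inner_left]
  rfl

variable {V : Submodule ℂ (H × K)} {R : H →L[ℂ] H} {L : H →L[ℂ] K}

/-- Testing the solution with itself gives ‖L f‖² = ⟨f, R f⟩ = 0, so f is orthogonal to the dense
set of first components. -/
theorem solution_injective (hD : Dense (Prod.fst '' (V : Set (H × K))))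
    (hmem : ∀ f, (R f, L f) ∈ V)
    (hin : ∀ f, ∀ p ∈ V, inner ℂ f p.1 = inner ℂ (L f) p.2) (f : H) (hf : R f = 0) : f = 0 := by
  have h1 : inner ℂ (L f) (L f) = 0 := by rw [← hin f _ (hmem f), hf, inner_zero_right]
  have h2 : L f = 0 := inner_self_eq_zero.1 h1
  refine hD.eq_zero_of_inner_left ℂ ?_
  rintro _ ⟨p, hp, rfl⟩
  rw [hin f p hp, h2, inner_zero_left]

variable [CompleteSpace H]

/-- Both ⟨Rx, y⟩ and ⟨x, Ry⟩ are equal to ⟨Lx, Ly⟩. -/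
theorem solution_selfAdjoint (hmem : ∀ f, (R f, L f) ∈ V)
    (hin : ∀ f, ∀ p ∈ V, inner ℂ f p.1 = inner ℂ (L f) p.2) : IsSelfAdjoint R := by
  rw [ContinuousLinearMap.isSelfAdjoint_iff_isSymmetric]
  intro x y
  change inner ℂ (R x) y = inner ℂ x (R y)
  rw [hin x _ (hmem y), ← inner_conj_symm, hin y _ (hmem x), inner_conj_symm]

/-- The negative inverse of an injective bounded self-adjoint operator is self-adjoint. -/
theorem exists_neg_inverse (hR : IsSelfAdjoint R) (hinj : ∀ f, R f = 0 → f = 0) :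
    ∃ A : H →ₗ.[ℂ] H, IsSelfAdjoint A ∧ ∀ p : H × H, p ∈ A.graph ↔ p.1 = -R p.2 := by
  let G : Submodule ℂ (H × H) :=
    { carrier := {p | p.1 = -R p.2}
      zero_mem' := by simp
      add_mem' := by
        rintro p q hp hq
        simp only [mem_ofPred_eq] at hp hq ⊢
        rw [Prod.fst_add, hp, hq, Prod.snd_add, map_add, neg_add]
      smul_mem' := by
        rintro c p hp
        simp only [mem_ofPred_eq] at hp ⊢
        rw [Prod.smul_fst, hp, Prod.smul_snd, map_smul, smul_neg] }
  have hG : G.toLinearPMap.graph = G := G.toLinearPMap_graph_eq fun p hp h0 => by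
    have h : p.1 = -R p.2 := hp
    exact hinj _ (neg_eq_zero.1 (h ▸ h0))
  have hgr : ∀ p : H × H, p ∈ G.toLinearPMap.graph ↔ p.1 = -R p.2 := fun p => by
    rw [hG]
    rfl
  have hdense : Dense (G.toLinearPMap.domain : Set H) := by
    refine (denseRange_of_selfAdjoint hR hinj).mono ?_
    rintro _ ⟨f, rfl⟩
    exact LinearPMap.mem_domain_iff.2 ⟨-f, (hgr _).2 (by simp)⟩
  refine ⟨G.toLinearPMap, ?_, hgr⟩
  rw [LinearPMap.isSelfAdjoint_def]
  -- At the level of graphs no domain has to be computed: orthogonality to all pairs (-R f, f) is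
  -- the equation defining the graph, because R is symmetric and everywhere defined.
  refine LinearPMap.eq_of_eq_graph ?_
  rw [LinearPMap.adjoint_graph_eq_graph_adjoint hdense]
  ext ⟨x, y⟩
  rw [Submodule.mem_adjoint_iff, hgr]
  have hs := (ContinuousLinearMap.isSelfAdjoint_iff_isSymmetric.1 hR)
  constructor
  · intro h
    rw [← sub_eq_zero]
    refine ext_inner_left ℂ fun f => ?_
    have h1 := h (-R f) f ((hgr _).2 rfl)
    have h2 : inner ℂ (R f) y = inner ℂ f (R y) := hs f y
    simp only [inner_neg_left, h2] at h1
    simpa [inner_add_right] using h1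
  · rintro h a b hab
    have h1 : a = -R b := (hgr _).1 hab
    have h2 : inner ℂ (R b) y = inner ℂ b (R y) := hs b y
    simp only at h
    simp only [h, h1, inner_neg_left, inner_neg_right, h2]
    ring

/-- Uniqueness of the solution of `u'' = -R⁻¹ u`. -/
theorem unique_of_inverse_wave (hR : IsSelfAdjoint R) (u v w : ℝ → H)
    (hu : ∀ t, HasDerivAt u (v t) t) (hv : ∀ t, HasDerivAt v (w t) t)
    (hw : ∀ t, u t = -R (w t)) (hpos : ∀ f, 0 ≤ RCLike.re (inner ℂ f (R f)))
    (hu0 : u 0 = 0) (hv0 : v 0 = 0) : u = 0 ∧ v = 0 := by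
  have hs : ∀ f g, inner ℂ (R f) g = inner ℂ f (R g) :=
    ContinuousLinearMap.isSelfAdjoint_iff_isSymmetric.1 hR
  -- This is the energy lowered by one power of R⁻¹. The physical energy would require
  -- differentiating the strain of u, whereas the derivatives of u and v are known only in H.
  have hd : ∀ t, HasDerivAt (fun t => inner ℂ (u t) (u t) + inner ℂ (v t) (R (v t))) 0 t := by
    intro t
    have h1 := (hu t).inner ℂ (hu t)
    have h2 := (hv t).inner ℂ ((R.restrictScalars ℝ).hasFDerivAt.comp_hasDerivAt t (hv t))
    refine (h1.add h2).congr_deriv ?_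
    have e : R (w t) = -u t := by rw [hw t, neg_neg]
    change inner ℂ (u t) (v t) + inner ℂ (v t) (u t) +
      (inner ℂ (v t) (R (w t)) + inner ℂ (w t) (R (v t))) = 0
    rw [← hs (w t), e, inner_neg_left, inner_neg_right]
    ring
  have hc : ∀ t, inner ℂ (u t) (u t) + inner ℂ (v t) (R (v t)) = 0 := by
    intro t
    have := is_const_of_deriv_eq_zero (fun t => (hd t).differentiableAt) (fun t => (hd t).deriv) t 0
    simpa [hu0, hv0] using this
  have hu' : u = 0 := by
    funext t
    have h := congrArg RCLike.re (hc t)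
    rw [map_add, inner_self_eq_norm_sq, map_zero] at h
    have h2 : ‖u t‖ ^ 2 = 0 := le_antisymm (by linarith [hpos (v t)]) (sq_nonneg _)
    exact norm_eq_zero.1 (pow_eq_zero_iff two_ne_zero |>.1 h2)
  refine ⟨hu', funext fun t => ?_⟩
  have h := hu t
  rw [hu'] at h
  exact h.unique (hasDerivAt_const t 0)

end Form

/-! ### The energy space and the evolution generated by the form -/

namespace ElasticBody

variable (B : ElasticBody)

namespace EnergySpace

variable {B}

theorem norm_sq (x : B.EnergySpace) : ‖x‖ ^ 2 = ‖strain x‖ ^ 2 + ‖vel x‖ ^ 2 := by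
  rw [← inner_self_eq_norm_sq (𝕜 := ℂ) x, inner_def, map_add, inner_self_eq_norm_sq,
    inner_self_eq_norm_sq]

theorem norm_strain_le (x : B.EnergySpace) : ‖strain x‖ ≤ ‖x‖ :=
  le_of_sq_le_sq (by rw [norm_sq]; linarith [sq_nonneg ‖vel x‖]) (norm_nonneg _)

theorem norm_vel_le (x : B.EnergySpace) : ‖vel x‖ ≤ ‖x‖ :=
  le_of_sq_le_sq (by rw [norm_sq]; linarith [sq_nonneg ‖strain x‖]) (norm_nonneg _)

theorem mem_formSpace (x : B.EnergySpace) : (disp x, strain x) ∈ B.formSpace := x.1.2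

/-- The energy space element with given components. -/
def pair (p : B.formSpace) (f : B.L2) : B.EnergySpace := (p, f)

theorem ext' {x y : B.EnergySpace} (h1 : disp x = disp y) (h2 : strain x = strain y)
    (h3 : vel x = vel y) : x = y :=
  Prod.ext (Subtype.ext (Prod.ext h1 h2)) h3

/-- The velocity, as a continuous linear map. -/
def velL : B.EnergySpace →L[ℂ] B.L2 :=
  LinearMap.mkContinuous { toFun := vel, map_add' := fun _ _ => rfl, map_smul' := fun _ _ => rfl } 1
    fun x => (norm_vel_le x).trans (one_mul _).ge

theorem exists_dispL {C : ℝ} (hC : 0 ≤ C) (hP : ∀ p ∈ B.formSpace, ‖p.1‖ ≤ C * ‖p.2‖) :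
    ∃ T : B.EnergySpace →L[ℂ] B.L2, ∀ x, T x = disp x :=
  ⟨LinearMap.mkContinuous
    { toFun := disp, map_add' := fun _ _ => rfl, map_smul' := fun _ _ => rfl } C
    fun x => (hP _ (mem_formSpace x)).trans (mul_le_mul_of_nonneg_left (norm_strain_le x) hC),
    fun _ => rfl⟩

theorem eq_zero_of_norm {C : ℝ} (hP : ∀ p ∈ B.formSpace, ‖p.1‖ ≤ C * ‖p.2‖)
    (x : B.EnergySpace) (hx : ‖x‖ = 0) : x = 0 := by
  have h1 : ‖strain x‖ = 0 := le_antisymm ((norm_strain_le x).trans hx.le) (norm_nonneg _)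
  have h2 : ‖vel x‖ = 0 := le_antisymm ((norm_vel_le x).trans hx.le) (norm_nonneg _)
  have h3 := hP _ (mem_formSpace x)
  simp only [h1, mul_zero] at h3
  exact ext' (norm_le_zero_iff.1 h3) (norm_eq_zero.1 h1) (norm_eq_zero.1 h2)

/-- The map to (strain, velocity) is isometric into a Hilbert sum, and its image is the preimage of
the closed space of strains under the first projection. -/
theorem completeSpace {C : ℝ} (hP : ∀ p ∈ B.formSpace, ‖p.1‖ ≤ C * ‖p.2‖) :
    CompleteSpace B.EnergySpace := by
  let Φ : B.EnergySpace →ₗᵢ[ℂ] WithLp 2 (B.StrainL2 × B.L2) :=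
    { toFun := fun x => WithLp.toLp 2 (strain x, vel x)
      map_add' := fun _ _ => rfl
      map_smul' := fun _ _ => rfl
      norm_map' := fun x => by
        refine (sq_eq_sq₀ (norm_nonneg _) (norm_nonneg _)).1 ?_
        rw [norm_sq]
        exact WithLp.prod_norm_sq_eq_of_L2 _ }
  rw [completeSpace_iff_isComplete_range Φ.isometry.isUniformInducing]
  have hW := isClosed_map_snd B.strainGraph.isClosed_topologicalClosure hP
  have he : range Φ = (fun z : WithLp 2 (B.StrainL2 × B.L2) => z.fst) ⁻¹'
      ((B.strainGraph.topologicalClosure.map (LinearMap.snd ℂ B.L2 B.StrainL2) :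
        Submodule ℂ B.StrainL2) : Set B.StrainL2) := by
    ext z
    constructor
    · rintro ⟨x, rfl⟩
      exact ⟨_, mem_formSpace x, rfl⟩
    · rintro ⟨p, hp, hpz⟩
      refine ⟨pair ⟨p, hp⟩ z.snd, ?_⟩
      have : strain (pair ⟨p, hp⟩ z.snd) = z.fst := hpz
      change WithLp.toLp 2 (strain (pair ⟨p, hp⟩ z.snd), z.snd) = z
      rw [this]
      rfl
  rw [he]
  exact (hW.preimage (WithLp.prod_continuous_ofLp 2 B.StrainL2 B.L2).fst).isComplete

end EnergySpace

open EnergySpace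

set_option maxHeartbeats 1000000 in
/-- The statements about the operator and the evolution follow from Green's formula, density and
the Poincaré inequality. -/
theorem evolution_of_form (G : Submodule ℂ (B.L2 × B.L2))
    (hG : ∀ p ∈ G, ∃ e, (p.1, e) ∈ B.strainGraph ∧
      ∀ q ∈ B.strainGraph, inner ℂ (-p.2) q.1 = inner ℂ e q.2)
    (hS : ∀ p ∈ B.strainGraph, ∃ b, (p.1, b) ∈ G ∧
      ∀ q ∈ B.strainGraph, inner ℂ (-b) q.1 = inner ℂ p.2 q.2)
    (hdense : Dense (Prod.fst '' (G : Set (B.L2 × B.L2)))) {C : ℝ} (hC : 0 ≤ C)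
    (hP₀ : ∀ p ∈ B.strainGraph, ‖p.1‖ ≤ C * ‖p.2‖) :
    ∃ E A : B.L2 →ₗ.[ℂ] B.L2, E.graph = G ∧ Dense (E.domain : Set B.L2) ∧
      E.IsFormalAdjoint E ∧ E ≤ A ∧ IsSelfAdjoint A ∧
      (∀ a : A.domain, ∃ e : B.StrainL2, ((a : B.L2), e) ∈ B.formSpace ∧
        ∀ p ∈ B.formSpace, inner ℂ (-A a) p.1 = inner ℂ e p.2) ∧
      (∀ p ∈ B.formSpace, ∀ q ∈ B.formSpace, p.1 = q.1 → p = q) ∧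
      (∀ x : B.EnergySpace, ‖x‖ = 0 → x = 0) ∧
      CompleteSpace B.EnergySpace ∧
      Dense {x : B.EnergySpace | ∃ y, B.EvolEq A x y} ∧
      (∀ x y : B.EnergySpace, B.EvolEq A x y ↔
        ∀ z w, B.EvolEq A z w → inner ℂ w x = -inner ℂ z y) ∧
      ∃ U : ℝ → (B.EnergySpace ≃ₗᵢ[ℂ] B.EnergySpace),
        (∀ s t, U (s + t) = U s * U t) ∧
        (∀ x, Continuous fun t => U t x) ∧
        (∀ x y, B.EvolEq A x y ↔ HasDerivAt (fun t => U t x) y 0) ∧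
        ∀ x y, B.EvolEq A x y →
          B.SolvesCauchy A (disp x) (vel x) (fun t => disp (U t x)) (fun t => vel (U t x)) ∧
          ∀ u v, B.SolvesCauchy A (disp x) (vel x) u v →
            u = (fun t => disp (U t x)) ∧ v = fun t => vel (U t x) := by
  have hP : ∀ p ∈ B.formSpace, ‖p.1‖ ≤ C * ‖p.2‖ := fun p hp => bound_closure hP₀ hp
  have hclosed : IsClosed (B.formSpace : Set (B.L2 × B.StrainL2)) :=
    B.strainGraph.isClosed_topologicalClosure
  have hsub : B.strainGraph ≤ B.formSpace := B.strainGraph.le_topologicalClosure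
  obtain ⟨R, L, hmem, hin⟩ := exists_solution hclosed hP
  have hRs := solution_selfAdjoint hmem hin
  have hD : Dense (Prod.fst '' (B.formSpace : Set (B.L2 × B.StrainL2))) := by
    refine hdense.mono ?_
    rintro _ ⟨p, hp, rfl⟩
    obtain ⟨e, he, -⟩ := hG p hp
    exact ⟨_, hsub he, rfl⟩
  have hRi := solution_injective hD hmem hin
  obtain ⟨A, hAs, hA⟩ := exists_neg_inverse hRs hRi
  -- the elastic operator
  have hsymm : ∀ p ∈ G, ∀ q ∈ G, inner ℂ p.2 q.1 = inner ℂ p.1 q.2 := by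
    intro p hp q hq
    obtain ⟨e, he, he'⟩ := hG p hp
    obtain ⟨f, hf, hf'⟩ := hG q hq
    have h1 := he' _ hf
    have h2 := hf' _ he
    rw [inner_neg_left, neg_eq_iff_eq_neg] at h1 h2
    rw [h1, ← inner_conj_symm p.1, h2, map_neg, inner_conj_symm]
  -- Well-definedness of E: if p.1 = 0, then by symmetry p.2 is orthogonal to the dense domain.
  have hGgr : G.toLinearPMap.graph = G := G.toLinearPMap_graph_eq fun p hp h0 => by
    refine hdense.eq_zero_of_inner_left ℂ ?_
    rintro _ ⟨q, hq, rfl⟩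
    rw [hsymm p hp q hq, h0, inner_zero_left]
  have hGA : ∀ p ∈ G, p ∈ A.graph := by
    intro p hp
    obtain ⟨e, he, he'⟩ := hG p hp
    rw [hA]
    -- The variational solution for -p.2 and the given pair (p.1, e) solve the same problem. Their
    -- difference lies in the form space, and its strain is orthogonal to itself, so the Poincaré
    -- inequality makes the displacements equal.
    have hd := B.formSpace.sub_mem (hmem (-p.2)) (hsub he)
    have h1 : inner ℂ (L (-p.2) - e) (L (-p.2) - e) = 0 := by
      rw [inner_sub_left, sub_eq_zero]
      exact (hin _ _ hd).symm.trans (inner_eq_closure he' hd)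
    have h2 := hP _ hd
    simp only [Prod.snd_sub, Prod.fst_sub, inner_self_eq_zero.1 h1, norm_zero, mul_zero] at h2
    have h3 := sub_eq_zero.1 (norm_le_zero_iff.1 h2)
    rw [← h3, map_neg]
  have hdom : Dense (G.toLinearPMap.domain : Set B.L2) := by
    refine hdense.mono ?_
    rintro _ ⟨p, hp, rfl⟩
    exact LinearPMap.mem_domain_iff.2 ⟨p.2, by rw [hGgr]; exact hp⟩
  -- the strain is unique
  have hstrain : ∀ p ∈ B.formSpace, ∀ q ∈ B.formSpace, p.1 = q.1 → p = q := by
    intro p hp q hq hpq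
    have hd := B.formSpace.sub_mem hp hq
    -- Green's formula moves all derivatives onto the admissible field r and passes to the limit in
    -- the other argument. As the displacements agree, the difference of strains is orthogonal to
    -- every strain, hence to itself.
    have h1 : ∀ r ∈ B.strainGraph, inner ℂ (p.2 - q.2) r.2 = inner ℂ (0 : B.L2) r.1 := by
      intro r hr
      obtain ⟨b, -, hb⟩ := hS r hr
      have h := inner_eq_closure hb hd
      rw [Prod.fst_sub, hpq, sub_self, inner_zero_right, Prod.snd_sub] at h
      rw [inner_zero_left, ← inner_conj_symm, ← h, map_zero]
    have h2 := inner_eq_closure (fun r hr => (h1 r hr).symm) hd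
    rw [inner_zero_left, Prod.snd_sub] at h2
    exact Prod.ext hpq (sub_eq_zero.1 (inner_self_eq_zero.1 h2.symm))
  have hsep := eq_zero_of_norm hP
  have hcomplete := completeSpace hP
  obtain ⟨T, hT⟩ := exists_dispL hC hP
  -- the inverse of the evolution operator
  let J₀ : B.EnergySpace →ₗ[ℂ] B.EnergySpace :=
    { toFun := fun y => pair ⟨(R (-vel y), L (-vel y)), hmem _⟩ (disp y)
      map_add' := fun y z => by
        have h : -vel (y + z) = -vel y + -vel z := neg_add _ _
        refine ext' ?_ ?_ rfl
        · change R (-vel (y + z)) = R (-vel y) + R (-vel z)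
          rw [h, map_add]
        · change L (-vel (y + z)) = L (-vel y) + L (-vel z)
          rw [h, map_add]
      map_smul' := fun c y => by
        have h : -vel (c • y) = c • -vel y := (smul_neg _ _).symm
        refine ext' ?_ ?_ rfl
        · change R (-vel (c • y)) = c • R (-vel y)
          rw [h, map_smul]
        · change L (-vel (c • y)) = c • L (-vel y)
          rw [h, map_smul] }
  let J : B.EnergySpace →L[ℂ] B.EnergySpace := J₀.mkContinuous (‖L‖ + ‖T‖) fun y => by
    refine abs_le_of_sq_le_sq' ?_ (by positivity) |>.2
    rw [norm_sq]
    change ‖L (-vel y)‖ ^ 2 + ‖disp y‖ ^ 2 ≤ _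
    have h1 : ‖L (-vel y)‖ ≤ ‖L‖ * ‖y‖ := (L.le_opNorm _).trans
      (mul_le_mul_of_nonneg_left ((norm_neg _).trans_le (norm_vel_le y)) (norm_nonneg _))
    have h2 : ‖disp y‖ ≤ ‖T‖ * ‖y‖ := by
      rw [← hT]
      exact T.le_opNorm y
    have h3 : 0 ≤ ‖L‖ * ‖y‖ := by positivity
    have h4 : 0 ≤ ‖T‖ * ‖y‖ := by positivity
    nlinarith [norm_nonneg (L (-vel y)), norm_nonneg (disp y), mul_nonneg h3 h4]
  have hJd : ∀ y, disp (J y) = R (-vel y) := fun _ => rfl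
  have hJs : ∀ y, strain (J y) = L (-vel y) := fun _ => rfl
  have hJv : ∀ y, vel (J y) = disp y := fun _ => rfl
  -- Uniqueness of strain matters here: the evolution equation constrains the displacement of x
  -- only, while an element of the energy space also carries a strain.
  have hevol : ∀ x y, B.EvolEq A x y ↔ x = J y := by
    intro x y
    rw [EvolEq, hA]
    constructor
    · rintro ⟨h1, h2⟩
      have h3 : disp x = R (-vel y) := by rw [map_neg]; exact h2
      have h4 := congrArg Prod.snd (hstrain _ (mem_formSpace x) _ (hmem (-vel y)) h3)
      exact ext' h3 h4 h1.symm
    · rintro rfl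
      exact ⟨rfl, by rw [hJd, map_neg]⟩
  have hskew : ∀ x y, inner ℂ (J x) y = -inner ℂ x (J y) := by
    intro x y
    have h1 := hin (-vel x) _ (mem_formSpace y)
    have h2 := hin (-vel y) _ (mem_formSpace x)
    rw [EnergySpace.inner_def, EnergySpace.inner_def, hJs, hJs, hJv, hJv, ← h1,
      ← inner_conj_symm (strain x), ← h2, inner_neg_left, inner_neg_left, map_neg, inner_conj_symm]
    ring
  have hJi : ∀ x, J x = 0 → x = 0 := by
    intro x hx
    have h1 : disp x = 0 := congrArg vel hx
    have h2 : R (-vel x) = 0 := congrArg disp hx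
    have h3 := congrArg Prod.snd
      (hstrain _ (mem_formSpace x) _ (mem_formSpace (0 : B.EnergySpace)) h1)
    exact ext' h1 h3 (neg_eq_zero.1 (hRi _ h2))
  obtain ⟨U, hUadd, hUc, hUJ, hUd, hU0, hJdense⟩ := exists_unitaryGroup_of_separated hsep J hskew hJi
  have hUzero : ∀ x, U 0 x = x := by
    intro x
    have h := congrArg (fun V => V x) (hUadd 0 0)
    rw [add_zero] at h
    exact ((U 0).injective h).symm
  have hself : ∀ x y : B.EnergySpace, (∀ z, inner ℂ z x = inner ℂ z y) → x = y := by
    intro x y h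
    rw [← sub_eq_zero]
    refine hsep _ ?_
    have h0 : inner ℂ (x - y) (x - y) = 0 := by rw [inner_sub_right, h, sub_self]
    have h1 := inner_self_eq_norm_sq (𝕜 := ℂ) (x - y)
    rw [h0, map_zero] at h1
    exact pow_eq_zero_iff two_ne_zero |>.1 h1.symm
  refine ⟨G.toLinearPMap, A, hGgr, hdom, ?_, ?_, hAs, ?_, hstrain, hsep, hcomplete, ?_, ?_,
    U, hUadd, hUc, fun x y => (hevol x y).trans (hU0 x y), ?_⟩
  · intro x y
    have hx := (G.toLinearPMap).mem_graph x
    have hy := (G.toLinearPMap).mem_graph y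
    rw [hGgr] at hx hy
    have h : inner ℂ (G.toLinearPMap x) (y : B.L2) = inner ℂ (x : B.L2) (G.toLinearPMap y) :=
      hsymm (_, _) hx (_, _) hy
    exact h
  · refine LinearPMap.le_of_le_graph ?_
    rw [hGgr]
    exact hGA
  · intro a
    have ha : (a : B.L2) = -R (A a) := (hA _).1 (A.mem_graph a)
    refine ⟨L (-A a), ?_, hin _⟩
    rw [ha, ← map_neg]
    exact hmem _
  · refine hJdense.mono ?_
    rintro _ ⟨y, rfl⟩
    exact ⟨y, (hevol _ _).2 rfl⟩
  · intro x y
    rw [hevol]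
    constructor
    · rintro rfl z w hzw
      rw [(hevol _ _).1 hzw, hskew, neg_neg]
    -- Conversely, testing with the pairs (J w, w) for arbitrary w determines x; this is where J
    -- being everywhere defined yields skew-adjointness and not just skew-symmetry.
    · intro h
      refine hself _ _ fun w => ?_
      rw [h (J w) w ((hevol _ _).2 rfl), hskew, neg_neg]
  · intro x y hxy
    obtain rfl := (hevol _ _).1 hxy
    have hsol : B.SolvesCauchy A (disp (J y)) (vel (J y)) (fun t => disp (U t (J y)))
        (fun t => vel (U t (J y))) := by
      refine ⟨by simp only [hUzero], by simp only [hUzero], fun t => ?_, fun t => ?_⟩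
      · have h := hasDerivAt_comp_of_separated hsep T (hUd t y)
        refine (h.congr_deriv ?_).congr_of_eventuallyEq (Eventually.of_forall fun r => ?_)
        · exact (hT _).trans (by rw [hUJ, hJv])
        · exact (hT _).symm
      · refine ⟨vel (U t y), ?_, ?_⟩
        · rw [hA, hUJ, hJd, map_neg]
        · exact hasDerivAt_comp_of_separated hsep velL (hUd t y)
    refine ⟨hsol, fun u v huv => ?_⟩
    choose w hw hwd using huv.deriv_v
    choose w' hw' hwd' using hsol.deriv_v
    -- The difference of two solutions has zero Cauchy data.
    have key := unique_of_inverse_wave hRs (fun t => u t - disp (U t (J y)))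
      (fun t => v t - vel (U t (J y))) (fun t => w t - w' t)
      (fun t => (huv.deriv_u t).sub (hsol.deriv_u t)) (fun t => (hwd t).sub (hwd' t))
      (fun t => by
        have h1 : u t = -R (w t) := (hA _).1 (hw t)
        have h2 : disp (U t (J y)) = -R (w' t) := (hA _).1 (hw' t)
        rw [h1, h2, map_sub]
        abel)
      (fun f => by
        rw [hin f _ (hmem f)]
        exact inner_self_nonneg)
      (by simp only [huv.init_u, hUzero, sub_self])
      (by simp only [huv.init_v, hUzero, sub_self])
    exact ⟨funext fun t => sub_eq_zero.1 (congrFun key.1 t),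
      funext fun t => sub_eq_zero.1 (congrFun key.2 t)⟩

end ElasticBody

/-! ### The divergence theorem for fields tangent to the boundary -/

section Divergence

theorem mul_le_sub_of_le_fderiv {φ : E3 → ℝ} (hφ : Differentiable ℝ φ) {s : Set E3}
    (hs : Convex ℝ s) {a : ℝ} {e : E3} (ha : ∀ y ∈ s, a ≤ fderiv ℝ φ y e) {y : E3} {t : ℝ}
    (ht : 0 ≤ t) (hy : y ∈ s) (hyt : y + t • e ∈ s) : a * t ≤ φ (y + t • e) - φ y := by
  have hd : ∀ τ : ℝ, HasDerivAt (fun τ : ℝ => φ (y + τ • e)) (fderiv ℝ φ (y + τ • e) e) τ := by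
    intro τ
    have h1 : HasDerivAt (fun τ : ℝ => y + τ • e) e τ := by
      simpa using ((hasDerivAt_id τ).smul_const e).const_add y
    exact (hφ (y + τ • e)).hasFDerivAt.comp_hasDerivAt τ h1
  have hmem : ∀ τ ∈ Icc 0 t, y + τ • e ∈ s := by
    intro τ hτ
    rcases ht.eq_or_lt with h0 | h0
    · have : τ = 0 := le_antisymm (hτ.2.trans h0.ge) hτ.1
      simpa [this] using hy
    have h2 := hs.add_smul_mem hy hyt (t := τ / t)
      ⟨div_nonneg hτ.1 h0.le, (div_le_one h0).2 hτ.2⟩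
    rwa [smul_smul, div_mul_cancel₀ _ h0.ne'] at h2
  have h := (convex_Icc (0 : ℝ) t).mul_sub_le_image_sub_of_le_deriv
    (f := fun τ : ℝ => φ (y + τ • e)) (C := a)
    (fun τ _ => (hd τ).continuousAt.continuousWithinAt)
    (fun τ _ => (hd τ).differentiableAt.differentiableWithinAt)
    (fun τ hτ => by
      rw [(hd τ).deriv]
      exact ha _ (hmem τ (interior_subset hτ)))
    0 (left_mem_Icc.2 ht) t (right_mem_Icc.2 ht) ht
  simpa using h

namespace IsLocalDefining

variable {D : Set E3} {x : E3} {φ : E3 → ℝ}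

theorem differentiable (h : IsLocalDefining D x φ) : Differentiable ℝ φ :=
  h.smooth.differentiable (by simp)

/-- Near `x`, the defining function increases in a fixed direction. -/
theorem exists_direction (h : IsLocalDefining D x φ) :
    ∃ e : E3, ∀ᶠ y in 𝓝 x, 1 / 2 ≤ fderiv ℝ φ y e := by
  obtain ⟨v, hv⟩ : ∃ v, fderiv ℝ φ x v ≠ 0 := by
    by_contra! hc
    exact h.fderiv_ne (ContinuousLinearMap.ext hc)
  refine ⟨(fderiv ℝ φ x v)⁻¹ • v, ?_⟩
  have hc : Continuous fun y => fderiv ℝ φ y ((fderiv ℝ φ x v)⁻¹ • v) :=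
    (h.smooth.continuous_fderiv (by simp)).clm_apply continuous_const
  have h1 : fderiv ℝ φ x ((fderiv ℝ φ x v)⁻¹ • v) = 1 := by
    rw [map_smul, smul_eq_mul, inv_mul_cancel₀ hv]
  have h2 := hc.continuousAt.eventually (lt_mem_nhds (a := (1 / 2 : ℝ))
    (show 1 / 2 < fderiv ℝ φ x ((fderiv ℝ φ x v)⁻¹ • v) by rw [h1]; norm_num))
  exact h2.mono fun y hy => hy.le

/-- A frontier point of the open set D is not in D, so φ ≥ 0 there, and it is a limit of points of
D, so φ ≤ 0. -/
theorem eventually_eq_zero (h : IsLocalDefining D x φ) (hD : IsOpen D) :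
    ∀ᶠ y in 𝓝 x, y ∈ frontier D → φ y = 0 := by
  filter_upwards [eventually_eventually_nhds.2 h.mem_iff] with y hy hyD
  have hyD' : y ∉ D := fun hm => by
    rw [hD.frontier_eq] at hyD
    exact hyD.2 hm
  refine le_antisymm ?_ (not_lt.1 fun hlt => hyD' (hy.self_of_nhds.2 hlt))
  by_contra! hlt
  have h1 := h.smooth.continuous.continuousAt.eventually (lt_mem_nhds hlt)
  have h2 := mem_closure_iff_frequently.1 (frontier_subset_closure hyD)
  obtain ⟨z, hz, hz1, hz2⟩ := (h2.and_eventually (h1.and hy)).exists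
  exact absurd (hz2.1 hz) (not_lt.2 (le_of_lt hz1))

/-- A `C¹` function which vanishes at the boundary is bounded by the defining function. -/
theorem exists_norm_le (h : IsLocalDefining D x φ) (hD : IsOpen D) (hx : x ∈ frontier D)
    {f : E3 → ℂ} (hf : ContDiffAt ℝ 1 f x) (hf0 : ∀ᶠ y in 𝓝 x, y ∈ frontier D → f y = 0) :
    ∃ C, 0 ≤ C ∧ ∀ᶠ y in 𝓝 x, φ y < 0 → ‖f y‖ ≤ C * |φ y| := by
  obtain ⟨e, he⟩ := h.exists_direction
  obtain ⟨K, s, hs, hK⟩ := hf.exists_lipschitzOnWith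
  obtain ⟨r, hr, hball⟩ := Metric.eventually_nhds_iff_ball.1
    (((he.and h.mem_iff).and hf0).and (eventually_mem_set.2 hs))
  have hφx : φ x = 0 := (h.eventually_eq_zero hD).self_of_nhds hx
  -- The Lipschitz constant of f times the distance to a boundary point along e, which is at most
  -- 2|φ y|‖e‖.
  refine ⟨K * (2 * ‖e‖), by positivity, ?_⟩
  have hsmall : ∀ᶠ y in 𝓝 x, 2 * |φ y| * ‖e‖ < r / 2 := by
    have hc : Continuous fun y => 2 * |φ y| * ‖e‖ :=
      (continuous_const.mul h.smooth.continuous.abs).mul continuous_const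
    exact hc.continuousAt.eventually (gt_mem_nhds (by simp [hφx, hr]))
  filter_upwards [hsmall, Metric.ball_mem_nhds x (half_pos hr)] with y hy hyb hneg
  -- Along e the function φ grows at rate at least 1/2, so starting from φ y < 0 it reaches 0 by
  -- time 2|φ y|.
  set T := 2 * |φ y| with hT
  have hT0 : 0 ≤ T := by positivity
  have hin : ∀ t ∈ Icc 0 T, y + t • e ∈ Metric.ball x r := by
    intro t ht
    have h1 : dist (y + t • e) y ≤ T * ‖e‖ := by
      rw [dist_eq_norm, add_sub_cancel_left, norm_smul, Real.norm_of_nonneg ht.1]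
      exact mul_le_mul_of_nonneg_right ht.2 (norm_nonneg _)
    have h2 := dist_triangle (y + t • e) y x
    rw [Metric.mem_ball] at hyb ⊢
    linarith
  have hmono : ∀ t₁ ∈ Icc 0 T, ∀ t₂ ∈ Icc 0 T, t₁ ≤ t₂ →
      1 / 2 * (t₂ - t₁) ≤ φ (y + t₂ • e) - φ (y + t₁ • e) := by
    intro t₁ h₁ t₂ h₂ h12
    have e2 : y + t₂ • e = (y + t₁ • e) + (t₂ - t₁) • e := by rw [sub_smul]; abel
    have := mul_le_sub_of_le_fderiv h.differentiable (convex_ball x r)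
      (fun z hz => (hball z hz).1.1.1) (sub_nonneg.2 h12) (hin t₁ h₁) (e2 ▸ hin t₂ h₂)
    rwa [← e2] at this
  have hcont : Continuous fun t : ℝ => φ (y + t • e) := h.smooth.continuous.comp (by fun_prop)
  obtain ⟨t, ht, ht0⟩ : ∃ t ∈ Icc 0 T, φ (y + t • e) = 0 := by
    have h1 := hmono 0 ⟨le_rfl, hT0⟩ T ⟨hT0, le_rfl⟩ hT0
    simp only [zero_smul, add_zero, sub_zero] at h1
    refine intermediate_value_Icc (f := fun t : ℝ => φ (y + t • e)) hT0 hcont.continuousOn ⟨?_, ?_⟩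
    · simpa using hneg.le
    · have := neg_abs_le (φ y)
      change 0 ≤ φ (y + T • e)
      linarith
  have htpos : 0 < t := by
    refine ht.1.lt_of_ne fun h0 => ?_
    rw [← h0, zero_smul, add_zero] at ht0
    exact hneg.ne ht0
  have hz : y + t • e ∈ frontier D := by
    rw [hD.frontier_eq]
    refine ⟨?_, fun hm => ?_⟩
    · have hlim : Tendsto (fun τ : ℝ => y + τ • e) (𝓝[<] t) (𝓝 (y + t • e)) := by
        have : Continuous fun τ : ℝ => y + τ • e := by fun_prop
        exact this.continuousAt.tendsto.mono_left nhdsWithin_le_nhds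
      refine mem_closure_of_tendsto hlim ?_
      filter_upwards [Ioo_mem_nhdsLT htpos] with τ hτ
      have hτ' : τ ∈ Icc 0 T := ⟨hτ.1.le, hτ.2.le.trans ht.2⟩
      have h1 := hmono τ hτ' t ht hτ.2.le
      rw [ht0] at h1
      exact (hball _ (hin τ hτ')).1.1.2.2 (by linarith [hτ.2])
    · exact absurd ((hball _ (hin t ht)).1.1.2.1 hm) (by rw [ht0]; exact lt_irrefl 0)
  have hyin : y ∈ Metric.ball x r := Metric.ball_subset_ball (half_le_self hr.le) hyb
  have h3 := hK.dist_le_mul y (hball y hyin).2 _ (hball _ (hin t ht)).2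
  rw [(hball _ (hin t ht)).1.2 hz, dist_zero_right, dist_eq_norm, sub_add_cancel_left, norm_neg,
    norm_smul, Real.norm_of_nonneg ht.1] at h3
  refine h3.trans ?_
  rw [mul_assoc]
  refine mul_le_mul_of_nonneg_left ?_ K.2
  calc t * ‖e‖ ≤ T * ‖e‖ := mul_le_mul_of_nonneg_right ht.2 (norm_nonneg _)
    _ = 2 * ‖e‖ * |φ y| := by rw [hT]; ring

end IsLocalDefining

/-- Smooth surfaces are null sets. -/
theorem HasSmoothBoundary.volume_frontier {D : Set E3} (h : HasSmoothBoundary D) (hD : IsOpen D) :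
    volume (frontier D) = 0 := by
  refine measure_null_of_locally_null _ fun x hx => ?_
  obtain ⟨φ, hφ⟩ := h x hx
  obtain ⟨e, he⟩ := hφ.exists_direction
  obtain ⟨r, hr, hball⟩ := Metric.eventually_nhds_iff_ball.1 (he.and (hφ.eventually_eq_zero hD))
  -- Since φ vanishes on the frontier and strictly increases along e, each line in that direction
  -- meets this piece at most once. Its translates by e/(n+1) are therefore disjoint, and infinitely
  -- many of them fit in a bounded set.
  refine ⟨frontier D ∩ Metric.ball x r, inter_mem_nhdsWithin _ (Metric.ball_mem_nhds x hr), ?_⟩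
  refine Measure.addHaar_eq_zero_of_disjoint_translates volume
    (fun n : ℕ => (1 / ((n : ℝ) + 1)) • e) ?_ ?_
    (isClosed_frontier.measurableSet.inter Metric.isOpen_ball.measurableSet)
  · have := tendsto_one_div_add_atTop_nhds_zero_nat (𝕜 := ℝ)
    exact Metric.isBounded_range_of_tendsto _ (this.smul_const e)
  have key : ∀ y ∈ frontier D ∩ Metric.ball x r, ∀ z ∈ frontier D ∩ Metric.ball x r, ∀ t : ℝ,
      0 < t → z = y + t • e → False := by
    rintro y ⟨hy, hyb⟩ z ⟨hz, hzb⟩ t ht rfl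
    have h1 := mul_le_sub_of_le_fderiv hφ.differentiable (convex_ball x r)
      (fun z hz => (hball z hz).1) ht.le hyb hzb
    rw [(hball _ hyb).2 hy, (hball _ hzb).2 hz] at h1
    linarith
  intro m n hmn
  rw [Function.onFun, Set.disjoint_left]
  rintro w hm hn
  rw [singleton_add, mem_image] at hm hn
  obtain ⟨y, hy, rfl⟩ := hm
  obtain ⟨z, hz, hzy⟩ := hn
  have hne : 1 / ((m : ℝ) + 1) ≠ 1 / ((n : ℝ) + 1) := by
    intro h
    have := inv_injective ((one_div _).symm.trans (h.trans (one_div _)))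
    exact hmn (by exact_mod_cast add_right_cancel this)
  rcases lt_or_gt_of_ne hne with h | h
  · refine key z hz y hy _ (sub_pos.2 h) ?_
    rw [sub_smul, ← sub_eq_zero]
    rw [← sub_eq_zero] at hzy
    rw [← neg_eq_zero, ← hzy]
    abel
  · refine key y hy z hz _ (sub_pos.2 h) ?_
    rw [sub_smul, ← sub_eq_zero]
    rw [← sub_eq_zero] at hzy
    rw [← hzy]
    abel

theorem continuous_pd {F : Type*} [NormedAddCommGroup F] [NormedSpace ℝ F] {f : E3 → F}
    (hf : ContDiff ℝ 1 f) (i : Fin 3) : Continuous (pd i f) :=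
  (hf.continuous_fderiv one_ne_zero).clm_apply continuous_const

theorem pd_mul {f g : E3 → ℂ} {x : E3} (hf : DifferentiableAt ℝ f x)
    (hg : DifferentiableAt ℝ g x) (i : Fin 3) :
    pd i (fun y => f y * g y) x = pd i f x * g x + f x * pd i g x := by
  unfold pd
  rw [fderiv_fun_mul hf hg]
  simp only [add_apply, smul_apply, smul_eq_mul]
  ring

theorem pd_congr {F : Type*} [NormedAddCommGroup F] [NormedSpace ℝ F] {f g : E3 → F} {x : E3}
    (h : f =ᶠ[𝓝 x] g) (i : Fin 3) : pd i f x = pd i g x := by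
  rw [pd, pd, h.fderiv_eq]

theorem pd_eq_zero {F : Type*} [NormedAddCommGroup F] [NormedSpace ℝ F] {f : E3 → F} {x : E3}
    (h : x ∉ tsupport f) (i : Fin 3) : pd i f x = 0 := by
  rw [pd_congr (notMem_tsupport_iff_eventuallyEq.1 h) i]
  simp [pd]

theorem hasCompactSupport_pd {F : Type*} [NormedAddCommGroup F] [NormedSpace ℝ F] {f : E3 → F}
    (h : HasCompactSupport f) (i : Fin 3) : HasCompactSupport (pd i f) :=
  h.mono' fun _ hx => by_contra fun hn => hx (pd_eq_zero hn i)

theorem integrable_pd {f : E3 → ℂ} (hf : ContDiff ℝ 1 f) (hc : HasCompactSupport f) (i : Fin 3) :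
    Integrable (pd i f) :=
  (continuous_pd hf i).integrable_of_hasCompactSupport (hasCompactSupport_pd hc i)

theorem integral_pd_eq_zero {f : E3 → ℂ} (hf : ContDiff ℝ 1 f) (hc : HasCompactSupport f)
    (i : Fin 3) : ∫ x, pd i f x = 0 := by
  -- Integration by parts against the constant function 1.
  have h := integral_bilinear_hasLineDerivAt_right_eq_neg_left_of_integrable (μ := volume)
    (f := fun _ : E3 => (1 : ℂ)) (f' := fun _ => 0) (g := f) (g' := pd i f)
    (v := EuclideanSpace.single i 1) (B := ContinuousLinearMap.mul ℝ ℂ) (by simp)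
    (by simpa using integrable_pd hf hc i)
    (by simpa using hf.continuous.integrable_of_hasCompactSupport hc)
    (fun x _ => by simpa using (hasFDerivAt_const (1 : ℂ) x).hasLineDerivAt _)
    (fun x _ => ((hf.differentiable one_ne_zero) x).hasFDerivAt.hasLineDerivAt _)
  simpa using h

/-- The values 0 and 1 are the extreme values of the transition function, so Fermat's criterion
applies, endpoints included. -/
theorem deriv_smoothTransition_eq_zero {s : ℝ} (hs : s ≤ 0 ∨ 1 ≤ s) :
    deriv Real.smoothTransition s = 0 := by
  rcases hs with hs | hs
  · refine IsLocalMin.deriv_eq_zero (Eventually.of_forall fun y => ?_)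
    rw [Real.smoothTransition.zero_of_nonpos hs]
    exact Real.smoothTransition.nonneg y
  · refine IsLocalMax.deriv_eq_zero (Eventually.of_forall fun y => ?_)
    rw [Real.smoothTransition.one_of_one_le hs]
    exact Real.smoothTransition.le_one y

/-- With s = -(n+1)φ, the size of the derivative of the n-th cutoff times |φ| is |s ψ'(s)| up to ∇φ,
where ψ is the transition function. A bound independent of n is what dominated convergence needs. -/
theorem exists_bound_deriv_smoothTransition :
    ∃ M, 0 ≤ M ∧ ∀ s : ℝ, |s * deriv Real.smoothTransition s| ≤ M := by
  have hc : Continuous (deriv Real.smoothTransition) :=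
    (Real.smoothTransition.contDiff (n := 1)).continuous_deriv le_rfl
  obtain ⟨M, hM⟩ := isCompact_Icc.exists_bound_of_continuousOn (s := Icc (0 : ℝ) 1)
    (continuous_id.mul hc).continuousOn
  refine ⟨M, (norm_nonneg _).trans (hM 0 (by simp)), fun s => ?_⟩
  by_cases hs : s ∈ Icc (0 : ℝ) 1
  · exact hM s hs
  · have h : s ≤ 0 ∨ 1 ≤ s := by
      by_contra! h
      exact hs ⟨h.1.le, h.2.le⟩
    rw [deriv_smoothTransition_eq_zero h, mul_zero, abs_zero]
    exact (norm_nonneg _).trans (hM 0 (by simp))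

end Divergence

/-! ### The divergence theorem by smooth cutoffs -/

section Divergence

/-- The coordinate divergence `∑ ∂ᵢ Yᵢ`. -/
def coordDiv (Y : Fin 3 → E3 → ℂ) (x : E3) : ℂ := ∑ b, pd b (Y b) x

theorem integrable_coordDiv {Z : Fin 3 → E3 → ℂ} (hZ : ∀ b, ContDiff ℝ 1 (Z b))
    (hc : ∀ b, HasCompactSupport (Z b)) : Integrable (coordDiv Z) :=
  integrable_finsetSum _ fun b _ => integrable_pd (hZ b) (hc b) b

theorem integral_coordDiv_eq_zero {Z : Fin 3 → E3 → ℂ} (hZ : ∀ b, ContDiff ℝ 1 (Z b))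
    (hc : ∀ b, HasCompactSupport (Z b)) : ∫ x, coordDiv Z x = 0 := by
  unfold coordDiv
  rw [integral_finsetSum _ fun b _ => integrable_pd (hZ b) (hc b) b]
  exact Finset.sum_eq_zero fun b _ => integral_pd_eq_zero (hZ b) (hc b) b

theorem coordDiv_congr {Y Z : Fin 3 → E3 → ℂ} {x : E3} (h : ∀ b, Y b =ᶠ[𝓝 x] Z b) :
    coordDiv Y x = coordDiv Z x :=
  Finset.sum_congr rfl fun b _ => pd_congr (h b) b

theorem contDiff_mul_of_tsupport {χ f : E3 → ℂ} {N : Set E3} (hN : IsOpen N)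
    (hχ : ContDiff ℝ 1 χ) (hs : tsupport χ ⊆ N) (hf : ContDiffOn ℝ 1 f N) :
    ContDiff ℝ 1 fun x => χ x * f x := by
  rw [contDiff_iff_contDiffAt]
  intro x
  by_cases hx : x ∈ N
  · exact hχ.contDiffAt.mul (hf.contDiffAt (hN.mem_nhds hx))
  · have h0 : (fun x => χ x * f x) =ᶠ[𝓝 x] fun _ => 0 := by
      filter_upwards [notMem_tsupport_iff_eventuallyEq.1 fun h => hx (hs h)] with y hy
      simp only [hy, Pi.zero_apply, zero_mul]
    exact contDiffAt_const.congr_of_eventuallyEq h0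

/-- The smooth approximations of the indicator function of `{φ < 0}`. -/
def sideCutoff (φ : E3 → ℝ) (n : ℕ) (x : E3) : ℂ :=
  (Real.smoothTransition (-(((n : ℝ) + 1) * φ x)) : ℝ)

theorem contDiff_sideCutoff {φ : E3 → ℝ} (hφ : ContDiff ℝ ∞ φ) (n : ℕ) :
    ContDiff ℝ 1 (sideCutoff φ n) := by
  refine Complex.ofRealCLM.contDiff.comp ?_
  exact Real.smoothTransition.contDiff.comp
    (contDiff_const.mul (hφ.of_le (by exact_mod_cast le_top))).neg

theorem pd_sideCutoff {φ : E3 → ℝ} (hφ : ContDiff ℝ ∞ φ) (n : ℕ) (x : E3) (b : Fin 3) :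
    pd b (sideCutoff φ n) x =
      ((deriv Real.smoothTransition (-(((n : ℝ) + 1) * φ x)) * -((n : ℝ) + 1) : ℝ) : ℂ) *
        ((pd b φ x : ℝ) : ℂ) := by
  have h1 : HasFDerivAt (fun x => -(((n : ℝ) + 1) * φ x)) (-(((n : ℝ) + 1) • fderiv ℝ φ x)) x :=
    ((hφ.differentiable (by simp) x).hasFDerivAt.const_mul ((n : ℝ) + 1)).neg
  have h2 := ((Real.smoothTransition.contDiff (n := 1)).differentiable one_ne_zero
    (-(((n : ℝ) + 1) * φ x))).hasDerivAt.comp_hasFDerivAt x h1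
  have h3 := Complex.ofRealCLM.hasFDerivAt.comp x h2
  have h4 : HasFDerivAt (sideCutoff φ n) _ x := h3
  rw [pd, h4.fderiv, pd]
  simp
  ring

theorem tendsto_sideCutoff {φ : E3 → ℝ} {x : E3} (hx : φ x < 0) :
    ∀ᶠ n : ℕ in atTop, 1 ≤ -(((n : ℝ) + 1) * φ x) := by
  obtain ⟨m, hm⟩ := exists_nat_ge (1 / -φ x)
  filter_upwards [eventually_ge_atTop m] with n hn
  have h1 : (m : ℝ) ≤ n := by exact_mod_cast hn
  have h2 : 0 < -φ x := neg_pos.2 hx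
  rw [div_le_iff₀ h2] at hm
  nlinarith

/-- The divergence theorem for fields supported near a boundary point, and tangent to the
boundary. -/
theorem setIntegral_coordDiv_of_local {D : Set E3} (hD : IsOpen D) {φ : E3 → ℝ}
    (hφ : ContDiff ℝ ∞ φ) {Z : Fin 3 → E3 → ℂ} (hZ : ∀ b, ContDiff ℝ 1 (Z b))
    (hc : ∀ b, HasCompactSupport (Z b)) {m : E3 → ℝ} (hm : Integrable m) (hm0 : ∀ x, 0 ≤ m x)
    (hmem : ∀ x, (∃ b, x ∈ tsupport (Z b)) → (x ∈ D ↔ φ x < 0))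
    (hbound : ∀ x, φ x < 0 → ‖∑ b, ((pd b φ x : ℝ) : ℂ) * Z b x‖ ≤ m x * |φ x|) :
    ∫ x in D, coordDiv Z x = 0 := by
  obtain ⟨M, hM0, hM⟩ := exists_bound_deriv_smoothTransition
  set F : ℕ → E3 → ℂ := fun n x => coordDiv (fun b y => sideCutoff φ n y * Z b y) x with hF
  have hF0 : ∀ n, ∫ x, F n x = 0 := fun n =>
    integral_coordDiv_eq_zero (fun b => (contDiff_sideCutoff hφ n).mul (hZ b))
      fun b => (hc b).mul_left
  -- The second term, of size n on a layer of width 1/n, contains only the component of Z normal to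
  -- the level sets of φ. By `hbound` that component is O(|φ|), so the term stays bounded.
  have hFe : ∀ n x, F n x = sideCutoff φ n x * coordDiv Z x +
      ((deriv Real.smoothTransition (-(((n : ℝ) + 1) * φ x)) * -((n : ℝ) + 1) : ℝ) : ℂ) *
        ∑ b, ((pd b φ x : ℝ) : ℂ) * Z b x := by
    intro n x
    simp only [hF, coordDiv, Finset.mul_sum, ← Finset.sum_add_distrib]
    refine Finset.sum_congr rfl fun b _ => ?_
    rw [pd_mul ((contDiff_sideCutoff hφ n).differentiable one_ne_zero x)
      ((hZ b).differentiable one_ne_zero x), pd_sideCutoff hφ]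
    ring
  have hlim : Tendsto (fun n => ∫ x, F n x) atTop (𝓝 (∫ x, D.indicator (coordDiv Z) x)) := by
    refine tendsto_integral_of_dominated_convergence (fun x => ‖coordDiv Z x‖ + M * m x) ?_ ?_ ?_ ?_
    · intro n
      exact (integrable_coordDiv (fun b => (contDiff_sideCutoff hφ n).mul (hZ b))
        fun b => (hc b).mul_left).aestronglyMeasurable
    · exact (integrable_coordDiv hZ hc).norm.add (hm.const_mul M)
    · refine fun n => Eventually.of_forall fun x => ?_
      rw [hFe]
      refine (norm_add_le _ _).trans (add_le_add ?_ ?_)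
      · rw [norm_mul]
        refine mul_le_of_le_one_left (norm_nonneg _) ?_
        rw [sideCutoff, Complex.norm_real, Real.norm_of_nonneg (Real.smoothTransition.nonneg _)]
        exact Real.smoothTransition.le_one _
      · rcases lt_or_ge (φ x) 0 with hx | hx
        · rw [norm_mul, Complex.norm_real, Real.norm_eq_abs]
          have h1 := hM (-(((n : ℝ) + 1) * φ x))
          calc _ ≤ |deriv Real.smoothTransition (-(((n : ℝ) + 1) * φ x)) * -((n : ℝ) + 1)| *
                (m x * |φ x|) := mul_le_mul_of_nonneg_left (hbound x hx) (abs_nonneg _)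
            _ = |-(((n : ℝ) + 1) * φ x) * deriv Real.smoothTransition (-(((n : ℝ) + 1) * φ x))| *
                m x := by
              simp only [abs_mul, abs_neg]
              ring
            _ ≤ M * m x := mul_le_mul_of_nonneg_right h1 (hm0 x)
        · rw [deriv_smoothTransition_eq_zero (Or.inl (neg_nonpos.2 (by positivity)))]
          simp only [zero_mul, Complex.ofReal_zero, norm_zero]
          exact mul_nonneg hM0 (hm0 x)
    -- At each fixed point the cutoff is eventually constant, with zero derivative, so the boundary
    -- term disappears in the limit.
    · refine Eventually.of_forall fun x => ?_
      by_cases hx : ∃ b, x ∈ tsupport (Z b)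
      · by_cases hxD : x ∈ D
        · rw [indicator_of_mem hxD]
          refine tendsto_const_nhds.congr' ?_
          filter_upwards [tendsto_sideCutoff ((hmem x hx).1 hxD)] with n hn
          rw [hFe, deriv_smoothTransition_eq_zero (Or.inr hn), sideCutoff,
            Real.smoothTransition.one_of_one_le hn]
          simp
        · rw [indicator_of_notMem hxD]
          refine tendsto_const_nhds.congr fun n => ?_
          have hx0 : 0 ≤ φ x := not_lt.1 fun h => hxD ((hmem x hx).2 h)
          have hn : -(((n : ℝ) + 1) * φ x) ≤ 0 := neg_nonpos.2 (by positivity)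
          rw [hFe, deriv_smoothTransition_eq_zero (Or.inl hn), sideCutoff,
            Real.smoothTransition.zero_of_nonpos hn]
          simp
      · push Not at hx
        have h0 : coordDiv Z x = 0 := Finset.sum_eq_zero fun b _ => pd_eq_zero (hx b) b
        have h1 : ∀ b, Z b x = 0 := fun b => image_eq_zero_of_notMem_tsupport (hx b)
        have h2 : D.indicator (coordDiv Z) x = 0 := by
          by_cases hxD : x ∈ D <;> simp [hxD, h0]
        rw [h2]
        refine tendsto_const_nhds.congr fun n => ?_
        rw [hFe, h0]
        simp [h1]
  rw [← integral_indicator hD.measurableSet]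
  refine tendsto_nhds_unique hlim ?_
  simp only [hF0]
  exact tendsto_const_nhds

/-- The divergence theorem for `χ Y`, where `χ` is supported near a given point and `Y` is tangent
to the boundary. -/
theorem exists_nhds_setIntegral_coordDiv {D N : Set E3} (hD : IsOpen D)
    (hsm : HasSmoothBoundary D) (hN : IsOpen N) {Y : Fin 3 → E3 → ℂ}
    (hY : ∀ b, ContDiffOn ℝ 1 (Y b) N) (hYN : ∀ x ∈ frontier D, ∀ φ, IsLocalDefining D x φ →
      ∑ b, ((pd b φ x : ℝ) : ℂ) * Y b x = 0) {x : E3} (hx : x ∈ closure D) (hxN : x ∈ N) :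
    ∃ W, IsOpen W ∧ x ∈ W ∧ W ⊆ N ∧ ∀ χ : E3 → ℂ, ContDiff ℝ 1 χ → HasCompactSupport χ →
      tsupport χ ⊆ W → ∫ y in D, coordDiv (fun b z => χ z * Y b z) y = 0 := by
  have hsub : ∀ (χ : E3 → ℂ) b, tsupport (fun z => χ z * Y b z) ⊆ tsupport χ := fun χ b =>
    closure_mono fun z hz hχ => hz (by simp [hχ])
  by_cases hxD : x ∈ D
  · refine ⟨D ∩ N, hD.inter hN, ⟨hxD, hxN⟩, inter_subset_right, fun χ hχ hc hs => ?_⟩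
    rw [setIntegral_eq_integral_of_forall_compl_eq_zero fun y hy => ?_]
    · exact integral_coordDiv_eq_zero
        (fun b => contDiff_mul_of_tsupport hN hχ (hs.trans inter_subset_right) (hY b))
        fun b => hc.mul_right
    · exact Finset.sum_eq_zero fun b _ => pd_eq_zero (fun h => hy (hs (hsub χ b h)).1) b
  have hxf : x ∈ frontier D := by
    rw [hD.frontier_eq]
    exact ⟨hx, hxD⟩
  obtain ⟨φ, hφ⟩ := hsm x hxf
  have hpd : ∀ b, ContDiff ℝ 1 (pd b φ) := fun b =>
    ((contDiff_infty.1 hφ.smooth 2).fderiv_right (m := 1) one_add_one_eq_two.le).clm_apply contDiff_const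
  have hf : ContDiffAt ℝ 1 (fun y => ∑ b, ((pd b φ y : ℝ) : ℂ) * Y b y) x := by
    refine ContDiffAt.sum fun b _ => ContDiffAt.mul ?_ ((hY b).contDiffAt (hN.mem_nhds hxN))
    exact (Complex.ofRealCLM.contDiff.comp (hpd b)).contDiffAt
  obtain ⟨e, he⟩ := hφ.exists_direction
  -- The same φ is a defining function at every nearby boundary point, so tangency there may be
  -- tested with it.
  have hf0 : ∀ᶠ y in 𝓝 x, y ∈ frontier D → ∑ b, ((pd b φ y : ℝ) : ℂ) * Y b y = 0 := by
    filter_upwards [eventually_eventually_nhds.2 hφ.mem_iff, he] with y hy hye hyf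
    refine hYN y hyf φ ⟨hφ.smooth, fun h0 => ?_, hy⟩
    rw [h0] at hye
    norm_num at hye
  obtain ⟨C, hC0, hC⟩ := hφ.exists_norm_le hD hxf hf hf0
  obtain ⟨W, hW, hWo, hxW⟩ := eventually_nhds_iff.1
    ((hC.and hφ.mem_iff).and (eventually_mem_set.2 (hN.mem_nhds hxN)))
  refine ⟨W, hWo, hxW, fun y hy => (hW y hy).2, fun χ hχ hc hs => ?_⟩
  refine setIntegral_coordDiv_of_local hD hφ.smooth (m := fun y => C * ‖χ y‖)
    (fun b => contDiff_mul_of_tsupport hN hχ (hs.trans fun y hy => (hW y hy).2) (hY b))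
    (fun b => hc.mul_right) ?_ (fun y => by positivity) ?_ ?_
  · exact ((hχ.continuous.integrable_of_hasCompactSupport hc).norm).const_mul C
  · rintro y ⟨b, hy⟩
    exact (hW y (hs (hsub χ b hy))).1.2
  · intro y hy
    have e1 : ∑ b, ((pd b φ y : ℝ) : ℂ) * (χ y * Y b y) = χ y * ∑ b, ((pd b φ y : ℝ) : ℂ) * Y b y := by
      rw [Finset.mul_sum]
      exact Finset.sum_congr rfl fun b _ => by ring
    rw [e1, norm_mul]
    by_cases hχy : χ y = 0
    · simp [hχy]
    · have := (hW y (hs (subset_tsupport _ hχy))).1.1 hy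
      calc ‖χ y‖ * _ ≤ ‖χ y‖ * (C * |φ y|) := mul_le_mul_of_nonneg_left this (norm_nonneg _)
        _ = C * ‖χ y‖ * |φ y| := by ring

open scoped Manifold in
/-- The divergence theorem for fields tangent to the boundary. -/
theorem setIntegral_coordDiv_eq_zero {D N : Set E3} (hD : IsOpen D) (hb : Bornology.IsBounded D)
    (hsm : HasSmoothBoundary D) (hN : IsOpen N) (hDN : closure D ⊆ N) {Y : Fin 3 → E3 → ℂ}
    (hY : ∀ b, ContDiffOn ℝ 1 (Y b) N) (hYN : ∀ x ∈ frontier D, ∀ φ, IsLocalDefining D x φ →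
      ∑ b, ((pd b φ x : ℝ) : ℂ) * Y b x = 0) :
    ∫ x in D, coordDiv Y x = 0 := by
  have hK : IsCompact (closure D) := hb.isCompact_closure
  choose! W hWo hxW hWN hWI using fun x (hx : x ∈ closure D) =>
    exists_nhds_setIntegral_coordDiv hD hsm hN hY hYN hx (hDN hx)
  -- Intersecting with unit balls makes the functions of the partition of unity compactly supported.
  let V : E3 → Set E3 := fun x => W x ∩ Metric.ball x 1
  obtain ⟨t, htK, ht⟩ := hK.elim_nhds_subcover V fun x hx =>
    Filter.inter_mem ((hWo x hx).mem_nhds (hxW x hx)) (Metric.ball_mem_nhds x one_pos)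
  obtain ⟨f, hf⟩ := SmoothPartitionOfUnity.exists_isSubordinate 𝓘(ℝ, E3) isClosed_closure
    (fun x : t => V x) (fun x => (hWo x (htK x x.2)).inter Metric.isOpen_ball)
    (by simpa [iUnion_subtype] using ht)
  let χ : t → E3 → ℂ := fun i x => (f i x : ℂ)
  have hχ : ∀ i, ContDiff ℝ 1 (χ i) := fun i =>
    Complex.ofRealCLM.contDiff.comp ((f i).contMDiff.contDiff.of_le (by exact_mod_cast le_top))
  have hts : ∀ i, tsupport (χ i) ⊆ V i := fun i =>
    (closure_mono fun x (hx : χ i x ≠ 0) (h0 : f i x = 0) => hx (by simp [χ, h0])).trans (hf i)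
  have hc : ∀ i, HasCompactSupport (χ i) := fun i =>
    (Metric.isBounded_ball.subset ((hts i).trans inter_subset_right)).isCompact_closure.of_isClosed_subset
      (isClosed_tsupport _) subset_closure
  have hcd : ∀ i b, ContDiff ℝ 1 fun x => χ i x * Y b x := fun i b =>
    contDiff_mul_of_tsupport hN (hχ i)
      ((hts i).trans (inter_subset_left.trans (hWN i (htK i i.2)))) (hY b)
  have hsum : ∀ x ∈ D, coordDiv Y x = ∑ i, coordDiv (fun b y => χ i y * Y b y) x := by
    intro x hx
    have h1 : ∀ b, Y b =ᶠ[𝓝 x] fun y => ∑ i, χ i y * Y b y := by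
      intro b
      filter_upwards [hD.mem_nhds hx] with y hy
      have h2 := f.sum_eq_one (subset_closure hy)
      rw [finsum_eq_sum_of_fintype] at h2
      rw [← Finset.sum_mul]
      have h3 : ∑ i, χ i y = 1 := by
        simp only [χ]
        exact_mod_cast h2
      rw [h3, one_mul]
    rw [coordDiv_congr h1]
    unfold coordDiv
    rw [Finset.sum_comm]
    refine Finset.sum_congr rfl fun b _ => ?_
    unfold pd
    rw [fderiv_fun_sum fun i _ => (hcd i b).differentiable one_ne_zero x]
    simp
  rw [setIntegral_congr_fun hD.measurableSet hsum, integral_finsetSum]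
  · exact Finset.sum_eq_zero fun i _ => hWI i (htK i i.2) (χ i) (hχ i) (hc i)
      ((hts i).trans inter_subset_left)
  · exact fun i _ => (integrable_coordDiv (hcd i) fun b => (hc i).mul_right).integrableOn

end Divergence

/-! ### Rules for partial derivatives and smoothness of the geometric quantities -/

theorem contDiff_pd {F : Type*} [NormedAddCommGroup F] [NormedSpace ℝ F] {f : E3 → F}
    (hf : ContDiff ℝ ∞ f) (i : Fin 3) : ContDiff ℝ ∞ (pd i f) :=
  (hf.fderiv_right (m := ∞) (by simp)).clm_apply contDiff_const

theorem contDiffOn_pd {F : Type*} [NormedAddCommGroup F] [NormedSpace ℝ F] {f : E3 → F}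
    {N : Set E3} (hN : IsOpen N) (hf : ContDiffOn ℝ ∞ f N) (i : Fin 3) :
    ContDiffOn ℝ ∞ (pd i f) N :=
  (hf.fderiv_of_isOpen hN (m := ∞) (by simp)).clm_apply contDiffOn_const

theorem contDiff_det {ι : Type*} [Fintype ι] [DecidableEq ι] {M : E3 → Matrix ι ι ℝ}
    (hM : ∀ i j, ContDiff ℝ ∞ fun x => M x i j) : ContDiff ℝ ∞ fun x => (M x).det := by
  simp only [Matrix.det_apply]
  exact ContDiff.sum fun σ _ => (contDiff_prod fun i _ => hM _ _).const_smul _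

theorem pd_ofReal {f : E3 → ℝ} {x : E3} (hf : DifferentiableAt ℝ f x) (i : Fin 3) :
    pd i (fun y => (f y : ℂ)) x = ((pd i f x : ℝ) : ℂ) := by
  have h := Complex.ofRealCLM.hasFDerivAt.comp x hf.hasFDerivAt
  have h' : HasFDerivAt (fun y => (f y : ℂ)) _ x := h
  rw [pd, h'.fderiv]
  rfl

theorem pd_conj {f : E3 → ℂ} {x : E3} (hf : DifferentiableAt ℝ f x) (i : Fin 3) :
    pd i (fun y => conj (f y)) x = conj (pd i f x) := by
  have h := Complex.conjCLE.toContinuousLinearMap.hasFDerivAt.comp x hf.hasFDerivAt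
  have h' : HasFDerivAt (fun y => conj (f y)) _ x := h
  rw [pd, h'.fderiv]
  rfl

theorem pd_sum {ι F : Type*} [NormedAddCommGroup F] [NormedSpace ℝ F] (s : Finset ι)
    {f : ι → E3 → F} {x : E3}
    (hf : ∀ i ∈ s, DifferentiableAt ℝ (f i) x) (b : Fin 3) :
    pd b (fun y => ∑ i ∈ s, f i y) x = ∑ i ∈ s, pd b (f i) x := by
  unfold pd
  rw [fderiv_fun_sum hf]
  simp

namespace ElasticBody

variable (B : ElasticBody)

/-- The open set where the metric is nondegenerate. -/
def regularSet : Set E3 := {x | 0 < (B.g x).det}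

theorem isOpen_regularSet : IsOpen B.regularSet :=
  isOpen_lt continuous_const B.continuous_g.matrix_det

theorem closure_subset_regularSet : closure B.Ω ⊆ B.regularSet := fun x hx =>
  (B.g_posDef x hx).det_pos

theorem mem_regularSet {x : E3} (hx : x ∈ B.Ω) : x ∈ B.regularSet :=
  B.closure_subset_regularSet (subset_closure hx)

theorem contDiffOn_ginv (i j : Fin 3) : ContDiffOn ℝ ∞ (fun x => B.ginv x i j) B.regularSet := by
  simp only [ginv_eq]
  refine ContDiffOn.mul ((contDiff_det B.g_smooth).contDiffOn.inv fun _ hx => ne_of_gt hx) ?_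
  simp only [Matrix.adjugate_apply]
  refine (contDiff_det fun a b => ?_).contDiffOn
  by_cases h : a = j
  · subst h
    simp only [Matrix.updateRow_self]
    exact contDiff_const
  · simp only [Matrix.updateRow_ne h]
    exact B.g_smooth a b

theorem contDiffOn_volDensity : ContDiffOn ℝ ∞ B.volDensity B.regularSet :=
  (contDiff_det B.g_smooth).contDiffOn.sqrt fun _ hx => ne_of_gt hx

theorem contDiffOn_christoffel (k i j : Fin 3) :
    ContDiffOn ℝ ∞ (fun x => B.christoffel x k i j) B.regularSet := by
  unfold christoffel
  refine contDiffOn_const.mul (ContDiffOn.sum fun l _ => (B.contDiffOn_ginv k l).mul ?_)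
  exact (((contDiff_pd (B.g_smooth j l) i).add (contDiff_pd (B.g_smooth i l) j)).sub
    (contDiff_pd (B.g_smooth i j) l)).contDiffOn

theorem contDiff_coord {u : E3 → C3} (hu : ContDiff ℝ ∞ u) (i : Fin 3) :
    ContDiff ℝ ∞ fun y => u y i :=
  ((EuclideanSpace.proj (𝕜 := ℂ) i).restrictScalars ℝ).contDiff.comp hu

theorem contDiffOn_ofReal {f : E3 → ℝ} {N : Set E3} (hf : ContDiffOn ℝ ∞ f N) :
    ContDiffOn ℝ ∞ (fun x => (f x : ℂ)) N :=
  Complex.ofRealCLM.contDiff.comp_contDiffOn hf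

theorem contDiffOn_covDeriv {u : E3 → C3} (hu : ContDiff ℝ ∞ u) (i j : Fin 3) :
    ContDiffOn ℝ ∞ (fun x => B.covDeriv u x i j) B.regularSet := by
  unfold covDeriv
  refine (contDiff_pd (contDiff_coord hu j) i).contDiffOn.sub (ContDiffOn.sum fun k _ => ?_)
  exact (contDiffOn_ofReal (B.contDiffOn_christoffel k i j)).mul (contDiff_coord hu k).contDiffOn

theorem contDiffOn_symDiff {u : E3 → C3} (hu : ContDiff ℝ ∞ u) (p : Fin 3 × Fin 3) :
    ContDiffOn ℝ ∞ (fun x => B.symDiff u x p) B.regularSet := by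
  change ContDiffOn ℝ ∞ (fun x => (B.covDeriv u x p.1 p.2 + B.covDeriv u x p.2 p.1) / 2) _
  exact ((B.contDiffOn_covDeriv hu _ _).add (B.contDiffOn_covDeriv hu _ _)).div_const 2

theorem contDiffOn_stress (j : Fin (B.k + 1)) {u : E3 → C3} (hu : ContDiff ℝ ∞ u) (a b : Fin 3) :
    ContDiffOn ℝ ∞ (fun x => B.stress j u x a b) B.regularSet := by
  unfold stress div1
  refine ContDiffOn.add (ContDiffOn.mul (ContDiffOn.mul ?_ ?_) ?_) (ContDiffOn.mul ?_ ?_)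
  · exact contDiffOn_ofReal (B.lam_smooth j).contDiffOn
  · exact ContDiffOn.sum fun i _ => ContDiffOn.sum fun l _ =>
      (contDiffOn_ofReal (B.contDiffOn_ginv i l)).mul (B.contDiffOn_covDeriv hu i l)
  · exact contDiffOn_ofReal (B.g_smooth a b).contDiffOn
  · exact contDiffOn_const.mul (contDiffOn_ofReal (B.mu_smooth j).contDiffOn)
  · exact B.contDiffOn_symDiff hu (a, b)

theorem contDiffOn_div2 {s : E3 → Fin 3 → Fin 3 → ℂ}
    (hs : ∀ a b, ContDiffOn ℝ ∞ (fun x => s x a b) B.regularSet) (a : Fin 3) :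
    ContDiffOn ℝ ∞ (fun x => B.div2 s x a) B.regularSet := by
  unfold div2
  refine ContDiffOn.sum fun b _ => ContDiffOn.sum fun c _ =>
    (contDiffOn_ofReal (B.contDiffOn_ginv b c)).mul (((contDiffOn_pd B.isOpen_regularSet (hs a b) c).sub
      (ContDiffOn.sum fun l _ => ?_)).sub (ContDiffOn.sum fun l _ => ?_))
  · exact (contDiffOn_ofReal (B.contDiffOn_christoffel l c a)).mul (hs l b)
  · exact (contDiffOn_ofReal (B.contDiffOn_christoffel l c b)).mul (hs a l)

/-! ### Derivatives of the metric -/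

theorem differentiableAt_of_contDiffOn {F : Type*} [NormedAddCommGroup F] [NormedSpace ℝ F]
    {f : E3 → F} {N : Set E3} (hN : IsOpen N) (hf : ContDiffOn ℝ ∞ f N) {x : E3} (hx : x ∈ N) :
    DifferentiableAt ℝ f x :=
  (hf.contDiffAt (hN.mem_nhds hx)).differentiableAt (by simp)

theorem g_symm {x : E3} (hx : x ∈ B.Ω) (i j : Fin 3) : B.g x i j = B.g x j i := by
  have := (B.g_posDef x (subset_closure hx)).isHermitian.apply i j
  simpa using this.symm

theorem ginv_symm {x : E3} (hx : x ∈ closure B.Ω) (i j : Fin 3) : B.ginv x i j = B.ginv x j i := by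
  have := (B.g_posDef x hx).inv.isHermitian.apply i j
  exact this.symm

theorem pd_g_symm {x : E3} (hx : x ∈ B.Ω) (c i j : Fin 3) :
    pd c (fun y => B.g y i j) x = pd c (fun y => B.g y j i) x := by
  refine pd_congr ?_ c
  filter_upwards [(B.isOpen 0).mem_nhds hx] with y hy
  exact B.g_symm hy i j

theorem christoffel_symm {x : E3} (hx : x ∈ B.Ω) (k i j : Fin 3) :
    B.christoffel x k i j = B.christoffel x k j i := by
  unfold christoffel
  congr 1
  refine Finset.sum_congr rfl fun l _ => ?_
  rw [B.pd_g_symm hx l i j]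
  ring

/-- The matrix `∂_c g`. -/
def dg (c : Fin 3) (x : E3) : Matrix (Fin 3) (Fin 3) ℝ :=
  Matrix.of fun i j => pd c (fun y => B.g y i j) x

/-- The matrix `Γᵐ_cl` with rows `m` and columns `l`. -/
def Gam (c : Fin 3) (x : E3) : Matrix (Fin 3) (Fin 3) ℝ :=
  Matrix.of fun m l => B.christoffel x m c l

theorem inv_mul_g {x : E3} (hx : x ∈ B.regularSet) : (B.g x)⁻¹ * B.g x = 1 :=
  Matrix.nonsing_inv_mul _ (ne_of_gt hx).isUnit

theorem g_mul_inv {x : E3} (hx : x ∈ B.regularSet) : B.g x * (B.g x)⁻¹ = 1 :=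
  Matrix.mul_nonsing_inv _ (ne_of_gt hx).isUnit

theorem g_mul_Gam {x : E3} (hx : x ∈ B.Ω) (c : Fin 3) :
    B.g x * B.Gam c x = Matrix.of fun i j => 1 / 2 * (pd c (fun y => B.g y j i) x +
      pd j (fun y => B.g y c i) x - pd i (fun y => B.g y c j) x) := by
  have h : B.Gam c x = (B.g x)⁻¹ * Matrix.of fun l j => 1 / 2 * (pd c (fun y => B.g y j l) x +
      pd j (fun y => B.g y c l) x - pd l (fun y => B.g y c j) x) := by
    ext m j
    rw [Matrix.mul_apply]
    simp only [Gam, christoffel, ginv, Matrix.of_apply, Finset.mul_sum]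
    refine Finset.sum_congr rfl fun l _ => ?_
    ring
  rw [h, ← Matrix.mul_assoc, B.g_mul_inv (B.mem_regularSet hx), Matrix.one_mul]

theorem transpose_g {x : E3} (hx : x ∈ B.Ω) : (B.g x).transpose = B.g x := by
  ext i j
  exact B.g_symm hx j i

/-- Metric compatibility ∇g = 0 in matrix form. In gΓ_c the last two derivatives of the metric are
antisymmetric, so adding the transpose leaves ∂_c g. -/
theorem dg_eq {x : E3} (hx : x ∈ B.Ω) (c : Fin 3) :
    B.dg c x = B.g x * B.Gam c x + (B.Gam c x).transpose * B.g x := by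
  have h : (B.Gam c x).transpose * B.g x = (B.g x * B.Gam c x).transpose := by
    rw [Matrix.transpose_mul, B.transpose_g hx]
  rw [h, B.g_mul_Gam hx]
  ext i j
  simp only [dg, Matrix.of_apply, Matrix.add_apply, Matrix.transpose_apply]
  rw [B.pd_g_symm hx c i j]
  ring

theorem pd_mul_real {f h : E3 → ℝ} {x : E3} (hf : DifferentiableAt ℝ f x)
    (hh : DifferentiableAt ℝ h x) (i : Fin 3) :
    pd i (fun y => f y * h y) x = pd i f x * h x + f x * pd i h x := by
  unfold pd
  rw [fderiv_fun_mul hf hh]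
  simp only [add_apply, smul_apply, smul_eq_mul]
  ring

/-- The matrix `∂_c g⁻¹`. -/
def dginv (c : Fin 3) (x : E3) : Matrix (Fin 3) (Fin 3) ℝ :=
  Matrix.of fun i j => pd c (fun y => B.ginv y i j) x

theorem differentiableAt_ginv {x : E3} (hx : x ∈ B.regularSet) (i j : Fin 3) :
    DifferentiableAt ℝ (fun y => B.ginv y i j) x :=
  differentiableAt_of_contDiffOn B.isOpen_regularSet (B.contDiffOn_ginv i j) hx

theorem differentiableAt_g (x : E3) (i j : Fin 3) : DifferentiableAt ℝ (fun y => B.g y i j) x :=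
  (B.g_smooth i j).differentiable (by simp) x

theorem dginv_mul_g {x : E3} (hx : x ∈ B.regularSet) (c : Fin 3) :
    B.dginv c x * B.g x + (B.g x)⁻¹ * B.dg c x = 0 := by
  ext i j
  have h0 : pd c (fun y => ∑ l, B.ginv y i l * B.g y l j) x = 0 := by
    have h1 : (fun y => ∑ l, B.ginv y i l * B.g y l j) =ᶠ[𝓝 x]
        fun _ => (1 : Matrix (Fin 3) (Fin 3) ℝ) i j := by
      filter_upwards [B.isOpen_regularSet.mem_nhds hx] with y hy
      rw [← B.inv_mul_g hy, Matrix.mul_apply]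
      rfl
    rw [pd_congr h1]
    simp [pd]
  have h2 : pd c (fun y => ∑ l, B.ginv y i l * B.g y l j) x =
      ∑ l, (pd c (fun y => B.ginv y i l) x * B.g x l j +
        B.ginv x i l * pd c (fun y => B.g y l j) x) := by
    rw [pd_sum _ (f := fun l y => B.ginv y i l * B.g y l j) fun l _ =>
      (B.differentiableAt_ginv hx i l).fun_mul (B.differentiableAt_g x l j)]
    exact Finset.sum_congr rfl fun l _ =>
      pd_mul_real (B.differentiableAt_ginv hx i l) (B.differentiableAt_g x l j) c
  rw [h0, Finset.sum_add_distrib] at h2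
  rw [Matrix.add_apply, Matrix.mul_apply, Matrix.mul_apply]
  exact h2.symm

/-- From the derivative of g⁻¹g = 1, after inserting ∂_c g and multiplying by g⁻¹ on the right. -/
theorem dginv_eq {x : E3} (hx : x ∈ B.Ω) (c : Fin 3) :
    B.dginv c x = -(B.Gam c x * (B.g x)⁻¹) - (B.g x)⁻¹ * (B.Gam c x).transpose := by
  have hr := B.mem_regularSet hx
  have h := congrArg (fun M => M * (B.g x)⁻¹) (B.dginv_mul_g hr c)
  simp only [Matrix.add_mul, Matrix.mul_assoc, B.g_mul_inv hr, Matrix.mul_one, Matrix.zero_mul,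
    B.dg_eq hx, Matrix.mul_add] at h
  rw [← Matrix.mul_assoc (B.g x)⁻¹ (B.g x), B.inv_mul_g hr, Matrix.one_mul] at h
  rw [sub_eq_add_neg, ← neg_add]
  exact eq_neg_of_add_eq_zero_left h

/-- `∇ g⁻¹ = 0`. -/
theorem pd_ginv {x : E3} (hx : x ∈ B.Ω) (c i j : Fin 3) :
    pd c (fun y => B.ginv y i j) x =
      -∑ l, (B.christoffel x i c l * B.ginv x l j + B.christoffel x j c l * B.ginv x i l) := by
  have h := congrFun (congrFun (B.dginv_eq hx c) i) j
  rw [Matrix.sub_apply, Matrix.neg_apply, Matrix.mul_apply, Matrix.mul_apply] at h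
  rw [Finset.sum_add_distrib, neg_add, ← sub_eq_add_neg]
  refine h.trans ?_
  congr 1
  exact Finset.sum_congr rfl fun l _ => mul_comm _ _

/-- Jacobi's formula, verified by expanding the 3 × 3 determinant. -/
theorem pd_det {x : E3} (c : Fin 3) :
    pd c (fun y => (B.g y).det) x = ((B.g x).adjugate * B.dg c x).trace := by
  have hd := fun i j => (B.differentiableAt_g x i j)
  have h3 : ∀ a b d e p q : Fin 3, pd c (fun y => B.g y a b * B.g y d e * B.g y p q) x =
      (pd c (fun y => B.g y a b) x * B.g x d e + B.g x a b * pd c (fun y => B.g y d e) x) *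
        B.g x p q + B.g x a b * B.g x d e * pd c (fun y => B.g y p q) x := by
    intro a b d e p q
    rw [pd_mul_real ((hd a b).fun_mul (hd d e)) (hd p q), pd_mul_real (hd a b) (hd d e)]
  have hm : ∀ a b d e p q : Fin 3,
      DifferentiableAt ℝ (fun y => B.g y a b * B.g y d e * B.g y p q) x :=
    fun a b d e p q => ((hd a b).fun_mul (hd d e)).fun_mul (hd p q)
  simp only [Matrix.det_fin_three]
  have h4 : pd c (fun y => B.g y 0 0 * B.g y 1 1 * B.g y 2 2 - B.g y 0 0 * B.g y 1 2 * B.g y 2 1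
      - B.g y 0 1 * B.g y 1 0 * B.g y 2 2 + B.g y 0 1 * B.g y 1 2 * B.g y 2 0
      + B.g y 0 2 * B.g y 1 0 * B.g y 2 1 - B.g y 0 2 * B.g y 1 1 * B.g y 2 0) x =
      pd c (fun y => B.g y 0 0 * B.g y 1 1 * B.g y 2 2) x
      - pd c (fun y => B.g y 0 0 * B.g y 1 2 * B.g y 2 1) x
      - pd c (fun y => B.g y 0 1 * B.g y 1 0 * B.g y 2 2) x
      + pd c (fun y => B.g y 0 1 * B.g y 1 2 * B.g y 2 0) x
      + pd c (fun y => B.g y 0 2 * B.g y 1 0 * B.g y 2 1) x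
      - pd c (fun y => B.g y 0 2 * B.g y 1 1 * B.g y 2 0) x := by
    have h := ((((((hm 0 0 1 1 2 2).hasFDerivAt.sub (hm 0 0 1 2 2 1).hasFDerivAt).sub
      (hm 0 1 1 0 2 2).hasFDerivAt).add (hm 0 1 1 2 2 0).hasFDerivAt).add
      (hm 0 2 1 0 2 1).hasFDerivAt).sub (hm 0 2 1 1 2 0).hasFDerivAt).fderiv
    exact congrArg (fun L => L (EuclideanSpace.single c 1)) h
  rw [h4]
  simp only [h3, Matrix.trace_fin_three, Matrix.mul_apply, Fin.sum_univ_three,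
    Matrix.adjugate_fin_three, dg, Matrix.of_apply, Matrix.cons_val]
  ring

/-- By Jacobi's formula and ∇g = 0, the derivative of det g is 2 det g · tr Γ_c; the square root
halves the factor. -/
theorem pd_volDensity {x : E3} (hx : x ∈ B.Ω) (c : Fin 3) :
    pd c B.volDensity x = B.volDensity x * ∑ l, B.christoffel x l l c := by
  have hr := B.mem_regularSet hx
  have hdet : 0 < (B.g x).det := hr
  have h1 : ((B.g x).adjugate * B.dg c x).trace = 2 * (B.g x).det * (B.Gam c x).trace := by
    have hadj : (B.g x).adjugate = (B.g x).det • (B.g x)⁻¹ := by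
      rw [Matrix.inv_def, Ring.inverse_eq_inv', smul_smul, mul_inv_cancel₀ hdet.ne', one_smul]
    rw [hadj, B.dg_eq hx, Matrix.smul_mul, Matrix.trace_smul, Matrix.mul_add, Matrix.trace_add,
      ← Matrix.mul_assoc, B.inv_mul_g hr, Matrix.one_mul, Matrix.trace_mul_comm, Matrix.mul_assoc,
      B.g_mul_inv hr, Matrix.mul_one, Matrix.trace_transpose, smul_eq_mul]
    ring
  have h2 : (B.Gam c x).trace = ∑ l, B.christoffel x l l c :=
    Finset.sum_congr rfl fun l _ => B.christoffel_symm hx l c l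
  have hd : DifferentiableAt ℝ (fun y => (B.g y).det) x :=
    (contDiff_det B.g_smooth).differentiable (by simp) x
  have h3 : HasFDerivAt B.volDensity _ x := hd.hasFDerivAt.sqrt hdet.ne'
  have h4 : pd c (fun y => (B.g y).det) x = _ := (B.pd_det c).trans h1
  rw [pd] at h4
  rw [pd, h3.fderiv, smul_apply, h4, smul_eq_mul, ← h2]
  have hv : √(B.g x).det * √(B.g x).det = (B.g x).det := Real.mul_self_sqrt hdet.le
  have hv0 : √(B.g x).det ≠ 0 := (Real.sqrt_pos.2 hdet).ne'
  change 1 / (2 * √(B.g x).det) * (2 * (B.g x).det * (B.Gam c x).trace) =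
    √(B.g x).det * (B.Gam c x).trace
  nth_rewrite 2 [← hv]
  field_simp

end ElasticBody

theorem sum_comm_pairs {ι M : Type*} [Fintype ι] [AddCommMonoid M] (f : ι → ι → ι → ι → M) :
    ∑ b, ∑ d, ∑ a, ∑ c, f b d a c = ∑ a, ∑ c, ∑ b, ∑ d, f b d a c := by
  calc _ = ∑ p : ι × ι, ∑ q : ι × ι, f p.1 p.2 q.1 q.2 := by simp only [Fintype.sum_prod_type]
    _ = ∑ q : ι × ι, ∑ p : ι × ι, f p.1 p.2 q.1 q.2 := Finset.sum_comm
    _ = _ := by simp only [Fintype.sum_prod_type]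

namespace ElasticBody

variable (B : ElasticBody)

/-! ### The divergence of a flux -/

/-- The density `√det g Yᵇ` of the vector field which corresponds to the covector field `Y`. -/
def raise (Y : Fin 3 → E3 → ℂ) (b : Fin 3) (x : E3) : ℂ :=
  (B.volDensity x : ℂ) * ∑ d, (B.ginv x b d : ℂ) * Y d x

theorem differentiableAt_ofReal {f : E3 → ℝ} {x : E3} (hf : DifferentiableAt ℝ f x) :
    DifferentiableAt ℝ (fun y => (f y : ℂ)) x :=
  Complex.ofRealCLM.differentiableAt.comp x hf

theorem differentiableAt_volDensity {x : E3} (hx : x ∈ B.regularSet) :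
    DifferentiableAt ℝ B.volDensity x :=
  differentiableAt_of_contDiffOn B.isOpen_regularSet B.contDiffOn_volDensity hx

theorem pd_ginv_complex {x : E3} (hx : x ∈ B.Ω) (c i j : Fin 3) :
    pd c (fun y => (B.ginv y i j : ℂ)) x =
      -∑ l, ((B.christoffel x i c l : ℂ) * (B.ginv x l j : ℂ) +
        (B.christoffel x j c l : ℂ) * (B.ginv x i l : ℂ)) := by
  rw [pd_ofReal (B.differentiableAt_ginv (B.mem_regularSet hx) i j), B.pd_ginv hx]
  push_cast
  rfl

/-- The Christoffel trace from ∂√det g cancels the one coming from the first index of g⁻¹; the term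
from the second index completes ∂Y to the covariant derivative. -/
theorem coordDiv_raise {Y : Fin 3 → E3 → ℂ} {x : E3} (hx : x ∈ B.Ω)
    (hY : ∀ d, DifferentiableAt ℝ (Y d) x) :
    coordDiv (B.raise Y) x = (B.volDensity x : ℂ) * ∑ b, ∑ d, (B.ginv x b d : ℂ) *
      (pd b (Y d) x - ∑ k, (B.christoffel x k b d : ℂ) * Y k x) := by
  have hr := B.mem_regularSet hx
  have hG := fun i j => differentiableAt_ofReal (B.differentiableAt_ginv hr i j)
  have hv := differentiableAt_ofReal (B.differentiableAt_volDensity hr)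
  have h1 : ∀ b, pd b (B.raise Y b) x =
      (B.volDensity x : ℂ) * (∑ l, (B.christoffel x l l b : ℂ)) *
        (∑ d, (B.ginv x b d : ℂ) * Y d x) + (B.volDensity x : ℂ) *
      ∑ d, (-(∑ l, ((B.christoffel x b b l : ℂ) * (B.ginv x l d : ℂ) +
        (B.christoffel x d b l : ℂ) * (B.ginv x b l : ℂ))) * Y d x +
          (B.ginv x b d : ℂ) * pd b (Y d) x) := by
    intro b
    unfold raise
    rw [pd_mul hv (DifferentiableAt.fun_sum fun d _ => (hG b d).fun_mul (hY d)),
      pd_sum _ fun d _ => (hG b d).fun_mul (hY d), pd_ofReal (B.differentiableAt_volDensity hr),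
      B.pd_volDensity hx]
    push_cast
    congr 2
    refine Finset.sum_congr rfl fun d _ => ?_
    rw [pd_mul (hG b d) (hY d), B.pd_ginv_complex hx]
  unfold coordDiv
  simp only [h1, Fin.sum_univ_three]
  ring

/-- The covector field `Y_d = gᵃᶜ w_a s_cd`. -/
def pairing (w : Fin 3 → E3 → ℂ) (s : E3 → Fin 3 → Fin 3 → ℂ) (d : Fin 3) (x : E3) : ℂ :=
  ∑ a, ∑ c, (B.ginv x a c : ℂ) * (w a x * s x c d)

/-- The Leibniz rule for the connection under a contraction: ∇g⁻¹ = 0, so only the two factors are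
differentiated. -/
theorem covDeriv_pairing {w : Fin 3 → E3 → ℂ} {s : E3 → Fin 3 → Fin 3 → ℂ} {x : E3}
    (hx : x ∈ B.Ω) (hw : ∀ a, DifferentiableAt ℝ (w a) x)
    (hs : ∀ a b, DifferentiableAt ℝ (fun y => s y a b) x) (b d : Fin 3) :
    pd b (B.pairing w s d) x - ∑ k, (B.christoffel x k b d : ℂ) * B.pairing w s k x =
      ∑ a, ∑ c, (B.ginv x a c : ℂ) *
        ((pd b (w a) x - ∑ k, (B.christoffel x k b a : ℂ) * w k x) * s x c d +
        w a x * (pd b (fun y => s y c d) x - ∑ l, (B.christoffel x l b c : ℂ) * s x l d -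
          ∑ l, (B.christoffel x l b d : ℂ) * s x c l)) := by
  have hr := B.mem_regularSet hx
  have hG := fun i j => differentiableAt_ofReal (B.differentiableAt_ginv hr i j)
  have h1 : pd b (B.pairing w s d) x = ∑ a, ∑ c,
      (-(∑ l, ((B.christoffel x a b l : ℂ) * (B.ginv x l c : ℂ) +
        (B.christoffel x c b l : ℂ) * (B.ginv x a l : ℂ))) * (w a x * s x c d) +
      (B.ginv x a c : ℂ) * (pd b (w a) x * s x c d + w a x * pd b (fun y => s y c d) x)) := by
    unfold pairing
    have ht : ∀ a c, DifferentiableAt ℝ (fun y => (B.ginv y a c : ℂ) * (w a y * s y c d)) x :=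
      fun a c => (hG a c).fun_mul ((hw a).fun_mul (hs c d))
    rw [pd_sum _ fun a _ => DifferentiableAt.fun_sum fun c _ => ht a c]
    refine Finset.sum_congr rfl fun a _ => ?_
    rw [pd_sum _ fun c _ => ht a c]
    refine Finset.sum_congr rfl fun c _ => ?_
    rw [pd_mul (hG a c) ((hw a).fun_mul (hs c d)), pd_mul (hw a) (hs c d), B.pd_ginv_complex hx]
  rw [h1]
  simp only [pairing, Fin.sum_univ_three]
  ring

/-- The density of the vector field `gᵃᶜ conj(v_a) s_cᵇ`. -/
def flux (v : E3 → C3) (s : E3 → Fin 3 → Fin 3 → ℂ) : Fin 3 → E3 → ℂ :=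
  B.raise (B.pairing (fun a x => conj (v x a)) s)

theorem coordDiv_flux {v : E3 → C3} (hv : ContDiff ℝ ∞ v) {s : E3 → Fin 3 → Fin 3 → ℂ} {x : E3}
    (hx : x ∈ B.Ω) (hs : ∀ a b, DifferentiableAt ℝ (fun y => s y a b) x) :
    coordDiv (B.flux v s) x = (B.volDensity x : ℂ) *
      ((∑ a, ∑ c, (B.ginv x a c : ℂ) * (conj (v x a) * B.div2 s x c)) +
        ∑ b, ∑ d, ∑ a, ∑ c, (B.ginv x b d : ℂ) * ((B.ginv x a c : ℂ) *
          (conj (B.covDeriv v x b a) * s x c d))) := by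
  have hw : ∀ a, DifferentiableAt ℝ (fun y => conj (v y a)) x := fun a =>
    Complex.conjCLE.toContinuousLinearMap.differentiableAt.comp x (differentiableAt_coord hv x a)
  have hr := B.mem_regularSet hx
  have hG := fun i j => differentiableAt_ofReal (B.differentiableAt_ginv hr i j)
  have hp : ∀ d, DifferentiableAt ℝ (B.pairing (fun a x => conj (v x a)) s d) x := fun d =>
    DifferentiableAt.fun_sum fun a _ => DifferentiableAt.fun_sum fun c _ =>
      (hG a c).fun_mul ((hw a).fun_mul (hs c d))
  have hcd : ∀ b a, pd b (fun y => conj (v y a)) x - ∑ k, (B.christoffel x k b a : ℂ) *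
      conj (v x k) = conj (B.covDeriv v x b a) := by
    intro b a
    rw [pd_conj (differentiableAt_coord hv x a), covDeriv]
    simp [map_sum]
  rw [flux, B.coordDiv_raise hx hp]
  simp only [B.covDeriv_pairing hx hw hs, hcd]
  congr 1
  have h2 : ∀ c, B.div2 s x c = ∑ b, ∑ d, (B.ginv x b d : ℂ) * (pd b (fun y => s y c d) x -
      ∑ l, (B.christoffel x l b c : ℂ) * s x l d - ∑ l, (B.christoffel x l b d : ℂ) * s x c l) := by
    intro c
    rw [div2, Finset.sum_comm]
    refine Finset.sum_congr rfl fun b _ => Finset.sum_congr rfl fun d _ => ?_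
    rw [B.ginv_symm (subset_closure hx) d b]
  simp only [h2, Finset.mul_sum, mul_add, Finset.sum_add_distrib]
  rw [add_comm]
  congr 1
  rw [sum_comm_pairs]
  refine Finset.sum_congr rfl fun a _ => Finset.sum_congr rfl fun c _ =>
    Finset.sum_congr rfl fun b _ => Finset.sum_congr rfl fun d _ => ?_
  ring

/-! ### Contractions of strain and stress -/

theorem symDiff_apply (u : E3 → C3) (x : E3) (a b : Fin 3) :
    B.symDiff u x (a, b) = (B.covDeriv u x a b + B.covDeriv u x b a) / 2 := rfl

theorem symDiff_symm (u : E3 → C3) (x : E3) (a b : Fin 3) :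
    B.symDiff u x (a, b) = B.symDiff u x (b, a) := by
  rw [symDiff_apply, symDiff_apply, add_comm]

/-- The divergence is the trace of the strain. -/
theorem trace_symDiff (u : E3 → C3) {x : E3} (hx : x ∈ closure B.Ω) :
    ∑ a, ∑ b, (B.ginv x a b : ℂ) * B.symDiff u x (a, b) = B.div1 u x := by
  have h : ∑ a, ∑ b, (B.ginv x a b : ℂ) * B.covDeriv u x b a = B.div1 u x := by
    rw [Finset.sum_comm, div1]
    refine Finset.sum_congr rfl fun a _ => Finset.sum_congr rfl fun b _ => ?_
    rw [B.ginv_symm hx]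
  have h2 : ∑ a, ∑ b, (B.ginv x a b : ℂ) * B.symDiff u x (a, b) =
      (∑ a, ∑ b, (B.ginv x a b : ℂ) * B.covDeriv u x a b +
        ∑ a, ∑ b, (B.ginv x a b : ℂ) * B.covDeriv u x b a) / 2 := by
    simp only [← Finset.sum_add_distrib, Finset.sum_div, symDiff_apply]
    refine Finset.sum_congr rfl fun a _ => Finset.sum_congr rfl fun b _ => ?_
    ring
  rw [h2, h, div1]
  ring

theorem sum_ginv_g {x : E3} (hx : x ∈ B.regularSet) (a d : Fin 3) :
    ∑ c, (B.ginv x a c : ℂ) * (B.g x c d : ℂ) = if a = d then 1 else 0 := by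
  have h := congrFun (congrFun (B.inv_mul_g hx) a) d
  rw [Matrix.mul_apply, Matrix.one_apply] at h
  have h2 := congrArg (fun r : ℝ => (r : ℂ)) h
  simp only [Complex.ofReal_sum, Complex.ofReal_mul] at h2
  refine h2.trans ?_
  split_ifs <;> simp

theorem hermForm_stiffnessMatrix (j : Fin (B.k + 1)) (x : E3) (e f : T2) :
    hermForm (B.stiffnessMatrix j x) e f = (B.volDensity x : ℂ) *
      ((B.lam j x : ℂ) * (conj (∑ a, ∑ b, (B.ginv x a b : ℂ) * e (a, b)) *
        ∑ a, ∑ b, (B.ginv x a b : ℂ) * f (a, b)) +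
      2 * (B.mu j x : ℂ) * ∑ b, ∑ a, ∑ d, ∑ c, (B.ginv x b d : ℂ) * ((B.ginv x a c : ℂ) *
        (conj (e (b, a)) * f (d, c)))) := by
  simp only [hermForm, Fintype.sum_prod_type, map_sum, Finset.sum_mul]
  simp only [Finset.mul_sum, ← Finset.sum_add_distrib]
  refine Finset.sum_congr rfl fun b _ => Finset.sum_congr rfl fun a _ =>
    Finset.sum_congr rfl fun d _ => Finset.sum_congr rfl fun c _ => ?_
  simp only [stiffnessMatrix, Matrix.of_apply, map_mul, Complex.conj_ofReal]
  push_cast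
  ring

/-- Contracting ∇v with the metric part of the stress gives the divergence, that is, the trace of
dˢv. The other part is symmetric, so it sees only the symmetric part of ∇v. -/
theorem stress_pairing (j : Fin (B.k + 1)) (u v : E3 → C3) {x : E3} (hx : x ∈ B.Ω) :
    (B.volDensity x : ℂ) * ∑ b, ∑ d, ∑ a, ∑ c, (B.ginv x b d : ℂ) * ((B.ginv x a c : ℂ) *
        (conj (B.covDeriv v x b a) * B.stress j u x c d)) =
      hermForm (B.stiffnessMatrix j x) (B.symDiff v x) (B.symDiff u x) := by
  have hx' : x ∈ closure B.Ω := subset_closure hx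
  rw [hermForm_stiffnessMatrix, B.trace_symDiff v hx', B.trace_symDiff u hx']
  congr 1
  have h1 : ∑ b, ∑ d, ∑ a, ∑ c, (B.ginv x b d : ℂ) * ((B.ginv x a c : ℂ) *
      (conj (B.covDeriv v x b a) * (B.g x c d : ℂ))) = conj (B.div1 v x) := by
    have h : ∀ b d a, ∑ c, (B.ginv x b d : ℂ) * ((B.ginv x a c : ℂ) *
        (conj (B.covDeriv v x b a) * (B.g x c d : ℂ))) =
        (B.ginv x b d : ℂ) * conj (B.covDeriv v x b a) * if a = d then 1 else 0 := by
      intro b d a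
      rw [← B.sum_ginv_g (B.mem_regularSet hx), Finset.mul_sum]
      exact Finset.sum_congr rfl fun c _ => by ring
    simp only [h, mul_ite, mul_one, mul_zero, Finset.sum_ite_eq', Finset.mem_univ, if_true, div1,
      map_sum, map_mul, Complex.conj_ofReal]
  have h2 : ∑ b, ∑ a, ∑ d, ∑ c, (B.ginv x b d : ℂ) * ((B.ginv x a c : ℂ) *
      (conj (B.symDiff v x (b, a)) * B.symDiff u x (d, c))) =
      ∑ b, ∑ d, ∑ a, ∑ c, (B.ginv x b d : ℂ) * ((B.ginv x a c : ℂ) *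
        (conj (B.covDeriv v x b a) * B.symDiff u x (c, d))) := by
    have h3 : ∑ b, ∑ a, ∑ d, ∑ c, (B.ginv x b d : ℂ) * ((B.ginv x a c : ℂ) *
        (conj (B.covDeriv v x a b) * B.symDiff u x (d, c))) =
        ∑ b, ∑ a, ∑ d, ∑ c, (B.ginv x b d : ℂ) * ((B.ginv x a c : ℂ) *
        (conj (B.covDeriv v x b a) * B.symDiff u x (d, c))) := by
      rw [Finset.sum_comm]
      refine Finset.sum_congr rfl fun b _ => Finset.sum_congr rfl fun a _ => ?_
      rw [Finset.sum_comm]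
      refine Finset.sum_congr rfl fun d _ => Finset.sum_congr rfl fun c _ => ?_
      rw [B.symDiff_symm u x c d]
      ring
    have h4 : ∑ b, ∑ a, ∑ d, ∑ c, (B.ginv x b d : ℂ) * ((B.ginv x a c : ℂ) *
        (conj (B.symDiff v x (b, a)) * B.symDiff u x (d, c))) =
        (∑ b, ∑ a, ∑ d, ∑ c, (B.ginv x b d : ℂ) * ((B.ginv x a c : ℂ) *
          (conj (B.covDeriv v x b a) * B.symDiff u x (d, c))) +
        ∑ b, ∑ a, ∑ d, ∑ c, (B.ginv x b d : ℂ) * ((B.ginv x a c : ℂ) *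
          (conj (B.covDeriv v x a b) * B.symDiff u x (d, c)))) / 2 := by
      simp only [← Finset.sum_add_distrib, Finset.sum_div]
      refine Finset.sum_congr rfl fun b _ => Finset.sum_congr rfl fun a _ =>
        Finset.sum_congr rfl fun d _ => Finset.sum_congr rfl fun c _ => ?_
      rw [B.symDiff_apply v, map_div₀, map_add, Complex.conj_ofNat]
      ring
    rw [h4, h3, add_self_div_two]
    refine Finset.sum_congr rfl fun b _ => ?_
    rw [Finset.sum_comm]
    refine Finset.sum_congr rfl fun d _ => Finset.sum_congr rfl fun a _ =>
      Finset.sum_congr rfl fun c _ => ?_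
    rw [B.symDiff_symm u x d c]
  rw [h2, ← h1]
  simp only [Finset.mul_sum, Finset.sum_mul, ← Finset.sum_add_distrib]
  refine Finset.sum_congr rfl fun b _ => Finset.sum_congr rfl fun d _ =>
    Finset.sum_congr rfl fun a _ => Finset.sum_congr rfl fun c _ => ?_
  rw [stress]
  ring

theorem hermForm_massMatrix_elastic (j : Fin (B.k + 1)) (u v : E3 → C3) {x : E3}
    (hx : x ∈ closedLayer B.D j) :
    hermForm (B.massMatrix j x) (v x) (B.elastic j u x) = (B.volDensity x : ℂ) *
      ∑ a, ∑ c, (B.ginv x a c : ℂ) * (conj (v x a) * B.div2 (B.stress j u) x c) := by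
  have hρ : (B.rho j x : ℂ) ≠ 0 := Complex.ofReal_ne_zero.2 (B.rho_pos j x hx).ne'
  simp only [hermForm, Finset.mul_sum]
  refine Finset.sum_congr rfl fun a _ => Finset.sum_congr rfl fun c _ => ?_
  change ((B.rho j x * B.volDensity x * B.ginv x a c : ℝ) : ℂ) *
    (conj (v x a) * ((B.rho j x : ℂ)⁻¹ * B.div2 (B.stress j u) x c)) = _
  push_cast
  field_simp

/-- The pointwise form of Green's formula. -/
theorem coordDiv_flux_stress (j : Fin (B.k + 1)) {u v : E3 → C3} (hu : ContDiff ℝ ∞ u)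
    (hv : ContDiff ℝ ∞ v) {x : E3} (hx : x ∈ layer B.D j) :
    coordDiv (B.flux v (B.stress j u)) x =
      hermForm (B.massMatrix j x) (v x) (B.elastic j u x) +
        hermForm (B.stiffnessMatrix j x) (B.symDiff v x) (B.symDiff u x) := by
  have hΩ : x ∈ B.Ω := B.D_subset j hx.1
  rw [B.coordDiv_flux hv hΩ fun a b => differentiableAt_of_contDiffOn B.isOpen_regularSet
    (B.contDiffOn_stress j hu a b) (B.mem_regularSet hΩ), mul_add, B.stress_pairing j u v hΩ,
    B.hermForm_massMatrix_elastic j u v (B.layer_subset j hx)]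

end ElasticBody

namespace ElasticBody

variable (B : ElasticBody)

/-! ### The divergence theorem in layered domains -/

theorem layer_castSucc (j : Fin B.k) : layer B.D j.castSucc = B.D j.castSucc \ B.D j.succ := by
  unfold layer
  congr 1
  ext x
  simp only [mem_iUnion, exists_prop]
  constructor
  · rintro ⟨i, hi, hx⟩
    rcases (Fin.castSucc_lt_iff_succ_le.1 hi).eq_or_lt with h | h
    · rwa [h]
    · exact B.nested _ _ h (subset_closure hx)
  · exact fun hx => ⟨j.succ, Fin.castSucc_lt_succ, hx⟩

theorem layer_last : layer B.D (Fin.last B.k) = B.D (Fin.last B.k) := by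
  unfold layer
  refine sdiff_eq_left.2 (disjoint_iUnion₂_right.2 fun i hi => ?_)
  exact absurd hi (not_lt.2 (Fin.le_last i))

theorem closure_D_subset (j : Fin (B.k + 1)) : closure (B.D j) ⊆ B.regularSet :=
  (closure_mono (B.D_subset j)).trans B.closure_subset_regularSet

theorem integrableOn_coordDiv {X : Fin 3 → E3 → ℂ}
    (hX : ∀ b, ContDiffOn ℝ 1 (X b) B.regularSet) (i : Fin (B.k + 1)) :
    IntegrableOn (coordDiv X) (B.D i) := by
  have hK : IsCompact (closure (B.D i)) := (B.bounded.subset (B.D_subset i)).isCompact_closure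
  have hc : ContinuousOn (coordDiv X) B.regularSet := by
    unfold coordDiv pd
    exact continuousOn_finsetSum _ fun b _ =>
      ((hX b).continuousOn_fderiv_of_isOpen B.isOpen_regularSet le_rfl).clm_apply continuousOn_const
  exact ((hc.mono (B.closure_D_subset i)).integrableOn_compact hK).mono_set subset_closure

theorem coordDiv_sub {X Y : Fin 3 → E3 → ℂ} {x : E3} (hX : ∀ b, DifferentiableAt ℝ (X b) x)
    (hY : ∀ b, DifferentiableAt ℝ (Y b) x) :
    coordDiv (fun b y => X b y - Y b y) x = coordDiv X x - coordDiv Y x := by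
  unfold coordDiv pd
  rw [← Finset.sum_sub_distrib]
  refine Finset.sum_congr rfl fun b _ => ?_
  rw [fderiv_fun_sub (hX b) (hY b)]
  rfl

/-- The divergence theorem for piecewise smooth fields with continuous normal component. -/
theorem integral_glue_coordDiv {X : Fin (B.k + 1) → Fin 3 → E3 → ℂ}
    (hX : ∀ j b, ContDiffOn ℝ 1 (X j b) B.regularSet)
    (hjump : ∀ j : Fin B.k, ∀ x ∈ frontier (B.D j.succ), ∀ φ, IsLocalDefining (B.D j.succ) x φ →
      ∑ b, ((pd b φ x : ℝ) : ℂ) * X j.succ b x = ∑ b, ((pd b φ x : ℝ) : ℂ) * X j.castSucc b x)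
    (hbdy : ∀ x ∈ frontier B.Ω, ∀ b, X 0 b x = 0) :
    ∫ x in B.Ω, glue B.D (fun j => coordDiv (X j)) x = 0 := by
  have hI : ∀ i j, IntegrableOn (coordDiv (X j)) (B.D i) := fun i j =>
    B.integrableOn_coordDiv (hX j) i
  have hm := fun i => (B.isOpen i).measurableSet
  have h1 : ∫ x in B.Ω, glue B.D (fun j => coordDiv (X j)) x =
      ∑ j, ∫ x in layer B.D j, coordDiv (X j) x := by
    unfold glue
    rw [integral_finsetSum _ fun j _ => ((hI 0 j).indicator (B.measurableSet_layer j))]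
    refine Finset.sum_congr rfl fun j _ => ?_
    rw [setIntegral_indicator (B.measurableSet_layer j), inter_eq_self_of_subset_right
      ((show layer B.D j ⊆ B.D j from sdiff_subset).trans (B.D_subset j))]
  -- The field of a layer is smooth beyond it, on the whole regular set, so it can be integrated
  -- over the filled domains and subtracted.
  have h2 : ∀ j : Fin B.k, ∫ x in layer B.D j.castSucc, coordDiv (X j.castSucc) x =
      (∫ x in B.D j.castSucc, coordDiv (X j.castSucc) x) -
        ∫ x in B.D j.succ, coordDiv (X j.castSucc) x := by
    intro j
    rw [layer_castSucc, setIntegral_sdiff (hm _) (hI _ _)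
      (subset_closure.trans (B.nested _ _ Fin.castSucc_lt_succ))]
  have h3 : ∫ x in B.D 0, coordDiv (X 0) x = 0 :=
    setIntegral_coordDiv_eq_zero (B.isOpen 0) B.bounded (B.smoothBoundary 0) B.isOpen_regularSet
      B.closure_subset_regularSet (hX 0) fun x hx φ _ => by simp [hbdy x hx]
  -- The difference of the two neighbouring fields has no normal component on the interface, so the
  -- tangential divergence theorem applies on the inner domain.
  have h4 : ∀ j : Fin B.k, ∫ x in B.D j.succ, coordDiv (X j.succ) x =
      ∫ x in B.D j.succ, coordDiv (X j.castSucc) x := by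
    intro j
    rw [← sub_eq_zero, ← integral_sub (hI _ _) (hI _ _)]
    have h := setIntegral_coordDiv_eq_zero (B.isOpen j.succ) (B.bounded.subset (B.D_subset _))
      (B.smoothBoundary _) B.isOpen_regularSet (B.closure_D_subset _)
      (Y := fun b y => X j.succ b y - X j.castSucc b y) (fun b => (hX _ b).sub (hX _ b))
      fun x hx φ hφ => by
        simp only [mul_sub, Finset.sum_sub_distrib]
        rw [hjump j x hx φ hφ, sub_self]
    rw [← h]
    refine setIntegral_congr_fun (hm _) fun x hx => ?_
    have hr := B.mem_regularSet (B.D_subset _ hx)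
    have hd : ∀ j b, DifferentiableAt ℝ (X j b) x := fun j b =>
      ((hX j b).contDiffAt (B.isOpen_regularSet.mem_nhds hr)).differentiableAt one_ne_zero
    exact (coordDiv_sub (hd _) (hd _)).symm
  rw [h1, Fin.sum_univ_castSucc]
  simp only [h2, layer_last]
  rw [Finset.sum_sub_distrib, sub_add_eq_add_sub,
    ← Fin.sum_univ_castSucc (f := fun j => ∫ x in B.D j, coordDiv (X j) x), Fin.sum_univ_succ, h3,
    zero_add, sub_eq_zero]
  exact Finset.sum_congr rfl fun j _ => h4 j

/-! ### Green's formula -/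

theorem contDiffOn_flux {v : E3 → C3} (hv : ContDiff ℝ ∞ v) {s : E3 → Fin 3 → Fin 3 → ℂ}
    (hs : ∀ a b, ContDiffOn ℝ ∞ (fun x => s x a b) B.regularSet) (b : Fin 3) :
    ContDiffOn ℝ 1 (B.flux v s b) B.regularSet := by
  have h : ContDiffOn ℝ ∞ (B.flux v s b) B.regularSet := by
    unfold flux raise pairing
    refine (contDiffOn_ofReal B.contDiffOn_volDensity).mul (ContDiffOn.sum fun d _ =>
      (contDiffOn_ofReal (B.contDiffOn_ginv b d)).mul (ContDiffOn.sum fun a _ =>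
      ContDiffOn.sum fun c _ => (contDiffOn_ofReal (B.contDiffOn_ginv a c)).mul
      (ContDiffOn.mul ?_ (hs c d))))
    exact (Complex.conjCLE.toContinuousLinearMap.contDiff.comp (contDiff_coord hv a)).contDiffOn
  exact h.of_le (by exact_mod_cast le_top)

theorem exists_pd_ne_zero {D : Set E3} {x : E3} {φ : E3 → ℝ} (h : IsLocalDefining D x φ) :
    ∃ b, pd b φ x ≠ 0 := by
  by_contra! hc
  refine h.fderiv_ne (ContinuousLinearMap.ext fun v => ?_)
  have hv : v = ∑ i, v i • EuclideanSpace.single i (1 : ℝ) := by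
    ext i
    simp [Pi.single_apply]
  rw [hv, map_sum]
  refine Finset.sum_eq_zero fun i _ => ?_
  rw [map_smul]
  have := hc i
  rw [pd] at this
  rw [this, smul_zero]

/-- The conormal length of a defining function is positive. -/
theorem conormal_pos {D : Set E3} {x : E3} (hx : x ∈ closure B.Ω) {φ : E3 → ℝ}
    (h : IsLocalDefining D x φ) : 0 < ∑ b, ∑ c, B.ginv x b c * (pd b φ x * pd c φ x) := by
  obtain ⟨b, hb⟩ := exists_pd_ne_zero h
  have h1 := (B.g_posDef x hx).inv.dotProduct_mulVec_pos (x := fun i => pd i φ x)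
    (fun h0 => hb (congrFun h0 b))
  refine h1.trans_le (le_of_eq ?_)
  simp only [dotProduct, Matrix.mulVec, Finset.mul_sum, Pi.star_apply, star_trivial]
  refine Finset.sum_congr rfl fun i _ => Finset.sum_congr rfl fun j _ => ?_
  rw [ginv]
  ring

/-- Raising the index of ∇φ gives its length times the unit normal. The factor q depends on neither
the fields nor the layer, so continuity of displacement and traction passes to the normal flux. -/
theorem normal_flux {D : Set E3} {x : E3} (hx : x ∈ closure B.Ω) {φ : E3 → ℝ}
    (h : IsLocalDefining D x φ) : ∃ ν q, B.IsOuterUnitNormal D x ν ∧ ∀ (v : E3 → C3) u j,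
      ∑ b, ((pd b φ x : ℝ) : ℂ) * B.flux v (B.stress j u) b x =
        q * ∑ a, ∑ c, (B.ginv x a c : ℂ) * (conj (v x a) * B.traction j u x ν c) := by
  set q := √(∑ b, ∑ c, B.ginv x b c * (pd b φ x * pd c φ x)) with hq
  have hq0 : q ≠ 0 := (Real.sqrt_pos.2 (B.conormal_pos hx h)).ne'
  refine ⟨fun a => (∑ b, B.ginv x a b * pd b φ x) / q, (B.volDensity x : ℂ) * (q : ℂ),
    ⟨φ, h, fun a => rfl⟩, fun v u j => ?_⟩
  have hν : ∀ d, (q : ℂ) * (((∑ b, B.ginv x d b * pd b φ x) / q : ℝ) : ℂ) =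
      ∑ b, (B.ginv x b d : ℂ) * ((pd b φ x : ℝ) : ℂ) := by
    intro d
    push_cast
    rw [mul_div_cancel₀ _ (Complex.ofReal_ne_zero.2 hq0)]
    refine Finset.sum_congr rfl fun b _ => ?_
    rw [B.ginv_symm hx]
  have h1 : ∀ c, (q : ℂ) * B.traction j u x (fun a => (∑ b, B.ginv x a b * pd b φ x) / q) c =
      ∑ d, B.stress j u x c d * ∑ b, (B.ginv x b d : ℂ) * ((pd b φ x : ℝ) : ℂ) := by
    intro c
    rw [traction, Finset.mul_sum]
    refine Finset.sum_congr rfl fun d _ => ?_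
    rw [← hν]
    ring
  have h2 : (B.volDensity x : ℂ) * (q : ℂ) * ∑ a, ∑ c, (B.ginv x a c : ℂ) * (conj (v x a) *
      B.traction j u x (fun a => (∑ b, B.ginv x a b * pd b φ x) / q) c) =
      (B.volDensity x : ℂ) * ∑ a, ∑ c, (B.ginv x a c : ℂ) * (conj (v x a) *
      ((q : ℂ) * B.traction j u x (fun a => (∑ b, B.ginv x a b * pd b φ x) / q) c)) := by
    simp only [Finset.mul_sum]
    refine Finset.sum_congr rfl fun a _ => Finset.sum_congr rfl fun c _ => ?_
    ring
  rw [h2]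
  simp only [h1, flux, raise, pairing, Finset.mul_sum]
  rw [sum_comm_pairs]
  refine Finset.sum_congr rfl fun a _ => Finset.sum_congr rfl fun c _ => ?_
  rw [Finset.sum_comm]
  refine Finset.sum_congr rfl fun d _ => Finset.sum_congr rfl fun b _ => ?_
  ring

theorem massWeight_mat {j : Fin (B.k + 1)} {x : E3} (hx : x ∈ layer B.D j) :
    B.massWeight.mat x = B.massMatrix j x := by
  ext a b
  exact B.glue_eq (fun l y => B.massMatrix l y a b) hx

theorem stiffnessWeight_mat {j : Fin (B.k + 1)} {x : E3} (hx : x ∈ layer B.D j) :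
    B.stiffnessWeight.mat x = B.stiffnessMatrix j x := by
  ext a b
  exact B.glue_eq (fun l y => B.stiffnessMatrix l y a b) hx

theorem frontier_D_subset (j : Fin (B.k + 1)) : frontier (B.D j) ⊆ closure B.Ω :=
  frontier_subset_closure.trans (closure_mono (B.D_subset j))

/-- Green's formula for admissible displacements. -/
theorem green {u : Fin (B.k + 1) → E3 → C3} (hu : u ∈ B.admissible) {b : B.L2} {e : B.StrainL2}
    (hb : B.Represents b fun j => B.elastic j (u j))
    (he : (fun x => e x) =ᵐ[volume.restrict B.Ω] glue B.D fun j => B.symDiff (u j))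
    {q : B.L2 × B.StrainL2} (hq : q ∈ B.strainGraph) :
    inner ℂ (-b) q.1 = inner ℂ e q.2 := by
  obtain ⟨v, hv, hq1, hq2⟩ := hq
  -- The sum is the integral of the divergence of the flux. The transmission conditions give its
  -- continuous normal component, and v = 0 on ∂Ω makes it vanish on the outer boundary.
  have key : inner ℂ q.1 b + inner ℂ q.2 e = 0 := by
    rw [WL2.inner_def, WL2.inner_def, ← integral_add (WL2.integrable_hermForm _ _)
      (WL2.integrable_hermForm _ _)]
    have h0 := B.integral_glue_coordDiv (X := fun j => B.flux (v j) (B.stress j (u j)))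
      (fun j b => B.contDiffOn_flux (hv.1 j) (fun a c => B.contDiffOn_stress j (hu.1 j) a c) b)
      (fun j x hx φ hφ => by
        obtain ⟨ν, r, hν, hr⟩ := B.normal_flux (B.frontier_D_subset _ hx) hφ
        rw [hr, hr]
        simp only [hv.2.1 j x hx, hu.2.2.1 j x hx ν hν])
      (fun x hx b => by simp [flux, raise, pairing, hv.2.2.2 x hx])
    rw [← h0]
    refine integral_congr_ae ?_
    filter_upwards [hb, he, hq1, hq2, ae_restrict_mem (B.isOpen 0).measurableSet]
      with x h1 h2 h3 h4 hx
    obtain ⟨j, hj⟩ := B.exists_mem_layer hx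
    rw [h1, h2, h3, h4, B.glue_eq _ hj, B.glue_eq _ hj, B.glue_eq _ hj, B.glue_eq _ hj,
      B.glue_eq _ hj, B.massWeight_mat hj, B.stiffnessWeight_mat hj,
      B.coordDiv_flux_stress j (hu.1 j) (hv.1 j) hj]
  have h2 := congrArg conj key
  rw [map_add, inner_conj_symm, inner_conj_symm, map_zero] at h2
  rw [inner_neg_left]
  exact neg_eq_of_add_eq_zero_right h2

end ElasticBody

namespace ElasticBody

variable (B : ElasticBody)

instance : IsFiniteMeasure (volume.restrict B.Ω) :=
  ⟨by rw [Measure.restrict_apply_univ]; exact B.bounded.measure_lt_top⟩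

/-! ### Square integrable representatives -/

theorem exists_representative {ι : Type} [Fintype ι] (w : FiberWeight (volume.restrict B.Ω) ι)
    {F : Fin (B.k + 1) → E3 → EuclideanSpace ℂ ι}
    (hF : ∀ j, ContinuousOn (F j) (closedLayer B.D j)) :
    ∃ a : WL2 w, (fun x => a x) =ᵐ[volume.restrict B.Ω] glue B.D F := by
  have hm : MemLp (glue B.D F) 2 (volume.restrict B.Ω) := by
    unfold glue
    refine memLp_finsetSum _ fun j _ => ?_
    rw [memLp_indicator_iff_restrict (B.measurableSet_layer j)]
    obtain ⟨C, hC⟩ := (B.isCompact_closedLayer j).exists_bound_of_continuousOn (hF j)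
    rw [Measure.restrict_restrict (B.measurableSet_layer j)]
    have hsub : layer B.D j ∩ B.Ω ⊆ closedLayer B.D j :=
      inter_subset_left.trans (B.layer_subset j)
    have hms : MeasurableSet (layer B.D j ∩ B.Ω) :=
      (B.measurableSet_layer j).inter (B.isOpen 0).measurableSet
    have hfin : IsFiniteMeasure (volume.restrict (layer B.D j ∩ B.Ω)) :=
      ⟨by rw [Measure.restrict_apply_univ]; exact (B.bounded.subset inter_subset_right).measure_lt_top⟩
    refine MemLp.of_bound (((hF j).mono hsub).aestronglyMeasurable hms) C ?_
    filter_upwards [ae_restrict_mem hms] with x hx using hC x (hsub hx)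
  exact ⟨(hm.toLp _ : Lp _ 2 _), hm.coeFn_toLp⟩

theorem continuousOn_euclidean {ι : Type} [Fintype ι] {f : E3 → EuclideanSpace ℂ ι} {s : Set E3}
    (hf : ∀ i, ContinuousOn (fun x => f x i) s) : ContinuousOn f s :=
  (PiLp.continuous_toLp 2 _).comp_continuousOn (continuousOn_pi.2 hf)

theorem closedLayer_subset_regularSet (j : Fin (B.k + 1)) : closedLayer B.D j ⊆ B.regularSet :=
  (B.closedLayer_subset j).trans B.closure_subset_regularSet

theorem continuousOn_symDiff {u : E3 → C3} (hu : ContDiff ℝ ∞ u) (j : Fin (B.k + 1)) :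
    ContinuousOn (B.symDiff u) (closedLayer B.D j) :=
  continuousOn_euclidean fun p =>
    (B.contDiffOn_symDiff hu p).continuousOn.mono (B.closedLayer_subset_regularSet j)

theorem continuousOn_elastic {u : E3 → C3} (hu : ContDiff ℝ ∞ u) (j : Fin (B.k + 1)) :
    ContinuousOn (B.elastic j u) (closedLayer B.D j) := by
  refine continuousOn_euclidean fun a => ContinuousOn.mul (ContinuousOn.inv₀ ?_ ?_) ?_
  · exact (Complex.continuous_ofReal.comp (B.rho_smooth j).continuous).continuousOn
  · exact fun x hx => Complex.ofReal_ne_zero.2 (B.rho_pos j x hx).ne'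
  · exact (B.contDiffOn_div2 (B.contDiffOn_stress j hu) a).continuousOn.mono
      (B.closedLayer_subset_regularSet j)

/-! ### The elastic operator -/

theorem stress_add (j : Fin (B.k + 1)) {u v : E3 → C3} (hu : ContDiff ℝ ∞ u)
    (hv : ContDiff ℝ ∞ v) (x : E3) (a b : Fin 3) :
    B.stress j (u + v) x a b = B.stress j u x a b + B.stress j v x a b := by
  simp only [stress, div1, B.symDiff_add hu hv, B.covDeriv_add hu hv, PiLp.add_apply,
    mul_add, Finset.sum_add_distrib, add_mul]
  ring

theorem stress_smul (j : Fin (B.k + 1)) (c : ℂ) {u : E3 → C3} (hu : ContDiff ℝ ∞ u) (x : E3)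
    (a b : Fin 3) : B.stress j (c • u) x a b = c * B.stress j u x a b := by
  have h : B.div1 (c • u) x = c * B.div1 u x := by
    simp only [div1, B.covDeriv_smul c hu, Finset.mul_sum]
    refine Finset.sum_congr rfl fun i _ => Finset.sum_congr rfl fun j _ => ?_
    ring
  simp only [stress, h, B.symDiff_smul c hu, PiLp.smul_apply, smul_eq_mul]
  ring

theorem stress_zero (j : Fin (B.k + 1)) (x : E3) (a b : Fin 3) :
    B.stress j 0 x a b = 0 := by
  simp [stress, div1, B.symDiff_zero, B.covDeriv_zero]

theorem differentiableAt_stress (j : Fin (B.k + 1)) {u : E3 → C3} (hu : ContDiff ℝ ∞ u) {x : E3}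
    (hx : x ∈ B.Ω) (a b : Fin 3) : DifferentiableAt ℝ (fun y => B.stress j u y a b) x :=
  differentiableAt_of_contDiffOn B.isOpen_regularSet (B.contDiffOn_stress j hu a b)
    (B.mem_regularSet hx)

theorem elastic_add (j : Fin (B.k + 1)) {u v : E3 → C3} (hu : ContDiff ℝ ∞ u)
    (hv : ContDiff ℝ ∞ v) {x : E3} (hx : x ∈ B.Ω) :
    B.elastic j (u + v) x = B.elastic j u x + B.elastic j v x := by
  ext a
  have h : ∀ c b, pd c (fun y => B.stress j u y a b + B.stress j v y a b) x =
      pd c (fun y => B.stress j u y a b) x + pd c (fun y => B.stress j v y a b) x := by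
    intro c b
    unfold pd
    rw [fderiv_fun_add (B.differentiableAt_stress j hu hx a b)
      (B.differentiableAt_stress j hv hx a b)]
    rfl
  change (B.rho j x : ℂ)⁻¹ * B.div2 (B.stress j (u + v)) x a =
    (B.rho j x : ℂ)⁻¹ * B.div2 (B.stress j u) x a + (B.rho j x : ℂ)⁻¹ * B.div2 (B.stress j v) x a
  rw [← mul_add]
  simp only [div2, B.stress_add j hu hv, h, ← Finset.sum_add_distrib]
  congr 1
  refine Finset.sum_congr rfl fun b _ => Finset.sum_congr rfl fun c _ => ?_
  simp only [mul_add, Finset.sum_add_distrib]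
  ring

theorem elastic_smul (j : Fin (B.k + 1)) (c : ℂ) {u : E3 → C3} (hu : ContDiff ℝ ∞ u) {x : E3}
    (hx : x ∈ B.Ω) : B.elastic j (c • u) x = c • B.elastic j u x := by
  ext a
  have h : ∀ d b, pd d (fun y => c * B.stress j u y a b) x =
      c * pd d (fun y => B.stress j u y a b) x := by
    intro d b
    have := fderiv_fun_const_smul (B.differentiableAt_stress j hu hx a b) c
    exact congrArg (fun L => L (EuclideanSpace.single d 1)) this
  change (B.rho j x : ℂ)⁻¹ * B.div2 (B.stress j (c • u)) x a =
    c * ((B.rho j x : ℂ)⁻¹ * B.div2 (B.stress j u) x a)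
  rw [mul_left_comm]
  simp only [div2, B.stress_smul j c hu, h, Finset.mul_sum]
  refine Finset.sum_congr rfl fun b _ => Finset.sum_congr rfl fun d _ => ?_
  simp only [mul_left_comm _ c, ← Finset.mul_sum]
  ring

theorem elastic_zero (j : Fin (B.k + 1)) (x : E3) : B.elastic j 0 x = 0 := by
  ext a
  simp [elastic, div2, B.stress_zero, pd]

theorem represents_add {p q : B.L2} {f g : Fin (B.k + 1) → E3 → C3}
    {h : Fin (B.k + 1) → E3 → C3} (hp : B.Represents p f) (hq : B.Represents q g)
    (hh : ∀ j, ∀ x ∈ B.Ω, h j x = f j x + g j x) : B.Represents (p + q) h := by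
  unfold Represents at *
  filter_upwards [hp, hq, WL2.coe_add p q, ae_restrict_mem (B.isOpen 0).measurableSet]
    with x h1 h2 h3 hx
  obtain ⟨j, hj⟩ := B.exists_mem_layer hx
  rw [h3, h1, h2, B.glue_eq _ hj, B.glue_eq _ hj, B.glue_eq _ hj, hh j x hx]

theorem represents_smul (c : ℂ) {p : B.L2} {f h : Fin (B.k + 1) → E3 → C3}
    (hp : B.Represents p f) (hh : ∀ j, ∀ x ∈ B.Ω, h j x = c • f j x) :
    B.Represents (c • p) h := by
  unfold Represents at *
  filter_upwards [hp, WL2.coe_smul c p, ae_restrict_mem (B.isOpen 0).measurableSet]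
    with x h1 h3 hx
  obtain ⟨j, hj⟩ := B.exists_mem_layer hx
  rw [h3, h1, B.glue_eq _ hj, B.glue_eq _ hj, hh j x hx]

theorem represents_zero {h : Fin (B.k + 1) → E3 → C3} (hh : ∀ j x, h j x = 0) :
    B.Represents 0 h := by
  unfold Represents
  filter_upwards [WL2.coe_zero (w := B.massWeight)] with x h1
  rw [h1]
  refine (Finset.sum_eq_zero fun j _ => ?_).symm
  by_cases hx : x ∈ layer B.D j <;> simp [hx, hh]

/-- The graph of the elastic operator on the admissible displacements. -/
def elasticGraph : Submodule ℂ (B.L2 × B.L2) where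
  carrier := {p | ∃ u ∈ B.admissible, B.Represents p.1 u ∧
    B.Represents p.2 fun j => B.elastic j (u j)}
  zero_mem' := ⟨0, zero_mem _, B.represents_zero fun _ _ => rfl,
    B.represents_zero fun j x => B.elastic_zero j x⟩
  add_mem' := by
    rintro p q ⟨u, hu, hp, hp'⟩ ⟨v, hv, hq, hq'⟩
    exact ⟨u + v, add_mem hu hv, B.represents_add hp hq fun _ _ _ => rfl,
      B.represents_add hp' hq' fun j x hx => B.elastic_add j (hu.1 j) (hv.1 j) hx⟩
  smul_mem' := by
    rintro c p ⟨u, hu, hp, hp'⟩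
    exact ⟨c • u, B.admissible.smul_mem c hu, B.represents_smul c hp fun _ _ _ => rfl,
      B.represents_smul c hp' fun j x hx => B.elastic_smul j c (hu.1 j) hx⟩

theorem mem_elasticGraph {p : B.L2 × B.L2} : p ∈ B.elasticGraph ↔ ∃ u ∈ B.admissible,
    B.Represents p.1 u ∧ B.Represents p.2 fun j => B.elastic j (u j) := Iff.rfl

theorem exists_elastic_representative {u : Fin (B.k + 1) → E3 → C3} (hu : u ∈ B.admissible) :
    ∃ b : B.L2, B.Represents b fun j => B.elastic j (u j) :=
  B.exists_representative _ fun j => B.continuousOn_elastic (hu.1 j) j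

theorem exists_mem_elasticGraph {u : Fin (B.k + 1) → E3 → C3} (hu : u ∈ B.admissible) :
    ∃ p ∈ B.elasticGraph, B.Represents p.1 u := by
  obtain ⟨a, ha⟩ := B.exists_representative B.massWeight fun j => (hu.1 j).continuous.continuousOn
  obtain ⟨b, hb⟩ := B.exists_elastic_representative hu
  exact ⟨(a, b), ⟨u, hu, ha, hb⟩, ha⟩

theorem elasticGraph_green {p : B.L2 × B.L2} (hp : p ∈ B.elasticGraph) :
    ∃ e, (p.1, e) ∈ B.strainGraph ∧
      ∀ q ∈ B.strainGraph, inner ℂ (-p.2) q.1 = inner ℂ e q.2 := by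
  obtain ⟨u, hu, h1, h2⟩ := hp
  obtain ⟨e, he⟩ := B.exists_representative B.stiffnessWeight fun j =>
    B.continuousOn_symDiff (hu.1 j) j
  exact ⟨e, ⟨u, hu, h1, he⟩, fun q hq => B.green hu h2 he hq⟩

theorem strainGraph_green {p : B.L2 × B.StrainL2} (hp : p ∈ B.strainGraph) :
    ∃ b, (p.1, b) ∈ B.elasticGraph ∧
      ∀ q ∈ B.strainGraph, inner ℂ (-b) q.1 = inner ℂ p.2 q.2 := by
  obtain ⟨u, hu, h1, h2⟩ := hp
  obtain ⟨b, hb⟩ := B.exists_elastic_representative hu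
  exact ⟨b, ⟨u, hu, h1, hb⟩, fun q hq => B.green hu hb h2 hq⟩

end ElasticBody

namespace ElasticBody

variable (B : ElasticBody)

/-! ### Density of the admissible displacements -/

/-- The interior of the `j`-th layer. -/
def openLayer (j : Fin (B.k + 1)) : Set E3 := B.D j \ ⋃ i, ⋃ _ : j < i, closure (B.D i)

theorem isOpen_openLayer (j : Fin (B.k + 1)) : IsOpen (B.openLayer j) := by
  refine (B.isOpen j).sdiff ?_
  exact isClosed_iUnion_of_finite fun i => isClosed_iUnion_of_finite fun _ => isClosed_closure

theorem openLayer_subset_layer (j : Fin (B.k + 1)) : B.openLayer j ⊆ layer B.D j :=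
  sdiff_subset_sdiff_right (iUnion₂_mono fun _ _ => subset_closure)

theorem frontier_disjoint_openLayer (i j : Fin (B.k + 1)) {x : E3} (hx : x ∈ frontier (B.D i)) :
    x ∉ B.openLayer j := by
  rintro ⟨h1, h2⟩
  rcases le_or_gt i j with h | h
  · have h3 : x ∈ B.D i := by
      rcases h.eq_or_lt with h | h
      · rwa [h]
      · exact B.nested i j h (subset_closure h1)
    rw [(B.isOpen i).frontier_eq] at hx
    exact hx.2 h3
  · exact h2 (mem_iUnion₂.2 ⟨i, h, frontier_subset_closure hx⟩)

/-- Only interface points are lost, and the interfaces are null sets. -/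
theorem ae_mem_openLayer : ∀ᵐ x ∂(volume.restrict B.Ω), ∃ j, x ∈ B.openLayer j := by
  have h : ∀ i, ∀ᵐ x ∂(volume.restrict B.Ω), x ∉ frontier (B.D i) := fun i =>
    ae_restrict_of_ae (measure_eq_zero_iff_ae_notMem.1
      ((B.smoothBoundary i).volume_frontier (B.isOpen i)))
  filter_upwards [ae_all_iff.2 h, ae_restrict_mem (B.isOpen 0).measurableSet] with x h1 hx
  obtain ⟨j, hj⟩ := B.exists_mem_layer hx
  refine ⟨j, hj.1, fun h2 => ?_⟩
  obtain ⟨i, hi, hxi⟩ := mem_iUnion₂.1 h2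
  refine h1 i ?_
  rw [(B.isOpen i).frontier_eq]
  exact ⟨hxi, fun hD => hj.2 (mem_iUnion₂.2 ⟨i, hi, hD⟩)⟩

theorem traction_eq_zero (l : Fin (B.k + 1)) {u : E3 → C3} {x : E3} (h : u =ᶠ[𝓝 x] 0)
    (ν : Fin 3 → ℝ) (a : Fin 3) : B.traction l u x ν a = 0 := by
  have h1 : ∀ i j, B.covDeriv u x i j = 0 := by
    intro i j
    have h2 : (fun y => u y j) =ᶠ[𝓝 x] fun _ => 0 := h.mono fun y hy => by simp [hy]
    rw [covDeriv, pd_congr h2]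
    simp [pd, h.self_of_nhds]
  simp [traction, stress, div1, symDiff, h1]

/-- The displacement with the component `χ` in direction `a`, supported in the `j`-th layer. -/
def testField (j : Fin (B.k + 1)) (a : Fin 3) (χ : E3 → ℝ) : Fin (B.k + 1) → E3 → C3 :=
  Pi.single j fun x => EuclideanSpace.single a (χ x : ℂ)

theorem testField_admissible (j : Fin (B.k + 1)) (a : Fin 3) {χ : E3 → ℝ} (hχ : ContDiff ℝ ∞ χ)
    (hs : tsupport χ ⊆ B.openLayer j) : B.testField j a χ ∈ B.admissible := by
  have hz : ∀ i, ∀ x ∈ frontier (B.D i), ∀ l, B.testField j a χ l =ᶠ[𝓝 x] 0 := by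
    intro i x hx l
    have hx' : x ∉ tsupport χ := fun h => B.frontier_disjoint_openLayer i j hx (hs h)
    filter_upwards [notMem_tsupport_iff_eventuallyEq.1 hx'] with y hy
    rw [testField]
    by_cases hl : l = j
    · subst hl
      simp [hy]
    · simp [Pi.single_eq_of_ne hl]
  refine ⟨fun l => ?_, fun i x hx => ?_, fun i x hx ν _ b => ?_, fun x hx => ?_⟩
  · rw [testField]
    by_cases hl : l = j
    · subst hl
      rw [Pi.single_eq_same]
      have h : (fun x => EuclideanSpace.single a (χ x : ℂ) : E3 → C3) =
          fun x => χ x • EuclideanSpace.single a (1 : ℂ) := by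
        ext x c
        by_cases hc : c = a <;> simp [hc]
      rw [h]
      exact hχ.smul contDiff_const
    · rw [Pi.single_eq_of_ne hl]
      exact contDiff_const
  · rw [(hz _ x hx _).self_of_nhds, (hz _ x hx _).self_of_nhds]
  · rw [B.traction_eq_zero _ (hz _ x hx _), B.traction_eq_zero _ (hz _ x hx _)]
  · exact (hz 0 x hx 0).self_of_nhds

/-- The densities `∑ Wₐ_c z_c`. -/
theorem integrable_weighted (z : B.L2) (a : Fin 3) :
    Integrable (fun x => ∑ c, (B.massWeight.mat x a c : ℂ) * z x c) (volume.restrict B.Ω) := by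
  refine integrable_finsetSum _ fun c _ => ?_
  obtain ⟨C, hC⟩ := B.massWeight.bdd
  refine Integrable.bdd_mul (c := C) ?_ ?_ ?_
  · exact (WL2.memLp_coord z c).integrable (by norm_num)
  · exact (Complex.measurable_ofReal.comp (B.massWeight.meas a c)).aestronglyMeasurable
  · filter_upwards [hC] with x hx
    simpa using hx a c

/-- Fields compactly supported in one open layer are trivially admissible. The fundamental lemma of
the calculus of variations then kills each component of Wz, with W the mass matrix, and hence the
density of ⟨z, z⟩. -/
theorem eq_zero_of_orthogonal (z : B.L2)
    (hz : ∀ p ∈ B.elasticGraph, inner ℂ p.1 z = 0) : z = 0 := by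
  have h1 : ∀ j a, ∀ᵐ x ∂(volume.restrict B.Ω), x ∈ B.openLayer j →
      ∑ c, (B.massWeight.mat x a c : ℂ) * z x c = 0 := by
    intro j a
    refine (B.isOpen_openLayer j).ae_eq_zero_of_integral_contDiff_smul_eq_zero
      ((B.integrable_weighted z a).locallyIntegrable.locallyIntegrableOn _) fun χ hχ _ hs => ?_
    obtain ⟨p, hp, hpr⟩ := B.exists_mem_elasticGraph (B.testField_admissible j a hχ hs)
    rw [← hz p hp, WL2.inner_def]
    refine integral_congr_ae ?_
    filter_upwards [hpr, ae_restrict_mem (B.isOpen 0).measurableSet] with x hx hxΩ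
    have hval : p.1 x = EuclideanSpace.single a (χ x : ℂ) := by
      rw [hx]
      obtain ⟨l, hl⟩ := B.exists_mem_layer hxΩ
      rw [B.glue_eq _ hl, testField]
      by_cases hlj : l = j
      · subst hlj
        rw [Pi.single_eq_same]
      · have h0 : χ x = 0 := image_eq_zero_of_notMem_tsupport fun h =>
          B.layer_disjoint hlj hl (B.openLayer_subset_layer j (hs h))
        rw [Pi.single_eq_of_ne hlj, h0]
        ext c
        simp
    have hform : hermForm (B.massWeight.mat x) (EuclideanSpace.single a (χ x : ℂ)) (z x) =
        χ x • ∑ c, (B.massWeight.mat x a c : ℂ) * z x c := by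
      rw [hermForm, Fintype.sum_eq_single a fun b hb => Finset.sum_eq_zero fun c _ => by simp [hb],
        Complex.real_smul, Finset.mul_sum]
      refine Finset.sum_congr rfl fun c _ => ?_
      simp only [PiLp.single_apply, if_true, Complex.conj_ofReal]
      ring
    rw [hval, hform]
  have h2 : inner ℂ z z = 0 := by
    rw [WL2.inner_def]
    refine integral_eq_zero_of_ae ?_
    filter_upwards [ae_all_iff.2 fun j => ae_all_iff.2 (h1 j), B.ae_mem_openLayer] with x hx hxj
    obtain ⟨j, hj⟩ := hxj
    rw [hermForm]
    refine Finset.sum_eq_zero fun a _ => ?_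
    have h3 : ∑ c, (B.massWeight.mat x a c : ℂ) * (conj (z x a) * z x c) =
        conj (z x a) * ∑ c, (B.massWeight.mat x a c : ℂ) * z x c := by
      rw [Finset.mul_sum]
      exact Finset.sum_congr rfl fun c _ => by ring
    rw [h3, hx j a hj, mul_zero]
  exact inner_self_eq_zero.1 h2

theorem dense_elasticGraph : Dense (Prod.fst '' (B.elasticGraph : Set (B.L2 × B.L2))) := by
  have h : (B.elasticGraph.map (LinearMap.fst ℂ B.L2 B.L2)).topologicalClosure = ⊤ := by
    rw [Submodule.topologicalClosure_eq_top_iff, eq_bot_iff]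
    intro z hz
    exact B.eq_zero_of_orthogonal z fun p hp => hz p.1 ⟨p, hp, rfl⟩
  exact Submodule.dense_iff_topologicalClosure_eq_top.2 h

/-! ### The Poincaré inequality -/

/-- The weight `exp(2τ(x₀ + x₁ + x₂))`. -/
def expWeight (τ : ℝ) (x : E3) : ℝ := Real.exp (2 * τ * ∑ i, x i)

theorem hasFDerivAt_sum_coord (x : E3) :
    HasFDerivAt (fun x : E3 => ∑ i, x i) (∑ i, (EuclideanSpace.proj (𝕜 := ℝ) i :
      E3 →L[ℝ] ℝ)) x :=
  HasFDerivAt.fun_sum fun i _ => (EuclideanSpace.proj (𝕜 := ℝ) i : E3 →L[ℝ] ℝ).hasFDerivAt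

theorem contDiff_expWeight (τ : ℝ) : ContDiff ℝ ∞ (expWeight τ) :=
  Real.contDiff_exp.comp (contDiff_const.mul (ContDiff.sum fun i _ =>
    (EuclideanSpace.proj (𝕜 := ℝ) i : E3 →L[ℝ] ℝ).contDiff))

theorem pd_expWeight (τ : ℝ) (x : E3) (b : Fin 3) :
    pd b (expWeight τ) x = 2 * τ * expWeight τ x := by
  have h : HasFDerivAt (expWeight τ) _ x := ((hasFDerivAt_sum_coord x).const_mul (2 * τ)).exp
  rw [pd, h.fderiv]
  simp [expWeight]
  ring

theorem expWeight_pos (τ : ℝ) (x : E3) : 0 < expWeight τ x := Real.exp_pos _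

/-- The field with components `w |u_b|²`. -/
def weightedSquare (τ : ℝ) (u : E3 → C3) (b : Fin 3) (x : E3) : ℂ :=
  (expWeight τ x : ℂ) * (conj (u x b) * u x b)

theorem contDiff_weightedSquare (τ : ℝ) {u : E3 → C3} (hu : ContDiff ℝ ∞ u) (b : Fin 3) :
    ContDiff ℝ ∞ (weightedSquare τ u b) :=
  (Complex.ofRealCLM.contDiff.comp (contDiff_expWeight τ)).mul
    ((Complex.conjCLE.toContinuousLinearMap.contDiff.comp (contDiff_coord hu b)).mul
      (contDiff_coord hu b))

theorem pd_weightedSquare (τ : ℝ) {u : E3 → C3} (hu : ContDiff ℝ ∞ u) (b : Fin 3) (x : E3) :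
    pd b (weightedSquare τ u b) x = (expWeight τ x : ℂ) * (2 * τ * (conj (u x b) * u x b) +
      (conj (pd b (fun y => u y b) x) * u x b + conj (u x b) * pd b (fun y => u y b) x)) := by
  have hd := differentiableAt_coord hu x b
  have hc : DifferentiableAt ℝ (fun y => conj (u y b)) x :=
    Complex.conjCLE.toContinuousLinearMap.differentiableAt.comp x hd
  have hw : DifferentiableAt ℝ (expWeight τ) x := (contDiff_expWeight τ).differentiable (by simp) x
  unfold weightedSquare
  rw [pd_mul (differentiableAt_ofReal hw) (hc.fun_mul hd), pd_mul hc hd, pd_conj hd, pd_ofReal hw,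
    pd_expWeight]
  push_cast
  ring

/-- Differentiating the weight contributes 2τ|u_b|². Half of it pays for the cross term 2 Re(ū_b ∂_b
u_b) by Young's inequality. -/
theorem re_pd_weightedSquare_ge {τ : ℝ} (hτ : 0 < τ) {u : E3 → C3} (hu : ContDiff ℝ ∞ u)
    (b : Fin 3) (x : E3) : expWeight τ x * (τ * ‖u x b‖ ^ 2 - τ⁻¹ * ‖pd b (fun y => u y b) x‖ ^ 2) ≤
      (pd b (weightedSquare τ u b) x).re := by
  rw [pd_weightedSquare τ hu, Complex.re_ofReal_mul]
  refine mul_le_mul_of_nonneg_left ?_ (expWeight_pos τ x).le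
  set z := u x b
  set y := pd b (fun y => u y b) x
  have h1 : (2 * (τ : ℂ) * (conj z * z)).re = 2 * τ * ‖z‖ ^ 2 := by
    rw [← Complex.normSq_eq_conj_mul_self, Complex.normSq_eq_norm_sq]
    have : (2 * (τ : ℂ) * ((‖z‖ ^ 2 : ℝ) : ℂ)) = ((2 * τ * ‖z‖ ^ 2 : ℝ) : ℂ) := by push_cast; ring
    rw [this, Complex.ofReal_re]
  have h2 : (conj y * z + conj z * y).re = 2 * (conj z * y).re := by
    simp only [Complex.add_re, Complex.mul_re, Complex.conj_re, Complex.conj_im]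
    ring
  have h3 : -(‖z‖ * ‖y‖) ≤ (conj z * y).re := by
    have := (abs_le.1 (Complex.abs_re_le_norm (conj z * y))).1
    rwa [norm_mul, RCLike.norm_conj] at this
  rw [Complex.add_re, h1, h2]
  have h4 : 0 ≤ τ⁻¹ * (τ * ‖z‖ - ‖y‖) ^ 2 := by positivity
  have h5 : τ⁻¹ * (τ * ‖z‖ - ‖y‖) ^ 2 = τ * ‖z‖ ^ 2 - 2 * (‖z‖ * ‖y‖) + τ⁻¹ * ‖y‖ ^ 2 := by
    field_simp
    ring
  linarith

theorem exists_christoffel_bound : ∃ M : ℝ, 0 ≤ M ∧ ∀ x ∈ B.Ω, ∀ k i j,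
    |B.christoffel x k i j| ≤ M := by
  have h : ∀ k i j, ∃ C, ∀ x ∈ closure B.Ω, ‖B.christoffel x k i j‖ ≤ C := fun k i j =>
    B.bounded.isCompact_closure.exists_bound_of_continuousOn
      ((B.contDiffOn_christoffel k i j).continuousOn.mono B.closure_subset_regularSet)
  choose C hC using h
  refine ⟨∑ k, ∑ i, ∑ j, |C k i j|, by positivity, fun x hx k i j => ?_⟩
  refine ((hC k i j x (subset_closure hx)).trans (le_abs_self _)).trans ?_
  refine (Finset.single_le_sum (f := fun j => |C k i j|) (fun _ _ => abs_nonneg _)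
    (Finset.mem_univ j)).trans ?_
  refine (Finset.single_le_sum (f := fun i => ∑ j, |C k i j|) (fun _ _ => by positivity)
    (Finset.mem_univ i)).trans ?_
  exact Finset.single_le_sum (f := fun k => ∑ i, ∑ j, |C k i j|) (fun _ _ => by positivity)
    (Finset.mem_univ k)

/-- The diagonal derivatives are controlled by the strain. -/
theorem norm_pd_diag_le {M : ℝ} {x : E3} (hM : ∀ k i j, |B.christoffel x k i j| ≤ M) (u : E3 → C3)
    (b : Fin 3) : ‖pd b (fun y => u y b) x‖ ≤ ‖B.symDiff u x‖ + 3 * M * ‖u x‖ := by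
  have h1 : pd b (fun y => u y b) x =
      B.symDiff u x (b, b) + ∑ k, (B.christoffel x k b b : ℂ) * u x k := by
    rw [symDiff_apply, covDeriv]
    ring
  rw [h1]
  refine (norm_add_le _ _).trans (add_le_add (PiLp.norm_apply_le _ _) ?_)
  calc ‖∑ k, (B.christoffel x k b b : ℂ) * u x k‖ ≤ ∑ _k : Fin 3, M * ‖u x‖ := by
        refine (norm_sum_le _ _).trans (Finset.sum_le_sum fun k _ => ?_)
        rw [norm_mul, Complex.norm_real, Real.norm_eq_abs]
        exact mul_le_mul (hM k b b) (PiLp.norm_apply_le _ k) (norm_nonneg _)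
          ((abs_nonneg _).trans (hM k b b))
    _ = 3 * M * ‖u x‖ := by simp; ring

/-- The pointwise form of the weighted estimate. -/
theorem re_coordDiv_weightedSquare_ge {M : ℝ} {x : E3}
    (hM : ∀ k i j, |B.christoffel x k i j| ≤ M) {u : E3 → C3} (hu : ContDiff ℝ ∞ u) :
    expWeight (54 * M ^ 2 + 1) x * (‖u x‖ ^ 2 - 6 * ‖B.symDiff u x‖ ^ 2) ≤
      (coordDiv (weightedSquare (54 * M ^ 2 + 1) u) x).re := by
  -- The three diagonal derivatives cost at most 3 · 18M²‖u‖² through the Christoffel terms; the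
  -- extra 1 leaves ‖u‖² on the good side.
  set τ := 54 * M ^ 2 + 1 with hτ
  have hτ1 : 1 ≤ τ := by nlinarith [sq_nonneg M]
  have hτ0 : 0 < τ := by linarith
  have hinv : τ⁻¹ ≤ 1 := inv_le_one_of_one_le₀ hτ1
  have hinv0 : 0 < τ⁻¹ := inv_pos.2 hτ0
  set e := ‖B.symDiff u x‖
  set n := ‖u x‖ with hn
  have hsum : n ^ 2 = ∑ b, ‖u x b‖ ^ 2 := EuclideanSpace.norm_sq_eq _
  rw [coordDiv, Complex.re_sum]
  have h1 : ∑ b : Fin 3, expWeight τ x * (τ * ‖u x b‖ ^ 2 - (2 * e ^ 2 + 18 * M ^ 2 * n ^ 2)) ≤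
      ∑ b, (pd b (weightedSquare τ u b) x).re := by
    refine Finset.sum_le_sum fun b _ => le_trans ?_ (re_pd_weightedSquare_ge hτ0 hu b x)
    refine mul_le_mul_of_nonneg_left (sub_le_sub_left ?_ _) (expWeight_pos τ x).le
    have h2 := B.norm_pd_diag_le hM u b
    have h3 : ‖pd b (fun y => u y b) x‖ ^ 2 ≤ (e + 3 * M * n) ^ 2 :=
      pow_le_pow_left₀ (norm_nonneg _) h2 2
    have h4 : (e + 3 * M * n) ^ 2 ≤ 2 * e ^ 2 + 18 * M ^ 2 * n ^ 2 := by
      nlinarith [sq_nonneg (e - 3 * M * n)]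
    calc τ⁻¹ * ‖pd b (fun y => u y b) x‖ ^ 2 ≤ 1 * ‖pd b (fun y => u y b) x‖ ^ 2 :=
          mul_le_mul_of_nonneg_right hinv (sq_nonneg _)
      _ ≤ _ := by linarith
  refine le_trans (le_of_eq ?_) h1
  rw [← Finset.mul_sum, Finset.sum_sub_distrib, ← Finset.mul_sum, ← hsum]
  simp only [Finset.sum_const, Finset.card_univ, Fintype.card_fin, nsmul_eq_mul]
  rw [hτ]
  push_cast
  ring

theorem integrable_glue_coordDiv {X : Fin (B.k + 1) → Fin 3 → E3 → ℂ}
    (hX : ∀ j b, ContDiffOn ℝ 1 (X j b) B.regularSet) :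
    Integrable (glue B.D fun j => coordDiv (X j)) (volume.restrict B.Ω) := by
  unfold glue
  exact integrable_finsetSum _ fun j _ =>
    (B.integrableOn_coordDiv (hX j) 0).indicator (B.measurableSet_layer j)

theorem integrable_norm_sq {ι : Type} [Fintype ι] {w : FiberWeight (volume.restrict B.Ω) ι}
    (a : WL2 w) : Integrable (fun x => ‖a x‖ ^ 2) (volume.restrict B.Ω) :=
  (memLp_two_iff_integrable_sq_norm (Lp.aestronglyMeasurable a.toLp)).1 (Lp.memLp a.toLp)

/-- The unweighted Poincaré inequality. -/
theorem exists_poincare_toLp : ∃ C : ℝ, 0 ≤ C ∧ ∀ p ∈ B.strainGraph,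
    ‖WL2.toLp p.1‖ ^ 2 ≤ C * ‖WL2.toLp p.2‖ ^ 2 := by
  obtain ⟨M, hM0, hM⟩ := B.exists_christoffel_bound
  set τ := 54 * M ^ 2 + 1 with hτ
  have hK : IsCompact (closure B.Ω) := B.bounded.isCompact_closure
  have hcont : Continuous (expWeight τ) := (contDiff_expWeight τ).continuous
  obtain ⟨C₀, hC₀⟩ := hK.exists_bound_of_continuousOn hcont.continuousOn
  obtain ⟨c₀, hc₀⟩ := hK.exists_bound_of_continuousOn
    (hcont.inv₀ fun x => (expWeight_pos τ x).ne').continuousOn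
  have hC : ∀ x ∈ B.Ω, expWeight τ x ≤ max C₀ 0 := fun x hx =>
    ((le_abs_self _).trans (hC₀ x (subset_closure hx))).trans (le_max_left _ _)
  have hc : ∀ x ∈ B.Ω, (max c₀ 1)⁻¹ ≤ expWeight τ x := fun x hx => by
    have h1 : (expWeight τ x)⁻¹ ≤ max c₀ 1 :=
      ((le_abs_self _).trans (hc₀ x (subset_closure hx))).trans (le_max_left _ _)
    exact inv_le_of_inv_le₀ (expWeight_pos τ x) h1
  set m := max c₀ 1
  have hm : 0 < m := lt_of_lt_of_le one_pos (le_max_right _ _)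
  set N := max C₀ 0
  have hN : 0 ≤ N := le_max_right _ _
  refine ⟨m * (6 * N), by positivity, ?_⟩
  rintro p ⟨u, hu, hp1, hp2⟩
  have hX : ∀ j b, ContDiffOn ℝ 1 (weightedSquare τ (u j) b) B.regularSet := fun j b =>
    ((contDiff_weightedSquare τ (hu.1 j) b).of_le (by exact_mod_cast le_top)).contDiffOn
  -- This field depends on the values of u alone, so [u] = 0 and the Dirichlet condition suffice;
  -- the traction plays no role.
  have h0 := B.integral_glue_coordDiv (X := fun j => weightedSquare τ (u j)) hX
    (fun j x hx φ _ => by simp only [weightedSquare, hu.2.1 j x hx])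
    (fun x hx b => by simp [weightedSquare, hu.2.2.2 x hx])
  have hint := B.integrable_glue_coordDiv (X := fun j => weightedSquare τ (u j)) hX
  have hle : ∫ x in B.Ω, (m⁻¹ * ‖p.1 x‖ ^ 2 - 6 * N * ‖p.2 x‖ ^ 2) ≤
      ∫ x in B.Ω, (glue B.D (fun j => coordDiv (weightedSquare τ (u j))) x).re := by
    refine integral_mono_ae (((B.integrable_norm_sq p.1).const_mul _).sub
      ((B.integrable_norm_sq p.2).const_mul _)) hint.re ?_
    filter_upwards [hp1, hp2, ae_restrict_mem (B.isOpen 0).measurableSet] with x h1 h2 hx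
    obtain ⟨j, hj⟩ := B.exists_mem_layer hx
    change m⁻¹ * ‖p.1 x‖ ^ 2 - 6 * N * ‖p.2 x‖ ^ 2 ≤
      (glue B.D (fun j => coordDiv (weightedSquare τ (u j))) x).re
    rw [h1, h2, B.glue_eq _ hj, B.glue_eq _ hj, B.glue_eq _ hj]
    refine le_trans ?_ (B.re_coordDiv_weightedSquare_ge (hM x hx) (hu.1 j))
    rw [mul_sub]
    refine sub_le_sub (mul_le_mul_of_nonneg_right (hc x hx) (sq_nonneg _)) ?_
    calc _ = expWeight τ x * (6 * ‖B.symDiff (u j) x‖ ^ 2) := rfl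
      _ ≤ N * (6 * ‖B.symDiff (u j) x‖ ^ 2) :=
        mul_le_mul_of_nonneg_right (hC x hx) (by positivity)
      _ = _ := by ring
  have hre : ∫ x in B.Ω, (glue B.D (fun j => coordDiv (weightedSquare τ (u j))) x).re = 0 := by
    have h := integral_re hint
    rw [h0] at h
    exact h
  rw [hre, integral_sub ((B.integrable_norm_sq p.1).const_mul _)
    ((B.integrable_norm_sq p.2).const_mul _), integral_const_mul, integral_const_mul,
    ← WL2.norm_sq_eq_integral, ← WL2.norm_sq_eq_integral, sub_nonpos, inv_mul_le_iff₀ hm] at hle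
  linarith

/-- The Poincaré inequality: the strain of an admissible displacement controls its norm. -/
theorem exists_poincare : ∃ C : ℝ, 0 ≤ C ∧ ∀ p ∈ B.strainGraph, ‖p.1‖ ≤ C * ‖p.2‖ := by
  obtain ⟨C, hC, h⟩ := B.exists_poincare_toLp
  obtain ⟨c, hc, hl⟩ := WL2.exists_lower B.stiffnessWeight
  obtain ⟨K, hK, hu⟩ := WL2.exists_upper B.massWeight
  refine ⟨√(K * (C * c⁻¹)), Real.sqrt_nonneg _, fun p hp => ?_⟩
  refine abs_le_of_sq_le_sq' ?_ (by positivity) |>.2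
  rw [mul_pow, Real.sq_sqrt (by positivity), WL2.norm_sq, WL2.norm_sq]
  have h1 : ‖WL2.toLp p.2‖ ^ 2 ≤ c⁻¹ * (WL2.ip p.2 p.2).re := by
    rw [← div_eq_inv_mul, le_div_iff₀ hc, mul_comm]
    exact hl p.2
  calc (WL2.ip p.1 p.1).re ≤ K * ‖WL2.toLp p.1‖ ^ 2 := hu p.1
    _ ≤ K * (C * (c⁻¹ * (WL2.ip p.2 p.2).re)) := by
      refine mul_le_mul_of_nonneg_left ((h p hp).trans ?_) hK
      exact mul_le_mul_of_nonneg_left h1 hC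
    _ = _ := by ring

end ElasticBody

end

/-! ### Conclusion -/

open ElasticBody EnergySpace in
theorem mainTheorem10 (B : ElasticBody) :
    ∃ E A : B.L2 →ₗ.[ℂ] B.L2,
      -- `E` is the elastic operator on the admissible displacements; it is densely defined
      (∀ p : B.L2 × B.L2, p ∈ E.graph ↔
        ∃ u ∈ B.admissible, B.Represents p.1 u ∧ B.Represents p.2 fun j => B.elastic j (u j)) ∧
      (∀ u ∈ B.admissible, ∃ a ∈ E.domain, B.Represents a u) ∧
      Dense (E.domain : Set B.L2) ∧
      -- it is symmetric
      E.IsFormalAdjoint E ∧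
      -- and `A` is a self-adjoint extension of it
      E ≤ A ∧
      IsSelfAdjoint A ∧
      -- namely the one given by the energy form with zero Dirichlet data:
      -- `(-Au, v) = ∫ (λ δu δv + 2 μ ⟨dˢu, dˢv⟩) dVol`
      (∀ a : A.domain, ∃ e : B.StrainL2, ((a : B.L2), e) ∈ B.formSpace ∧
        ∀ p ∈ B.formSpace, inner ℂ (-A a) p.1 = inner ℂ e p.2) ∧
      -- the strain of a displacement of finite energy is well defined, and the energy space is a
      -- Hilbert space for the energy norm
      (∀ p ∈ B.formSpace, ∀ q ∈ B.formSpace, p.1 = q.1 → p = q) ∧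
      (∀ x : B.EnergySpace, ‖x‖ = 0 → x = 0) ∧
      CompleteSpace B.EnergySpace ∧
      -- the evolution operator `𝐄 (u₁, u₂) = (u₂, A u₁)` is densely defined and skew-adjoint on it
      Dense {x : B.EnergySpace | ∃ y, B.EvolEq A x y} ∧
      (∀ x y : B.EnergySpace, B.EvolEq A x y ↔
        ∀ z w, B.EvolEq A z w → inner ℂ w x = -inner ℂ z y) ∧
      -- it generates a strongly continuous unitary group `U`, which solves the Cauchy problem
      ∃ U : ℝ → (B.EnergySpace ≃ₗᵢ[ℂ] B.EnergySpace),
        (∀ s t, U (s + t) = U s * U t) ∧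
        (∀ x, Continuous fun t => U t x) ∧
        (∀ x y, B.EvolEq A x y ↔ HasDerivAt (fun t => U t x) y 0) ∧
        ∀ x y, B.EvolEq A x y →
          B.SolvesCauchy A (disp x) (vel x) (fun t => disp (U t x)) (fun t => vel (U t x)) ∧
          ∀ u v, B.SolvesCauchy A (disp x) (vel x) u v →
            u = (fun t => disp (U t x)) ∧ v = fun t => vel (U t x) := by
  obtain ⟨C, hC, hP⟩ := B.exists_poincare
  obtain ⟨E, A, hE, hdense, hsymm, hle, hA, hrest⟩ :=
    B.evolution_of_form B.elasticGraph (fun p hp => B.elasticGraph_green hp)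
      (fun p hp => B.strainGraph_green hp) B.dense_elasticGraph hC hP
  refine ⟨E, A, fun p => ?_, fun u hu => ?_, hdense, hsymm, hle, hA, hrest⟩
  · rw [hE]
    exact B.mem_elasticGraph
  · obtain ⟨p, hp, hpu⟩ := B.exists_mem_elasticGraph hu
    exact ⟨p.1, LinearPMap.mem_domain_iff.2 ⟨p.2, by rwa [hE]⟩, hpu⟩
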